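/- Let $\{p(\cdot\,|\,\theta):\theta\in\Theta\}$, $\Theta\subset\mathbb R^m$, be a family of probability densities with respect to a measure $\mu$ on a measurable space $\mathcal Z$, let $P_\theta$ be the law with density $p(\cdot\,|\,\theta)$, and let $z_1,\dots,z_n$ be i.i.d. from $P_\theta$. Let $\theta_0\in\operatorname{int}(\Theta)$. Suppose that the model is differentiable in quadratic mean at $\theta_0$, i.e. there is a score function $s:\mathcal Z\to\mathbb R^m$ with $$\int\Big[\sqrt{p(z|\theta_0+h)}-\sqrt{p(z|\theta_0)}-\tfrac12 h's(z)\sqrt{p(z|\theta_0)}\Big]^2d\mu(z)=o(\|h\|^2)\quad\text{as }h\to0,$$ and that the Fisher information matrix $J_0=E_{\theta_0}[ss']$ is nonsingular. Let $I_1,I_2\subset[0,1]$ (possibly overlapping) and put $N_1=I_1\cap I_2^c$, $N_2=I_2\cap I_1^c$, $N_{12}=I_1\cap I_2$. Suppose that $\frac1n\#\{i\le n:\frac in\in N_1\}\to\lambda_1>0$, $\frac1n\#\{i\le n:\frac in\in N_2\}\to\lambda_2>0$ and $\frac1n\#\{i\le n:\frac in\in N_{12}\}\to\lambda_{12}>0$.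 For each $n$ let $S_{1,n},S_{2,n}$ be real-valued statistics of $z_1,\dots,z_n$ such that $S_{k,n}$ depends only on the observations $z_i$ with $\frac in\in I_k$, $k=1,2$. Suppose that for every $h\in\mathbb R^m$ the pair $(S_{1,n},S_{2,n})$ converges in distribution, under the sequence of parameters $\theta_0+h/\sqrt n$, to a probability law $\mathcal L_h$ on $\mathbb R^2$. Then there are measurable functions $T_1,T_2:\mathbb R^m\times\mathbb R^m\times[0,1]\to\mathbb R$, not depending on $h$, such that for every $h\in\mathbb R^m$: if $Z_1\sim N(h,(\lambda_1J_0)^{-1})$, $Z_2\sim N(h,(\lambda_2J_0)^{-1})$, $Z_{12}\sim N(h,(\lambda_{12}J_0)^{-1})$ and $U\sim\mathrm{Unif}[0,1]$ are independent, then $$\big(T_1(Z_1,Z_{12},U),\;T_2(Z_2,Z_{12},U)\big)\sim\mathcal L_h .$$ -/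

import Mathlib

open MeasureTheory ProbabilityTheory Filter Topology

noncomputable section

/-- `p θ`, for `θ ∈ Θ`, are probability densities on `Z` with respect to the dominating
measure `μ`. Nothing is required of `p θ` for `θ ∉ Θ`. -/
structure IsDensityFamily {Z : Type*} [MeasurableSpace Z] {m : ℕ} (μ : Measure Z)
    (Θ : Set (EuclideanSpace ℝ (Fin m))) (p : EuclideanSpace ℝ (Fin m) → Z → ℝ) : Prop where
  measurable : ∀ θ ∈ Θ, Measurable (p θ)
  nonneg : ∀ θ ∈ Θ, ∀ z, 0 ≤ p θ z
  lintegral_eq_one : ∀ θ ∈ Θ, ∫⁻ z, ENNReal.ofReal (p θ z) ∂μ = 1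

/-- The law `P_θ` of a single observation: the measure with density `p θ` with respect to `μ`. -/
def obsLaw {Z : Type*} [MeasurableSpace Z] {m : ℕ} (μ : Measure Z)
    (p : EuclideanSpace ℝ (Fin m) → Z → ℝ) (θ : EuclideanSpace ℝ (Fin m)) : Measure Z :=
  μ.withDensity fun z => ENNReal.ofReal (p θ z)

/-- The law of an i.i.d. sample `(z_1, …, z_n)` from `P_θ`. -/
def sampleLaw {Z : Type*} [MeasurableSpace Z] {m : ℕ} (μ : Measure Z)
    (p : EuclideanSpace ℝ (Fin m) → Z → ℝ) (n : ℕ) (θ : EuclideanSpace ℝ (Fin m)) :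
    Measure (Fin n → Z) :=
  Measure.pi fun _ => obsLaw μ p θ

/-- Differentiability in quadratic mean of the model at `θ₀` with score function `s`:
`∫ (√p_{θ₀+h} - √p_{θ₀} - (1/2) h's √p_{θ₀})² dμ = o(‖h‖²)` as `h → 0`. The integral is the
`[0, ∞]`-valued one, so that its finiteness for small `h` is part of the condition. -/
def IsDQM {Z : Type*} [MeasurableSpace Z] {m : ℕ} (μ : Measure Z)
    (p : EuclideanSpace ℝ (Fin m) → Z → ℝ) (θ₀ : EuclideanSpace ℝ (Fin m))
    (s : Z → EuclideanSpace ℝ (Fin m)) : Prop :=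
  Measurable s ∧
  ∀ ε : ℝ, 0 < ε → ∀ᶠ h in 𝓝 (0 : EuclideanSpace ℝ (Fin m)),
    ∫⁻ z, ENNReal.ofReal
      ((√(p (θ₀ + h) z) - √(p θ₀ z) - 1 / 2 * inner ℝ h (s z) * √(p θ₀ z)) ^ 2) ∂μ
      ≤ ENNReal.ofReal (ε * ‖h‖ ^ 2)

/-- The Fisher information matrix `E_{θ₀}[s s']`. -/
def fisherInfo {Z : Type*} [MeasurableSpace Z] {m : ℕ} (μ : Measure Z)
    (p : EuclideanSpace ℝ (Fin m) → Z → ℝ) (θ₀ : EuclideanSpace ℝ (Fin m))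
    (s : Z → EuclideanSpace ℝ (Fin m)) : Matrix (Fin m) (Fin m) ℝ :=
  Matrix.of fun i j => ∫ z, s z i * s z j ∂(obsLaw μ p θ₀)

/-- The observations of a sample of size `n` whose position lies in `I`: the index `i : Fin n`
stands for the observation number `i + 1`, whose position is `(i + 1) / n`. -/
def infoIndices (I : Set ℝ) (n : ℕ) : Set (Fin n) :=
  {i | ((i : ℝ) + 1) / n ∈ I}

/-- The proportion of the observations whose position lies in `N` tends to `lam`. -/
def HasAsymptoticShare (N : Set ℝ) (lam : ℝ) : Prop :=
  Tendsto (fun n : ℕ => ((infoIndices N n).ncard : ℝ) / n) atTop (𝓝 lam)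

/-- The local parameter sequence `θ₀ + h / √n`. -/
def localParam {m : ℕ} (θ₀ h : EuclideanSpace ℝ (Fin m)) (n : ℕ) : EuclideanSpace ℝ (Fin m) :=
  θ₀ + (√(n : ℝ))⁻¹ • h

/-- Weak convergence, as `n → ∞`, of the laws of the pair `(S₁ n, S₂ n)` under the probability
measures `ν n` to `L`, through bounded continuous test functions. -/
def PairConvergesInLaw {Z : Type*} [MeasurableSpace Z] (ν : ∀ n : ℕ, Measure (Fin n → Z))
    (S₁ S₂ : ∀ n : ℕ, (Fin n → Z) → ℝ) (L : Measure (ℝ × ℝ)) : Prop :=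
  ∀ f : BoundedContinuousFunction (ℝ × ℝ) ℝ,
    Tendsto (fun n => ∫ x, f (S₁ n x, S₂ n x) ∂(ν n)) atTop (𝓝 (∫ y, f y ∂L))

/-- The law of `(Z₁, Z₂, Z₁₂, U)` for independent `Z₁ ∼ N(h, (lam₁ J)⁻¹)`,
`Z₂ ∼ N(h, (lam₂ J)⁻¹)`, `Z₁₂ ∼ N(h, (lam₁₂ J)⁻¹)` and `U ∼ Unif[0,1]`. -/
def limitExperiment {m : ℕ} (J : Matrix (Fin m) (Fin m) ℝ) (lam₁ lam₂ lam₁₂ : ℝ)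
    (h : EuclideanSpace ℝ (Fin m)) :
    Measure (EuclideanSpace ℝ (Fin m) × EuclideanSpace ℝ (Fin m) ×
      EuclideanSpace ℝ (Fin m) × ℝ) :=
  (multivariateGaussian h (lam₁ • J)⁻¹).prod
    ((multivariateGaussian h (lam₂ • J)⁻¹).prod
      ((multivariateGaussian h (lam₁₂ • J)⁻¹).prod
        (volume.restrict (Set.Icc (0 : ℝ) 1))))

end

/-!
Fix truncated, centred scores `u_n` at `θ₀` and, for a set `A` of indices, the score sum
`D_A = n^{-1/2} ∑_{i ∈ A} u_n(z_i)`. A Hellinger comparison, valid under differentiability in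
quadratic mean, replaces the law of the sample under `θ₀ + h / √n` by its law under `θ₀` tilted
by `exp ⟪h, D⟫`, up to a normalising constant. Everything then happens under the single parameter
`θ₀`.

Given the shared observations, the pairs `(D₁, S₁)` and `(D₂, S₂)`, where `D₁`, `D₂`, `D₀` are the
score sums over `N₁`, `N₂`, `N₁₂`, are independent. Conditional independence does not survive weak
limits, so one passes to the limit with the random conditional laws `κ₁`, `κ₂` of these pairs
instead: `(κ₁, κ₂, D₀)` is a random element of a compact metrizable space once infinite values are
allowed, and its law has a limit point. The `D`-marginals of `κ₁`, `κ₂` are deterministic, with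
Gaussian limits, and the tilted means converge because the tilts are uniformly integrable.
Generating `(κ₁, κ₂)` from `D₀` and one part of the uniform variable, then `S₁` from `κ₁` given
`D₁` and `S₂` from `κ₂` given `D₂` with two other independent parts, gives measurable functions of
`(D₁, D₀, U)` and `(D₂, D₀, U)` that realise this limit.

Finally, tilting `N(0, λ J)` by `exp ⟪h, ·⟫` gives `N(λ J h, λ J)` up to a constant
(Cameron–Martin), which is the law of `λ J Z` for `Z ∼ N(h, (λ J)⁻¹)`.
-/

noncomputable section

section ProbabilityMeasureSpace

open TopologicalSpace
open scoped ENNReal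

theorem polishSpace_of_compact_metrizable (A : Type*) [TopologicalSpace A] [CompactSpace A]
    [MetrizableSpace A] : PolishSpace A := by
  let _ : MetricSpace A := metrizableSpaceMetric A
  infer_instance

/-- The Markov kernel which samples from a probability law given as a parameter. -/
def lawKernel (A : Type*) [MeasurableSpace A] : Kernel (ProbabilityMeasure A) A :=
  ⟨fun κ => (κ : Measure A), measurable_subtype_coe⟩

@[simp] theorem lawKernel_apply {A : Type*} [MeasurableSpace A] (κ : ProbabilityMeasure A) :
    lawKernel A κ = (κ : Measure A) := rfl

instance isMarkovKernel_lawKernel {A : Type*} [MeasurableSpace A] :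
    IsMarkovKernel (lawKernel A) :=
  ⟨fun κ => by rw [lawKernel_apply]; infer_instance⟩

theorem measurable_lintegral_probabilityMeasure {A : Type*} [MeasurableSpace A] {f : A → ℝ≥0∞}
    (hf : Measurable f) :
    Measurable fun κ : ProbabilityMeasure A => ∫⁻ x, f x ∂(κ : Measure A) :=
  (Measure.measurable_lintegral hf).comp measurable_subtype_coe

variable {K : Type*} [TopologicalSpace K] [MeasurableSpace K] [BorelSpace K]

theorem measurable_integral_probabilityMeasure (f : C(K, ℝ)) :
    Measurable fun κ : ProbabilityMeasure K => ∫ x, f x ∂(κ : Measure K) :=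
  (StronglyMeasurable.integral_kernel (κ := lawKernel K)
    f.continuous.measurable.stronglyMeasurable).measurable

section Compact

variable [CompactSpace K]

/-- The preimages of open sets under integration of continuous functions: the standard subbasis of
the weak topology on the probability measures on a compact space. -/
def integralSubbasis (K : Type*) [TopologicalSpace K] [MeasurableSpace K] :
    Set (Set (ProbabilityMeasure K)) :=
  {s | ∃ (f : C(K, ℝ)) (u : Set ℝ), IsOpen u ∧
    s = (fun κ : ProbabilityMeasure K => ∫ x, f x ∂(κ : Measure K)) ⁻¹' u}

theorem probabilityMeasure_topology_eq_generateFrom :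
    (inferInstance : TopologicalSpace (ProbabilityMeasure K)) = .generateFrom
      (integralSubbasis K) := by
  refine le_antisymm (le_generateFrom ?_) ?_
  · rintro s ⟨f, u, hu, rfl⟩
    exact hu.preimage (ProbabilityMeasure.continuous_integral_continuousMap f)
  · rw [← continuous_id_iff_le]
    let _ : TopologicalSpace (ProbabilityMeasure K) := .generateFrom (integralSubbasis K)
    refine ProbabilityMeasure.continuous_iff_forall_continuousMap_continuous_integral.2 fun f => ?_
    exact continuous_def.2 fun u hu => isOpen_generateFrom_of_mem ⟨f, u, hu, rfl⟩

theorem ae_eq_of_tendsto_of_ae_eq {Y ι : Type*} [TopologicalSpace Y]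
    [MetrizableSpace Y] {F : Filter ι} [F.NeBot] {G : ι → ProbabilityMeasure K}
    {G₀ : ProbabilityMeasure K} (hG : Tendsto G F (𝓝 G₀)) {g : K → Y} (hg : Continuous g)
    {y : ι → Y} {y₀ : Y} (hy : Tendsto y F (𝓝 y₀)) (hae : ∀ n, ∀ᵐ x ∂(G n : Measure K), g x = y n) :
    ∀ᵐ x ∂(G₀ : Measure K), g x = y₀ := by
  let _ : MetricSpace Y := metrizableSpaceMetric Y
  let φ : C(K, ℝ) := ⟨fun x => dist (g x) y₀, by fun_prop⟩
  have h_integral (n : ι) : ∫ x, φ x ∂(G n : Measure K) = dist (y n) y₀ := by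
    have h_ae : (φ : K → ℝ) =ᵐ[(G n : Measure K)] fun _ => dist (y n) y₀ :=
      (hae n).mono fun x hx => congrArg (dist · y₀) hx
    rw [integral_congr_ae h_ae, integral_const, probReal_univ, one_smul]
  have h_zero : ∫ x, φ x ∂(G₀ : Measure K) = 0 :=
    tendsto_nhds_unique (((ProbabilityMeasure.continuous_integral_continuousMap φ).tendsto _).comp
      hG) ((tendsto_iff_dist_tendsto_zero.1 hy).congr fun n => (h_integral n).symm)
  rw [integral_eq_zero_iff_of_nonneg (f := φ) (fun x => dist_nonneg)
    ((BoundedContinuousFunction.mkOfCompact φ).integrable _)] at h_zero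
  exact h_zero.mono fun x hx => dist_eq_zero.1 hx

end Compact

variable [MetrizableSpace K]

theorem giry_le_borel_probabilityMeasure :
    (inferInstance : MeasurableSpace (ProbabilityMeasure K)) ≤ borel (ProbabilityMeasure K) := by
  have hcoe : @Measurable _ _ (borel (ProbabilityMeasure K)) _
      (fun κ : ProbabilityMeasure K => (κ : Measure K)) := by
    let _ : MeasurableSpace (ProbabilityMeasure K) := borel _
    have : BorelSpace (ProbabilityMeasure K) := ⟨rfl⟩
    refine Measurable.measure_of_isPiSystem_of_isProbabilityMeasure
      (S := {s | IsClosed s})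
      (by rw [← borel_eq_generateFrom_isClosed]; exact BorelSpace.measurable_eq)
      isPiSystem_isClosed fun F hF => ?_
    refine measurable_of_tendsto_metrizable
      (f := fun n (κ : ProbabilityMeasure K) => ∫⁻ x, hF.apprSeq n x ∂(κ : Measure K))
      (fun n => (ProbabilityMeasure.continuous_lintegral_boundedContinuousFunction
        (hF.apprSeq n)).measurable) ?_
    exact tendsto_pi_nhds.2 fun κ => HasOuterApproxClosed.tendsto_lintegral_apprSeq hF κ
  rintro - ⟨t, ht, rfl⟩
  exact hcoe ht

variable [CompactSpace K]

instance secondCountableTopology_probabilityMeasure :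
    SecondCountableTopology (ProbabilityMeasure K) :=
  have := polishSpace_of_compact_metrizable K
  have := polishSpace_of_compact_metrizable (ProbabilityMeasure K)
  inferInstance

instance borelSpace_probabilityMeasure : BorelSpace (ProbabilityMeasure K) := by
  refine ⟨le_antisymm giry_le_borel_probabilityMeasure ?_⟩
  rw [borel_eq_generateFrom_of_subbasis probabilityMeasure_topology_eq_generateFrom]
  refine MeasurableSpace.generateFrom_le ?_
  rintro s ⟨f, u, hu, rfl⟩
  exact measurable_integral_probabilityMeasure f hu.measurableSet

end ProbabilityMeasureSpace

section NoiseOutsourcing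

open scoped ENNReal unitInterval

variable {α β Ω : Type*} [MeasurableSpace α] [MeasurableSpace β] [MeasurableSpace Ω]
  [StandardBorelSpace Ω] [Nonempty Ω]

theorem exists_measurable_map_prod_uniform_kernel
    [MeasurableSpace.CountableOrCountablyGenerated α β] (η : Kernel α (β × Ω)) [IsMarkovKernel η] :
    ∃ φ : α → β × I → Ω, Measurable (Function.uncurry φ) ∧
      ∀ a, ((η a).fst.prod volume).map (fun p => (p.1, φ a p)) = η a := by
  obtain ⟨φ, hφ, hφ_map⟩ := Kernel.exists_measurable_map_eq_unitInterval η.condKernel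
  refine ⟨fun a p => φ (a, p.1) p.2, by fun_prop,
    fun a => Measure.ext_of_lintegral _ fun F hF => ?_⟩
  calc ∫⁻ y, F y ∂((η a).fst.prod volume).map (fun p => (p.1, φ (a, p.1) p.2))
      = ∫⁻ b, (∫⁻ u, F (b, φ (a, b) u)) ∂(η a).fst := by
        rw [lintegral_map hF (by fun_prop), lintegral_prod _ (by fun_prop)]
    _ = ∫⁻ b, ∫⁻ w, F (b, w) ∂(η.condKernel (a, b)) ∂(η.fst a) := by
        rw [Kernel.fst_apply, Measure.fst]
        refine lintegral_congr fun b => ?_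
        rw [← hφ_map, lintegral_map (by fun_prop) (by fun_prop)]
    _ = ∫⁻ y, F y ∂(η a) := by
        rw [← Kernel.lintegral_compProd _ _ _ hF, η.disintegrate]

theorem exists_measurable_map_prod_uniform (ρ : Measure (β × Ω)) [IsProbabilityMeasure ρ] :
    ∃ ψ : β × I → Ω, Measurable ψ ∧ (ρ.fst.prod volume).map (fun p => (p.1, ψ p)) = ρ := by
  obtain ⟨φ, hφ, hφ_map⟩ := exists_measurable_map_prod_uniform_kernel (Kernel.const Unit ρ)
  exact ⟨φ (), by fun_prop, hφ_map ()⟩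

theorem lintegral_prod_prod_mul {ξ : Type*} [MeasurableSpace ξ] {γ₁ : Measure α} {γ₂ : Measure β}
    {ν : Measure ξ} [SFinite γ₁] [SFinite γ₂] [SFinite ν] {f₁ : α × ξ → ℝ≥0∞} {f₂ : β × ξ → ℝ≥0∞}
    {f₀ : ξ → ℝ≥0∞} (hf₁ : Measurable f₁) (hf₂ : Measurable f₂) (hf₀ : Measurable f₀) :
    ∫⁻ ω, f₁ (ω.1, ω.2.2) * f₂ (ω.2.1, ω.2.2) * f₀ ω.2.2 ∂(γ₁.prod (γ₂.prod ν)) =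
      ∫⁻ w, (∫⁻ x, f₁ (x, w) ∂γ₁) * (∫⁻ y, f₂ (y, w) ∂γ₂) * f₀ w ∂ν := by
  have : Measurable fun w => ∫⁻ y, f₂ (y, w) ∂γ₂ := hf₂.lintegral_prod_left'
  calc _ = ∫⁻ x, ∫⁻ w, f₁ (x, w) * ((∫⁻ y, f₂ (y, w) ∂γ₂) * f₀ w) ∂ν ∂γ₁ := by
        rw [lintegral_prod _ (by fun_prop)]
        refine lintegral_congr fun x => ?_
        rw [lintegral_prod_symm _ (by fun_prop)]
        refine lintegral_congr fun w => ?_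
        simp only [mul_assoc]
        rw [lintegral_const_mul _ (by fun_prop), lintegral_mul_const _ (by fun_prop)]
    _ = _ := by
        rw [lintegral_lintegral_swap (by fun_prop)]
        refine lintegral_congr fun w => ?_
        rw [lintegral_mul_const _ (by fun_prop), mul_assoc]

theorem lintegral_prod_splitNoise {ξ : Type*} [MeasurableSpace ξ] {γ₁ : Measure α} {γ₂ : Measure β}
    {γ₀ : Measure ξ} [SFinite γ₁] [SFinite γ₂] [SFinite γ₀] {g : I → I × I × I} (hg : Measurable g)
    (hg_map : (volume : Measure I).map g = volume.prod (volume.prod volume))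
    {f₁ : (α × I) × ξ × I → ℝ≥0∞} {f₂ : (β × I) × ξ × I → ℝ≥0∞} {f₀ : ξ → ℝ≥0∞}
    (hf₁ : Measurable f₁) (hf₂ : Measurable f₂) (hf₀ : Measurable f₀) :
    ∫⁻ ω, f₁ ((ω.1, (g ω.2.2.2).1), ω.2.2.1, (g ω.2.2.2).2.2) *
        f₂ ((ω.2.1, (g ω.2.2.2).2.1), ω.2.2.1, (g ω.2.2.2).2.2) * f₀ ω.2.2.1
          ∂(γ₁.prod (γ₂.prod (γ₀.prod volume))) =
      ∫⁻ w, (∫⁻ x, f₁ (x, w) ∂(γ₁.prod volume)) * (∫⁻ y, f₂ (y, w) ∂(γ₂.prod volume)) * f₀ w.1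
        ∂(γ₀.prod volume) := by
  set a : α × ξ × I → ℝ≥0∞ := fun p => ∫⁻ u, f₁ ((p.1, u), p.2)
  set b : β × ξ × I → ℝ≥0∞ := fun p => ∫⁻ u, f₂ ((p.1, u), p.2)
  have ha : Measurable a :=
    Measurable.lintegral_prod_right' (f := fun q : (α × ξ × I) × I => f₁ ((q.1.1, q.2), q.1.2))
      (by fun_prop)
  have hb : Measurable b :=
    Measurable.lintegral_prod_right' (f := fun q : (β × ξ × I) × I => f₂ ((q.1.1, q.2), q.1.2))
      (by fun_prop)
  have h_noise (x : α) (y : β) (d : ξ) :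
      ∫⁻ u, f₁ ((x, (g u).1), d, (g u).2.2) * f₂ ((y, (g u).2.1), d, (g u).2.2) * f₀ d =
        ∫⁻ w, a (x, d, w) * b (y, d, w) * f₀ d := by
    rw [← lintegral_map (f := fun v : I × I × I => f₁ ((x, v.1), d, v.2.2) *
      f₂ ((y, v.2.1), d, v.2.2) * f₀ d) (by fun_prop) hg, hg_map]
    exact lintegral_prod_prod_mul (f₁ := fun q : I × I => f₁ ((x, q.1), d, q.2))
      (f₂ := fun q : I × I => f₂ ((y, q.1), d, q.2)) (f₀ := fun _ => f₀ d) (by fun_prop)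
      (by fun_prop) measurable_const
  calc _ = ∫⁻ ω, a (ω.1, ω.2.2) * b (ω.2.1, ω.2.2) * f₀ ω.2.2.1
          ∂(γ₁.prod (γ₂.prod (γ₀.prod volume))) := by
        rw [lintegral_prod _ (by fun_prop), lintegral_prod _ (by fun_prop)]
        refine lintegral_congr fun x => ?_
        rw [lintegral_prod _ (by fun_prop), lintegral_prod _ (by fun_prop)]
        refine lintegral_congr fun y => ?_
        rw [lintegral_prod _ (by fun_prop), lintegral_prod _ (by fun_prop)]
        exact lintegral_congr fun d => h_noise x y d
    _ = ∫⁻ w, (∫⁻ x, a (x, w) ∂γ₁) * (∫⁻ y, b (y, w) ∂γ₂) * f₀ w.1 ∂(γ₀.prod volume) :=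
        lintegral_prod_prod_mul ha hb (hf₀.comp measurable_fst)
    _ = _ := by
        refine lintegral_congr fun w => ?_
        rw [lintegral_prod _ (by fun_prop), lintegral_prod _ (by fun_prop)]

end NoiseOutsourcing

section RandomLaws

open scoped ENNReal unitInterval

/-- Pairs of laws on `K × S` together with a point of `K`. The intended elements are the conditional
laws of `(D₁, S₁)` and of `(D₂, S₂)` given the shared observations, with the score sum of the shared
observations. -/
abbrev LawSpace (K S : Type*) [MeasurableSpace K] [MeasurableSpace S] : Type _ :=
  ProbabilityMeasure (K × S) × ProbabilityMeasure (K × S) × K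

/-- `HasMarginals G c₁ c₂ c₀`: under `G`, the `K`-marginals of the two random laws on `K × S` are
almost surely the fixed laws `c₁` and `c₂`, and the random point of `K` has law `c₀`. -/
structure HasMarginals {K S : Type*} [MeasurableSpace K] [MeasurableSpace S]
    (G : ProbabilityMeasure (LawSpace K S)) (c₁ c₂ c₀ : ProbabilityMeasure K) : Prop where
  fst : ∀ᵐ x ∂(G : Measure (LawSpace K S)), x.1.map measurable_fst.aemeasurable = c₁
  snd : ∀ᵐ x ∂(G : Measure (LawSpace K S)), x.2.1.map measurable_fst.aemeasurable = c₂
  shared : G.map (measurable_snd.comp measurable_snd).aemeasurable = c₀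

theorem measurable_lintegral_lawSpace {K S : Type*} [MeasurableSpace K] [MeasurableSpace S]
    {F₁ F₂ : K × S → ℝ≥0∞} {F₀ : K → ℝ≥0∞} (hF₁ : Measurable F₁) (hF₂ : Measurable F₂)
    (hF₀ : Measurable F₀) :
    Measurable fun x : LawSpace K S => (∫⁻ y, F₁ y ∂(x.1 : Measure (K × S))) *
      (∫⁻ y, F₂ y ∂(x.2.1 : Measure (K × S))) * F₀ x.2.2 :=
  (((measurable_lintegral_probabilityMeasure hF₁).comp measurable_fst).mul
    ((measurable_lintegral_probabilityMeasure hF₂).comp (by fun_prop))).mul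
    (hF₀.comp (by fun_prop))

variable {K S : Type*} [TopologicalSpace K] [CompactSpace K] [TopologicalSpace.MetrizableSpace K]
  [MeasurableSpace K] [BorelSpace K] [Nonempty K]
  [TopologicalSpace S] [CompactSpace S] [TopologicalSpace.MetrizableSpace S]
  [MeasurableSpace S] [BorelSpace S] [Nonempty S]

theorem exists_sampler_of_lawSpace (G : ProbabilityMeasure (LawSpace K S)) :
    ∃ ψ : K × I → ProbabilityMeasure (K × S) × ProbabilityMeasure (K × S), Measurable ψ ∧
      (((G : Measure (LawSpace K S)).map (fun x => x.2.2)).prod volume).map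
        (fun p => ((ψ p).1, (ψ p).2, p.1)) = G := by
  have := polishSpace_of_compact_metrizable K
  have := polishSpace_of_compact_metrizable S
  have := polishSpace_of_compact_metrizable (ProbabilityMeasure (K × S))
  have : Nonempty (ProbabilityMeasure (K × S)) := ⟨diracProba (Classical.arbitrary _)⟩
  set ρ : Measure (K × ProbabilityMeasure (K × S) × ProbabilityMeasure (K × S)) :=
    (G : Measure (LawSpace K S)).map (fun x => (x.2.2, x.1, x.2.1)) with hρ
  have : IsProbabilityMeasure ρ := Measure.isProbabilityMeasure_map (by fun_prop)
  obtain ⟨ψ, hψ, hψ_map⟩ := exists_measurable_map_prod_uniform ρ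
  refine ⟨ψ, hψ, ?_⟩
  have h_fst : ρ.fst = (G : Measure (LawSpace K S)).map (fun x => x.2.2) := by
    rw [Measure.fst, hρ, Measure.map_map measurable_fst (by fun_prop)]
    rfl
  have h := congrArg (Measure.map fun q => (q.2.1, q.2.2, q.1)) hψ_map
  rw [Measure.map_map (by fun_prop) (by fun_prop), h_fst, hρ,
    Measure.map_map (by fun_prop) (by fun_prop)] at h
  exact h.trans Measure.map_id

theorem HasMarginals.exists_sampler {G : ProbabilityMeasure (LawSpace K S)}
    {γ₁ γ₂ γ₀ : ProbabilityMeasure K} (hG : HasMarginals G γ₁ γ₂ γ₀) :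
    ∃ T₁ T₂ : K → K → I → S,
      Measurable (fun x : K × K × I => T₁ x.1 x.2.1 x.2.2) ∧
      Measurable (fun x : K × K × I => T₂ x.1 x.2.1 x.2.2) ∧
      ∀ F₁ F₂ : K × S → ℝ≥0∞, Measurable F₁ → Measurable F₂ → ∀ F₀ : K → ℝ≥0∞, Measurable F₀ →
        ∫⁻ ω, F₁ (ω.1, T₁ ω.1 ω.2.2.1 ω.2.2.2) * F₂ (ω.2.1, T₂ ω.2.1 ω.2.2.1 ω.2.2.2) *
            F₀ ω.2.2.1 ∂((γ₁ : Measure K).prod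
            ((γ₂ : Measure K).prod ((γ₀ : Measure K).prod (volume : Measure I)))) =
          ∫⁻ x, (∫⁻ y, F₁ y ∂(x.1 : Measure (K × S))) * (∫⁻ y, F₂ y ∂(x.2.1 : Measure (K × S))) *
            F₀ x.2.2 ∂(G : Measure (LawSpace K S)) := by
  have := polishSpace_of_compact_metrizable K
  have := polishSpace_of_compact_metrizable S
  obtain ⟨φ, hφ, hφ_map⟩ := exists_measurable_map_prod_uniform_kernel (lawKernel (K × S))
  obtain ⟨ψ, hψ, hψ_map⟩ := exists_sampler_of_lawSpace G
  obtain ⟨g, hg, hg_map⟩ := Measure.exists_measurable_map_eq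
    ((volume : Measure I).prod ((volume : Measure I).prod (volume : Measure I)))
  have h_shared : (G : Measure (LawSpace K S)).map (fun x => x.2.2) = γ₀ :=
    congrArg ProbabilityMeasure.toMeasure hG.shared
  rw [h_shared] at hψ_map
  refine ⟨fun d₁ d₀ u => φ (ψ (d₀, (g u).2.2)).1 (d₁, (g u).1),
    fun d₂ d₀ u => φ (ψ (d₀, (g u).2.2)).2 (d₂, (g u).2.1), by fun_prop, by fun_prop,
    fun F₁ F₂ hF₁ hF₂ F₀ hF₀ => ?_⟩
  have h_sample {γ : ProbabilityMeasure K} {κ : ProbabilityMeasure (K × S)} {F : K × S → ℝ≥0∞}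
      (hF : Measurable F) (hκ : κ.map measurable_fst.aemeasurable = γ) :
      ∫⁻ x, F (x.1, φ κ x) ∂((γ : Measure K).prod volume) = ∫⁻ y, F y ∂(κ : Measure (K × S)) := by
    conv_rhs => rw [← lawKernel_apply, ← hφ_map κ, lintegral_map hF (by fun_prop)]
    rw [← hκ]
    rfl
  rw [lintegral_prod_splitNoise hg hg_map (f₁ := fun q => F₁ (q.1.1, φ (ψ q.2).1 q.1))
    (f₂ := fun q => F₂ (q.1.1, φ (ψ q.2).2 q.1)) (by fun_prop) (by fun_prop) hF₀]
  have h_fst := hG.fst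
  have h_snd := hG.snd
  rw [← hψ_map] at h_fst h_snd ⊢
  rw [lintegral_map (measurable_lintegral_lawSpace hF₁ hF₂ hF₀) (by fun_prop)]
  refine lintegral_congr_ae ?_
  filter_upwards [ae_of_ae_map (by fun_prop) h_fst, ae_of_ae_map (by fun_prop) h_snd] with p hp₁ hp₂
  rw [h_sample hF₁ hp₁, h_sample hF₂ hp₂]

end RandomLaws

section Truncation

open scoped NNReal ENNReal

section ExpTilt

variable {E : Type*} [NormedAddCommGroup E] [InnerProductSpace ℝ E]

/-- The exponential tilt `exp ⟪h, d⟫`, the density which turns a law into the member with parameter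
`h` of the exponential family it generates, up to normalisation. -/
def expTilt (h d : E) : ℝ≥0∞ :=
  ENNReal.ofReal (Real.exp (inner ℝ h d))

@[fun_prop]
theorem measurable_expTilt [MeasurableSpace E] [OpensMeasurableSpace E] (h : E) :
    Measurable (expTilt h) :=
  ENNReal.measurable_ofReal.comp (Continuous.measurable (by fun_prop))

theorem expTilt_add (h d e : E) : expTilt h (d + e) = expTilt h d * expTilt h e := by
  rw [expTilt, inner_add_right, Real.exp_add, ENNReal.ofReal_mul (Real.exp_nonneg _)]
  rfl

end ExpTilt

/-- Clamping of an extended real to `[-R, R]`, the truncation that makes exponential tilts bounded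
and continuous. -/
def clampReal (R : ℝ) (x : EReal) : ℝ := (max (-R : EReal) (min (R : EReal) x)).toReal

theorem continuous_clampReal (R : ℝ) : Continuous (clampReal R) := by
  refine EReal.continuousOn_toReal.comp_continuous (by fun_prop) fun x => ?_
  have h_bot : max (-R : EReal) (min (R : EReal) x) ≠ ⊥ :=
    ((EReal.bot_lt_coe (-R)).trans_le (le_max_left _ _)).ne'
  have h_top : max (-R : EReal) (min (R : EReal) x) ≠ ⊤ :=
    (max_lt (EReal.coe_lt_top (-R)) ((min_le_left _ _).trans_lt (EReal.coe_lt_top R))).ne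
  simp [h_bot, h_top]

theorem clampReal_coe (R x : ℝ) : clampReal R x = max (-R) (min R x) := by
  have hmono : Monotone ((↑) : ℝ → EReal) := EReal.coe_strictMono.monotone
  rw [clampReal, ← EReal.coe_neg, ← hmono.map_min, ← hmono.map_max, EReal.toReal_coe]

variable {m : ℕ}

/-- The coordinatewise embedding of `ℝᵐ` into the compact space `[-∞, ∞]ᵐ`, in which laws always
have weak limit points. -/
def embEReal (d : EuclideanSpace ℝ (Fin m)) : Fin m → EReal := fun i => (d i : EReal)

theorem injective_embEReal : Function.Injective (embEReal (m := m)) := fun _ _ h =>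
  PiLp.ext fun i => EReal.coe_injective (congrFun h i)

theorem continuous_embEReal : Continuous (embEReal (m := m)) :=
  continuous_pi fun i => continuous_coe_real_ereal.comp (by fun_prop)

/-- The tilt `exp (h'd)`, infinite coordinates of `d` counting as `0`: the extension of `expTilt h`
to the compactification. -/
def extTilt (h : EuclideanSpace ℝ (Fin m)) (d : Fin m → EReal) : ℝ≥0∞ :=
  ENNReal.ofReal (Real.exp (∑ i, h i * (d i).toReal))

/-- The tilt with coordinates clamped to `[-R, R]`: a bounded continuous approximation of
`extTilt`. -/
def tiltTrunc (R : ℝ) (h : EuclideanSpace ℝ (Fin m)) (d : Fin m → EReal) : ℝ≥0 :=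
  (Real.exp (∑ i, h i * clampReal R (d i))).toNNReal

open Classical in
/-- The envelope `exp (C ∑ |dᵢ|)`, which controls the error made by truncating tilts. It is infinite
at infinite points, so that the comparisons below hold everywhere. -/
def expEnvelope (C : ℝ) (d : Fin m → EReal) : ℝ≥0∞ :=
  if d ∈ Set.range embEReal then ENNReal.ofReal (Real.exp (C * ∑ i, |(d i).toReal|)) else ∞

theorem extTilt_embEReal (h d : EuclideanSpace ℝ (Fin m)) :
    extTilt h (embEReal d) = expTilt h d := by
  simp only [extTilt, expTilt, embEReal, EReal.toReal_coe, PiLp.inner_apply, RCLike.inner_apply,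
    conj_trivial, mul_comm]

theorem expEnvelope_embEReal (C : ℝ) (d : EuclideanSpace ℝ (Fin m)) :
    expEnvelope C (embEReal d) = ENNReal.ofReal (Real.exp (C * ∑ i, |d i|)) := by
  simp only [expEnvelope, Set.mem_range_self, if_true, embEReal, EReal.toReal_coe]

theorem expEnvelope_of_notMem_range {d : Fin m → EReal} (hd : d ∉ Set.range embEReal) (C : ℝ) :
    expEnvelope C d = ∞ := if_neg hd

@[fun_prop] theorem measurable_extTilt (h : EuclideanSpace ℝ (Fin m)) : Measurable (extTilt h) := by
  unfold extTilt
  fun_prop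

@[fun_prop] theorem measurable_expEnvelope (C : ℝ) : Measurable (expEnvelope (m := m) C) := by
  have h_emb : MeasurableEmbedding (embEReal (m := m)) :=
    continuous_embEReal.measurableEmbedding injective_embEReal
  exact Measurable.ite h_emb.measurableSet_range (by fun_prop) measurable_const

theorem continuous_tiltTrunc (R : ℝ) (h : EuclideanSpace ℝ (Fin m)) :
    Continuous (tiltTrunc R h) := by
  unfold tiltTrunc
  have : ∀ i, Continuous fun d : Fin m → EReal => clampReal R (d i) := fun i =>
    (continuous_clampReal R).comp (continuous_apply i)
  fun_prop

theorem exp_sum_le_exp_mul_sum_abs {h x y : Fin m → ℝ} {C : ℝ} (hC : ∑ i, |h i| ≤ C)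
    (hxy : ∀ i, |x i| ≤ |y i|) :
    Real.exp (∑ i, h i * x i) ≤ Real.exp (C * ∑ i, |y i|) := by
  apply Real.exp_le_exp.2
  calc ∑ i, h i * x i ≤ ∑ i, |h i| * ∑ j, |y j| := by
        refine Finset.sum_le_sum fun i _ => ?_
        calc h i * x i ≤ |h i * x i| := le_abs_self _
          _ = |h i| * |x i| := abs_mul _ _
          _ ≤ |h i| * |y i| := mul_le_mul_of_nonneg_left (hxy i) (abs_nonneg _)
          _ ≤ |h i| * ∑ j, |y j| := by
            gcongr
            exact Finset.single_le_sum (f := fun j => |y j|) (fun j _ => abs_nonneg _)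
              (Finset.mem_univ i)
    _ = (∑ i, |h i|) * ∑ j, |y j| := by rw [Finset.sum_mul]
    _ ≤ C * ∑ j, |y j| := by gcongr

theorem abs_max_neg_min_le {R : ℝ} (hR : 0 ≤ R) (x : ℝ) : |max (-R) (min R x)| ≤ |x| := by
  rw [abs_le]
  constructor
  · rcases le_total 0 x with h | h
    · have : 0 ≤ max (-R) (min R x) := le_max_of_le_right (le_min hR h)
      linarith [abs_nonneg x]
    · rw [abs_of_nonpos h, neg_neg]
      exact le_max_of_le_right (le_min (h.trans hR) le_rfl)
  · exact max_le (by linarith [abs_nonneg x]) ((min_le_right _ _).trans (le_abs_self x))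

theorem max_neg_min_eq_self {R x : ℝ} (h : |x| ≤ R) : max (-R) (min R x) = x := by
  rw [abs_le] at h
  rw [min_eq_right h.2, max_eq_right h.1]

theorem exp_sum_le_exp_sum_add (h : Fin m → ℝ) {x x' z : Fin m → ℝ} {R : ℝ}
    (hx : ∀ i, |x i| ≤ |z i|) (heq : (∀ i, |z i| ≤ R) → x = x') :
    Real.exp (∑ i, h i * x i) ≤ Real.exp (∑ i, h i * x' i) +
      Real.exp (-R) * Real.exp ((∑ i, |h i| + 1) * ∑ i, |z i|) := by
  by_cases hz : ∀ i, |z i| ≤ R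
  · rw [heq hz]
    have := mul_pos (Real.exp_pos (-R)) (Real.exp_pos ((∑ i, |h i| + 1) * ∑ i, |z i|))
    linarith
  · push Not at hz
    obtain ⟨j, hj⟩ := hz
    have h_tail := exp_sum_le_exp_mul_sum_abs (h := h) le_rfl hx
    have h_R : R ≤ ∑ i, |z i| := hj.le.trans
      (Finset.single_le_sum (f := fun j => |z j|) (fun j _ => abs_nonneg _) (Finset.mem_univ j))
    have h_gain : Real.exp ((∑ i, |h i|) * ∑ i, |z i|) ≤
        Real.exp (-R) * Real.exp ((∑ i, |h i| + 1) * ∑ i, |z i|) := by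
      rw [← Real.exp_add]
      apply Real.exp_le_exp.2
      nlinarith only [h_R]
    have := Real.exp_pos (∑ i, h i * x' i)
    linarith

/-- The exponent `∑ |hᵢ| + 1` of the envelope of the tilt by `h`; the extra `1` pays for the factor
`exp (-R)` gained outside `[-R, R]ᵐ`. -/
def envelopeExponent (h : EuclideanSpace ℝ (Fin m)) : ℝ := ∑ i, |h i| + 1

theorem extTilt_le_expEnvelope (h : EuclideanSpace ℝ (Fin m)) (d : Fin m → EReal) :
    extTilt h d ≤ expEnvelope (envelopeExponent h) d := by
  by_cases hd : d ∈ Set.range embEReal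
  · obtain ⟨d, rfl⟩ := hd
    simp only [extTilt, expEnvelope_embEReal, embEReal, EReal.toReal_coe]
    exact ENNReal.ofReal_le_ofReal
      (exp_sum_le_exp_mul_sum_abs (by simp [envelopeExponent]) fun _ => le_rfl)
  · simp [expEnvelope_of_notMem_range hd]

theorem tiltTrunc_le_expEnvelope {R : ℝ} (hR : 0 ≤ R) (h : EuclideanSpace ℝ (Fin m))
    (d : Fin m → EReal) : (tiltTrunc R h d : ℝ≥0∞) ≤ expEnvelope (envelopeExponent h) d := by
  by_cases hd : d ∈ Set.range embEReal
  · obtain ⟨d, rfl⟩ := hd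
    simp only [tiltTrunc, expEnvelope_embEReal, embEReal, clampReal_coe]
    exact ENNReal.ofReal_le_ofReal
      (exp_sum_le_exp_mul_sum_abs (by simp [envelopeExponent]) fun _ => abs_max_neg_min_le hR _)
  · simp [expEnvelope_of_notMem_range hd]

theorem extTilt_le_tiltTrunc_add (R : ℝ) (h : EuclideanSpace ℝ (Fin m)) (d : Fin m → EReal) :
    extTilt h d ≤ tiltTrunc R h d +
      ENNReal.ofReal (Real.exp (-R)) * expEnvelope (envelopeExponent h) d := by
  by_cases hd : d ∈ Set.range embEReal
  · obtain ⟨d, rfl⟩ := hd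
    simp only [extTilt, tiltTrunc, expEnvelope_embEReal, embEReal, EReal.toReal_coe, clampReal_coe,
      envelopeExponent]
    rw [← ENNReal.ofReal_mul (Real.exp_nonneg _), ← ENNReal.ofReal, ← ENNReal.ofReal_add
      (Real.exp_nonneg _) (by positivity)]
    exact ENNReal.ofReal_le_ofReal (exp_sum_le_exp_sum_add _ (z := d) (fun _ => le_rfl)
      fun hz => funext fun i => (max_neg_min_eq_self (hz i)).symm)
  · simp [expEnvelope_of_notMem_range hd, ENNReal.mul_top, Real.exp_pos]

theorem tiltTrunc_le_extTilt_add {R : ℝ} (hR : 0 ≤ R) (h : EuclideanSpace ℝ (Fin m))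
    (d : Fin m → EReal) :
    (tiltTrunc R h d : ℝ≥0∞) ≤ extTilt h d +
      ENNReal.ofReal (Real.exp (-R)) * expEnvelope (envelopeExponent h) d := by
  by_cases hd : d ∈ Set.range embEReal
  · obtain ⟨d, rfl⟩ := hd
    simp only [extTilt, tiltTrunc, expEnvelope_embEReal, embEReal, EReal.toReal_coe, clampReal_coe,
      envelopeExponent]
    rw [← ENNReal.ofReal_mul (Real.exp_nonneg _), ← ENNReal.ofReal, ← ENNReal.ofReal_add
      (Real.exp_nonneg _) (by positivity)]
    exact ENNReal.ofReal_le_ofReal (exp_sum_le_exp_sum_add _ (z := d)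
      (fun _ => abs_max_neg_min_le hR _) fun hz => funext fun i => max_neg_min_eq_self (hz i))
  · simp [expEnvelope_of_notMem_range hd, ENNReal.mul_top, Real.exp_pos]

theorem exp_mul_sum_abs_le_sum_exp (C : ℝ) (d : Fin m → ℝ) :
    Real.exp (C * ∑ i, |d i|) ≤
      ∑ τ : Fin m → Bool, Real.exp (∑ i, (if τ i then C else -C) * d i) := by
  refine le_trans ?_ (Finset.single_le_sum (f := fun τ : Fin m → Bool => Real.exp
    (∑ i, (if τ i then C else -C) * d i)) (fun τ _ => Real.exp_nonneg _)
    (Finset.mem_univ fun i => decide (0 ≤ d i)))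
  apply Real.exp_le_exp.2
  rw [Finset.mul_sum]
  refine Finset.sum_le_sum fun i _ => ?_
  by_cases hi : 0 ≤ d i
  · simp [hi, abs_of_nonneg hi]
  · simp [hi, abs_of_neg (not_le.1 hi)]

theorem expEnvelope_le_sum_expTilt (C : ℝ) (d : EuclideanSpace ℝ (Fin m)) :
    expEnvelope C (embEReal d) ≤ ∑ τ : Fin m → Bool,
      expTilt (WithLp.toLp 2 fun i => if τ i then C else -C) d := by
  simp only [← extTilt_embEReal, expEnvelope_embEReal, extTilt, embEReal, EReal.toReal_coe]
  rw [← ENNReal.ofReal_sum_of_nonneg fun _ _ => Real.exp_nonneg _]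
  exact ENNReal.ofReal_le_ofReal (exp_mul_sum_abs_le_sum_exp C d)

end Truncation

section TiltedMean

open scoped NNReal ENNReal

theorem mul_mul_le_mul_mul_add_of_le_add {X₁ X₁' X₂ X₂' w w' A W ε : ℝ≥0∞}
    (h₁ : X₁ ≤ X₁' + ε * A) (h₂ : X₂ ≤ X₂' + ε * A) (h₀ : w ≤ w' + ε * W)
    (hX₁ : X₁ ≤ A) (hX₁' : X₁' ≤ A) (hX₂ : X₂ ≤ A) (hw' : w' ≤ W) :
    X₁ * X₂ * w ≤ X₁' * X₂' * w' + 3 * ε * A ^ 2 * W := by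
  calc X₁ * X₂ * w ≤ X₁ * X₂ * (w' + ε * W) := by gcongr
    _ = X₁ * X₂ * w' + ε * (X₁ * X₂) * W := by ring
    _ ≤ (X₁' + ε * A) * X₂ * w' + ε * (A * A) * W := by gcongr
    _ = X₁' * X₂ * w' + ε * (A * X₂) * w' + ε * (A * A) * W := by ring
    _ ≤ X₁' * (X₂' + ε * A) * w' + ε * (A * A) * W + ε * (A * A) * W := by gcongr
    _ = X₁' * X₂' * w' + ε * (X₁' * A) * w' + ε * (A * A) * W + ε * (A * A) * W := by ring
    _ ≤ X₁' * X₂' * w' + ε * (A * A) * W + ε * (A * A) * W + ε * (A * A) * W := by gcongr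
    _ = X₁' * X₂' * w' + 3 * ε * A ^ 2 * W := by ring

variable {K S : Type*} [MeasurableSpace K] [MeasurableSpace S]

/-- The mean of `(∫ f₁(s) w(d) κ₁(dd, ds)) (∫ f₂(s) w(d) κ₂(dd, ds)) w(d₀)` over the random pair of
laws `κ₁`, `κ₂` and the random point `d₀`. When `κ₁`, `κ₂` are conditional laws, this is the mean of
`f₁(S₁) f₂(S₂)` after a change of measure. -/
def tiltedMean (G : ProbabilityMeasure (LawSpace K S)) (w : K → ℝ≥0∞) (f₁ f₂ : S → ℝ≥0) : ℝ≥0∞ :=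
  ∫⁻ x, (∫⁻ y, f₁ y.2 * w y.1 ∂(x.1 : Measure (K × S))) *
    (∫⁻ y, f₂ y.2 * w y.1 ∂(x.2.1 : Measure (K × S))) * w x.2.2 ∂(G : Measure (LawSpace K S))

theorem lintegral_comp_fst {κ : ProbabilityMeasure (K × S)} {c : ProbabilityMeasure K}
    (hκ : κ.map measurable_fst.aemeasurable = c) {W : K → ℝ≥0∞} (hW : Measurable W) :
    ∫⁻ y, W y.1 ∂(κ : Measure (K × S)) = ∫⁻ d, W d ∂(c : Measure K) := by
  rw [← hκ, ProbabilityMeasure.toMeasure_map, lintegral_map hW measurable_fst]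

variable {w w' W : K → ℝ≥0∞} {M : ℝ≥0} {B ε : ℝ≥0∞}

theorem lintegral_mul_le_of_le_envelope {κ : ProbabilityMeasure (K × S)} {c : ProbabilityMeasure K}
    (hκ : κ.map measurable_fst.aemeasurable = c) (hW : Measurable W) (hw : ∀ d, w d ≤ W d)
    (hB : ∫⁻ d, W d ∂(c : Measure K) ≤ B) {f : S → ℝ≥0} (hf : ∀ s, f s ≤ M) :
    ∫⁻ y, f y.2 * w y.1 ∂(κ : Measure (K × S)) ≤ M * B := by
  calc ∫⁻ y, f y.2 * w y.1 ∂(κ : Measure (K × S))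
      ≤ ∫⁻ y, M * W y.1 ∂(κ : Measure (K × S)) :=
        lintegral_mono fun y => mul_le_mul' (ENNReal.coe_le_coe.2 (hf _)) (hw _)
    _ = M * ∫⁻ d, W d ∂(c : Measure K) := by
        rw [lintegral_const_mul _ (by fun_prop), lintegral_comp_fst hκ hW]
    _ ≤ M * B := by gcongr

theorem lintegral_mul_le_lintegral_mul_add {κ : ProbabilityMeasure (K × S)}
    {c : ProbabilityMeasure K} (hκ : κ.map measurable_fst.aemeasurable = c) (hW : Measurable W)
    (hww' : ∀ d, w d ≤ w' d + ε * W d) (hB : ∫⁻ d, W d ∂(c : Measure K) ≤ B) {f : S → ℝ≥0}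
    (hf : ∀ s, f s ≤ M) :
    ∫⁻ y, f y.2 * w y.1 ∂(κ : Measure (K × S)) ≤
      ∫⁻ y, f y.2 * w' y.1 ∂(κ : Measure (K × S)) + ε * (M * B) := by
  have h_pointwise (y : K × S) : f y.2 * w y.1 ≤ f y.2 * w' y.1 + ε * M * W y.1 := by
    calc f y.2 * w y.1 ≤ f y.2 * (w' y.1 + ε * W y.1) := by gcongr; exact hww' _
      _ = f y.2 * w' y.1 + ε * f y.2 * W y.1 := by ring
      _ ≤ f y.2 * w' y.1 + ε * M * W y.1 := by gcongr; exact hf _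
  calc ∫⁻ y, f y.2 * w y.1 ∂(κ : Measure (K × S))
      ≤ ∫⁻ y, (f y.2 * w' y.1 + ε * M * W y.1) ∂(κ : Measure (K × S)) :=
        lintegral_mono h_pointwise
    _ = ∫⁻ y, f y.2 * w' y.1 ∂(κ : Measure (K × S)) + ε * (M * ∫⁻ d, W d ∂(c : Measure K)) := by
        rw [lintegral_add_right _ (by fun_prop), lintegral_const_mul _ (by fun_prop),
          lintegral_comp_fst hκ hW, mul_assoc]
    _ ≤ _ := by gcongr

theorem HasMarginals.tiltedMean_le_add {G : ProbabilityMeasure (LawSpace K S)}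
    {c₁ c₂ c₀ : ProbabilityMeasure K} (hG : HasMarginals G c₁ c₂ c₀) (hW : Measurable W)
    (hw : ∀ d, w d ≤ W d) (hw' : ∀ d, w' d ≤ W d) (hww' : ∀ d, w d ≤ w' d + ε * W d)
    (hB₁ : ∫⁻ d, W d ∂(c₁ : Measure K) ≤ B) (hB₂ : ∫⁻ d, W d ∂(c₂ : Measure K) ≤ B)
    (hB₀ : ∫⁻ d, W d ∂(c₀ : Measure K) ≤ B) {f₁ f₂ : S → ℝ≥0}
    (hf₁ : ∀ s, f₁ s ≤ M) (hf₂ : ∀ s, f₂ s ≤ M) :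
    tiltedMean G w f₁ f₂ ≤ tiltedMean G w' f₁ f₂ + 3 * ε * (M * B) ^ 2 * B := by
  calc tiltedMean G w f₁ f₂
      ≤ ∫⁻ x, ((∫⁻ y, f₁ y.2 * w' y.1 ∂(x.1 : Measure (K × S))) *
        (∫⁻ y, f₂ y.2 * w' y.1 ∂(x.2.1 : Measure (K × S))) * w' x.2.2 +
          3 * ε * (M * B) ^ 2 * W x.2.2) ∂(G : Measure (LawSpace K S)) := by
        refine lintegral_mono_ae ?_
        filter_upwards [hG.fst, hG.snd] with x hx₁ hx₂
        exact mul_mul_le_mul_mul_add_of_le_add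
          (lintegral_mul_le_lintegral_mul_add hx₁ hW hww' hB₁ hf₁)
          (lintegral_mul_le_lintegral_mul_add hx₂ hW hww' hB₂ hf₂) (hww' _)
          (lintegral_mul_le_of_le_envelope hx₁ hW hw hB₁ hf₁)
          (lintegral_mul_le_of_le_envelope hx₁ hW hw' hB₁ hf₁)
          (lintegral_mul_le_of_le_envelope hx₂ hW hw hB₂ hf₂) (hw' _)
    _ = tiltedMean G w' f₁ f₂ + 3 * ε * (M * B) ^ 2 * ∫⁻ d, W d ∂(c₀ : Measure K) := by
        rw [lintegral_add_right _ (by fun_prop), lintegral_const_mul _ (by fun_prop), ← hG.shared,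
          ProbabilityMeasure.toMeasure_map,
          lintegral_map hW (measurable_snd.comp measurable_snd)]
        rfl
    _ ≤ _ := by gcongr

end TiltedMean

section LimitOfTiltedMeans

open scoped NNReal ENNReal

variable {K S : Type*} [TopologicalSpace K] [CompactSpace K] [TopologicalSpace.MetrizableSpace K]
  [MeasurableSpace K] [BorelSpace K]
  [TopologicalSpace S] [CompactSpace S] [TopologicalSpace.MetrizableSpace S]
  [MeasurableSpace S] [BorelSpace S]
  {ι : Type*} {F : Filter ι} {G : ι → ProbabilityMeasure (LawSpace K S)}
  {G₀ : ProbabilityMeasure (LawSpace K S)}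

instance borelSpace_lawSpace : BorelSpace (LawSpace K S) :=
  have := polishSpace_of_compact_metrizable K
  have := polishSpace_of_compact_metrizable S
  Prod.borelSpace

theorem continuous_toNNReal_lintegral {X : Type*} [TopologicalSpace X] [CompactSpace X]
    [MeasurableSpace X] [OpensMeasurableSpace X] (f : C(X, ℝ≥0)) :
    Continuous fun κ : ProbabilityMeasure X => (∫⁻ x, f x ∂(κ : Measure X)).toNNReal :=
  ENNReal.continuousOn_toNNReal.comp_continuous
    (ProbabilityMeasure.continuous_lintegral_continuousMap f) fun κ =>
      (BoundedContinuousFunction.lintegral_lt_top_of_nnreal (κ : Measure X)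
        (BoundedContinuousFunction.mkOfCompact f)).ne

theorem tendsto_tiltedMean_of_continuous (hG : Tendsto G F (𝓝 G₀)) (w : C(K, ℝ≥0))
    (f₁ f₂ : C(S, ℝ≥0)) :
    Tendsto (fun n => tiltedMean (G n) (fun d => w d) f₁ f₂) F
      (𝓝 (tiltedMean G₀ (fun d => w d) f₁ f₂)) := by
  have := polishSpace_of_compact_metrizable K
  have := polishSpace_of_compact_metrizable S
  let φ (f : C(S, ℝ≥0)) : C(K × S, ℝ≥0) := ⟨fun y => f y.2 * w y.1, by fun_prop⟩
  have h_cont (f : C(S, ℝ≥0)) := continuous_toNNReal_lintegral (φ f)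
  let Ψ : C(LawSpace K S, ℝ≥0) :=
    ⟨fun x => (∫⁻ y, φ f₁ y ∂(x.1 : Measure (K × S))).toNNReal *
      (∫⁻ y, φ f₂ y ∂(x.2.1 : Measure (K × S))).toNNReal * w x.2.2,
      (((h_cont f₁).comp continuous_fst).mul
        ((h_cont f₂).comp (continuous_fst.comp continuous_snd))).mul (by fun_prop)⟩
  have h_coe (f : C(S, ℝ≥0)) (κ : ProbabilityMeasure (K × S)) :
      ((∫⁻ y, φ f y ∂(κ : Measure (K × S))).toNNReal : ℝ≥0∞) =
        ∫⁻ y, f y.2 * w y.1 ∂(κ : Measure (K × S)) := by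
    rw [ENNReal.coe_toNNReal]
    · simp only [φ, ContinuousMap.coe_mk, ENNReal.coe_mul]
    · exact (BoundedContinuousFunction.lintegral_lt_top_of_nnreal (κ : Measure (K × S))
        (BoundedContinuousFunction.mkOfCompact (φ f))).ne
  have h_tiltedMean (G : ProbabilityMeasure (LawSpace K S)) :
      tiltedMean G (fun d => w d) f₁ f₂ = ∫⁻ x, Ψ x ∂(G : Measure (LawSpace K S)) := by
    simp only [tiltedMean, Ψ, ContinuousMap.coe_mk, ENNReal.coe_mul, h_coe]
  simp_rw [h_tiltedMean]
  exact ((ProbabilityMeasure.continuous_lintegral_continuousMap Ψ).tendsto _).comp hG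

theorem HasMarginals.of_tendsto [F.NeBot] {c₁ c₂ c₀ : ι → ProbabilityMeasure K}
    {γ₁ γ₂ γ₀ : ProbabilityMeasure K} (hG : Tendsto G F (𝓝 G₀))
    (h : ∀ n, HasMarginals (G n) (c₁ n) (c₂ n) (c₀ n)) (h₁ : Tendsto c₁ F (𝓝 γ₁))
    (h₂ : Tendsto c₂ F (𝓝 γ₂)) (h₀ : Tendsto c₀ F (𝓝 γ₀)) : HasMarginals G₀ γ₁ γ₂ γ₀ := by
  have := polishSpace_of_compact_metrizable K
  have := polishSpace_of_compact_metrizable S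
  have h_marginal : Continuous fun κ : ProbabilityMeasure (K × S) =>
      κ.map measurable_fst.aemeasurable := ProbabilityMeasure.continuous_map continuous_fst
  refine ⟨?_, ?_, ?_⟩
  · exact ae_eq_of_tendsto_of_ae_eq hG (h_marginal.comp continuous_fst) h₁ fun n => (h n).fst
  · exact ae_eq_of_tendsto_of_ae_eq hG (h_marginal.comp (continuous_fst.comp continuous_snd)) h₂
      fun n => (h n).snd
  · refine tendsto_nhds_unique (ProbabilityMeasure.tendsto_map_of_tendsto_of_continuous _ _ hG
      (continuous_snd.comp continuous_snd)) ?_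
    simpa only [(h _).shared] using h₀

theorem eq_of_tendsto_of_uniform_approx [F.NeBot] {a : ι → ℝ≥0∞} {l a₀ : ℝ≥0∞}
    {b : ℕ → ι → ℝ≥0∞} {b₀ δ : ℕ → ℝ≥0∞} (ha : Tendsto a F (𝓝 l))
    (hb : ∀ R, Tendsto (b R) F (𝓝 (b₀ R))) (hδ : Tendsto δ atTop (𝓝 0))
    (hab : ∀ R, ∀ᶠ n in F, a n ≤ b R n + δ R ∧ b R n ≤ a n + δ R)
    (hab₀ : ∀ R, a₀ ≤ b₀ R + δ R ∧ b₀ R ≤ a₀ + δ R) : a₀ = l := by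
  have h_error (x : ℝ≥0∞) : Tendsto (fun R => x + δ R + δ R) atTop (𝓝 x) := by
    simpa only [add_zero] using (tendsto_const_nhds.add hδ).add hδ
  apply le_antisymm
  · refine ge_of_tendsto' (h_error l) fun R => (hab₀ R).1.trans ?_
    gcongr
    exact le_of_tendsto_of_tendsto (hb R) (ha.add tendsto_const_nhds) ((hab R).mono fun n h => h.2)
  · refine ge_of_tendsto' (h_error a₀) fun R => le_trans ?_ (add_le_add_left (hab₀ R).2 (δ R))
    exact le_of_tendsto_of_tendsto ha ((hb R).add tendsto_const_nhds)
      ((hab R).mono fun n h => h.1)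

end LimitOfTiltedMeans

section LimitSampler

open scoped NNReal ENNReal unitInterval

variable {m : ℕ} {c : ℕ → ProbabilityMeasure (EuclideanSpace ℝ (Fin m))}
  {γ : ProbabilityMeasure (EuclideanSpace ℝ (Fin m))}

/-- Weak convergence together with eventual boundedness of all exponential moments, so that the
means of exponential tilts converge as well. -/
structure TiltConvergence (c : ℕ → ProbabilityMeasure (EuclideanSpace ℝ (Fin m)))
    (γ : ProbabilityMeasure (EuclideanSpace ℝ (Fin m))) : Prop where
  tendsto : Tendsto c atTop (𝓝 γ)
  bound : ∀ h : EuclideanSpace ℝ (Fin m), ∃ B : ℝ≥0∞, B ≠ ∞ ∧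
    ∀ᶠ n in atTop, ∫⁻ d, expTilt h d ∂(c n : Measure (EuclideanSpace ℝ (Fin m))) ≤ B

/-- A law on `ℝᵐ` regarded as a law on the compactification `[-∞, ∞]ᵐ`. -/
def embLaw (c : ProbabilityMeasure (EuclideanSpace ℝ (Fin m))) :
    ProbabilityMeasure (Fin m → EReal) :=
  c.map continuous_embEReal.measurable.aemeasurable

theorem lintegral_embLaw (c : ProbabilityMeasure (EuclideanSpace ℝ (Fin m)))
    {g : (Fin m → EReal) → ℝ≥0∞} (hg : Measurable g) :
    ∫⁻ d, g d ∂(embLaw c : Measure (Fin m → EReal)) =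
      ∫⁻ d, g (embEReal d) ∂(c : Measure (EuclideanSpace ℝ (Fin m))) := by
  rw [embLaw, ProbabilityMeasure.toMeasure_map, lintegral_map hg continuous_embEReal.measurable]

theorem lintegral_embLaw_expEnvelope_le (c : ProbabilityMeasure (EuclideanSpace ℝ (Fin m)))
    (C : ℝ) : ∫⁻ d, expEnvelope C d ∂(embLaw c : Measure (Fin m → EReal)) ≤
      ∑ τ : Fin m → Bool, ∫⁻ d, expTilt (WithLp.toLp 2 fun i => if τ i then C else -C) d
        ∂(c : Measure (EuclideanSpace ℝ (Fin m))) := by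
  rw [lintegral_embLaw c (measurable_expEnvelope C),
    ← lintegral_finsetSum _ fun _ _ => measurable_expTilt _]
  exact lintegral_mono fun d => expEnvelope_le_sum_expTilt C d

theorem TiltConvergence.lintegral_expTilt_le (hc : TiltConvergence c γ)
    {h : EuclideanSpace ℝ (Fin m)} {B : ℝ≥0∞}
    (hB : ∀ᶠ n in atTop, ∫⁻ d, expTilt h d ∂(c n : Measure (EuclideanSpace ℝ (Fin m))) ≤ B) :
    ∫⁻ d, expTilt h d ∂(γ : Measure (EuclideanSpace ℝ (Fin m))) ≤ B :=
  (lintegral_le_liminf_lintegral_of_forall_isOpen_measure_le_liminf_measure (by fun_prop)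
    (fun _ => Real.exp_nonneg _)
    fun _ hU => ProbabilityMeasure.le_liminf_measure_open_of_tendsto hc.tendsto hU).trans
    (liminf_le_of_frequently_le' hB.frequently)

theorem TiltConvergence.exists_expEnvelope_bound (hc : TiltConvergence c γ) (C : ℝ) :
    ∃ B : ℝ≥0∞, B ≠ ∞ ∧
      (∀ᶠ n in atTop, ∫⁻ d, expEnvelope C d ∂(embLaw (c n) : Measure (Fin m → EReal)) ≤ B) ∧
      ∫⁻ d, expEnvelope C d ∂(embLaw γ : Measure (Fin m → EReal)) ≤ B := by
  choose B hB hc_le using fun τ : Fin m → Bool =>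
    hc.bound (WithLp.toLp 2 fun i => if τ i then C else -C)
  refine ⟨∑ τ, B τ, by simp [hB], ?_, ?_⟩
  · filter_upwards [eventually_all.2 hc_le] with n hn
    exact (lintegral_embLaw_expEnvelope_le _ C).trans (Finset.sum_le_sum fun τ _ => hn τ)
  · exact (lintegral_embLaw_expEnvelope_le _ C).trans
      (Finset.sum_le_sum fun τ _ => hc.lintegral_expTilt_le (hc_le τ))

theorem TiltConvergence.tendsto_embLaw (hc : TiltConvergence c γ) :
    Tendsto (fun n => embLaw (c n)) atTop (𝓝 (embLaw γ)) :=
  ((ProbabilityMeasure.continuous_map continuous_embEReal).tendsto _).comp hc.tendsto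

theorem HasMarginals.tiltedMean_extTilt_approx {S : Type*} [MeasurableSpace S]
    {G : ProbabilityMeasure (LawSpace (Fin m → EReal) S)}
    {c₁ c₂ c₀ : ProbabilityMeasure (Fin m → EReal)} (hG : HasMarginals G c₁ c₂ c₀)
    (h : EuclideanSpace ℝ (Fin m)) {B : ℝ≥0∞}
    (hB₁ : ∫⁻ d, expEnvelope (envelopeExponent h) d ∂(c₁ : Measure (Fin m → EReal)) ≤ B)
    (hB₂ : ∫⁻ d, expEnvelope (envelopeExponent h) d ∂(c₂ : Measure (Fin m → EReal)) ≤ B)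
    (hB₀ : ∫⁻ d, expEnvelope (envelopeExponent h) d ∂(c₀ : Measure (Fin m → EReal)) ≤ B)
    {f₁ f₂ : S → ℝ≥0} {M : ℝ≥0} (hf₁ : ∀ s, f₁ s ≤ M) (hf₂ : ∀ s, f₂ s ≤ M) {R : ℝ} (hR : 0 ≤ R) :
    tiltedMean G (extTilt h) f₁ f₂ ≤ tiltedMean G (fun d => tiltTrunc R h d) f₁ f₂ +
        3 * ENNReal.ofReal (Real.exp (-R)) * (M * B) ^ 2 * B ∧
      tiltedMean G (fun d => tiltTrunc R h d) f₁ f₂ ≤ tiltedMean G (extTilt h) f₁ f₂ +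
        3 * ENNReal.ofReal (Real.exp (-R)) * (M * B) ^ 2 * B :=
  ⟨hG.tiltedMean_le_add (measurable_expEnvelope _) (extTilt_le_expEnvelope h)
    (tiltTrunc_le_expEnvelope hR h) (extTilt_le_tiltTrunc_add R h) hB₁ hB₂ hB₀ hf₁ hf₂,
  hG.tiltedMean_le_add (measurable_expEnvelope _) (tiltTrunc_le_expEnvelope hR h)
    (extTilt_le_expEnvelope h) (tiltTrunc_le_extTilt_add hR h) hB₁ hB₂ hB₀ hf₁ hf₂⟩

theorem tendsto_truncation_error {M : ℝ≥0} {B : ℝ≥0∞} (hB : B ≠ ∞) :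
    Tendsto (fun R : ℕ => 3 * ENNReal.ofReal (Real.exp (-(R : ℝ))) * (M * B) ^ 2 * B) atTop
      (𝓝 0) := by
  have h_exp : Tendsto (fun R : ℕ => ENNReal.ofReal (Real.exp (-(R : ℝ)))) atTop (𝓝 0) := by
    rw [← ENNReal.ofReal_zero]
    exact ENNReal.tendsto_ofReal (Real.tendsto_exp_neg_atTop_nhds_zero.comp
      tendsto_natCast_atTop_atTop)
  have h_const : 3 * (M * B) ^ 2 * B ≠ ∞ := by finiteness
  have := ENNReal.Tendsto.const_mul h_exp (Or.inr h_const)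
  rw [mul_zero] at this
  exact this.congr fun R => by ring

theorem exists_forall_le_of_continuousMap {X : Type*} [TopologicalSpace X] [CompactSpace X]
    (f : C(X, ℝ≥0)) : ∃ M : ℝ≥0, ∀ x, f x ≤ M := by
  obtain ⟨M, hM⟩ := (isCompact_range f.continuous).bddAbove
  exact ⟨M, fun x => hM ⟨x, rfl⟩⟩

variable {S : Type*} [TopologicalSpace S] [CompactSpace S] [TopologicalSpace.MetrizableSpace S]
  [MeasurableSpace S] [BorelSpace S]
  {c₁ c₂ c₀ : ℕ → ProbabilityMeasure (EuclideanSpace ℝ (Fin m))}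
  {γ₁ γ₂ γ₀ : ProbabilityMeasure (EuclideanSpace ℝ (Fin m))}
  {G : ℕ → ProbabilityMeasure (LawSpace (Fin m → EReal) S)}
  {l : EuclideanSpace ℝ (Fin m) → C(S, ℝ≥0) → C(S, ℝ≥0) → ℝ≥0∞}

theorem HasMarginals.tiltedMean_extTilt_eq_of_tendsto {F : Filter ℕ} [F.NeBot] (hF : F ≤ atTop)
    (hc₁ : TiltConvergence c₁ γ₁) (hc₂ : TiltConvergence c₂ γ₂) (hc₀ : TiltConvergence c₀ γ₀)
    (hG : ∀ n, HasMarginals (G n) (embLaw (c₁ n)) (embLaw (c₂ n)) (embLaw (c₀ n)))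
    {G₀ : ProbabilityMeasure (LawSpace (Fin m → EReal) S)} (hG_lim : Tendsto G F (𝓝 G₀))
    (hG₀ : HasMarginals G₀ (embLaw γ₁) (embLaw γ₂) (embLaw γ₀))
    {h : EuclideanSpace ℝ (Fin m)} {f₁ f₂ : C(S, ℝ≥0)} {a : ℝ≥0∞}
    (ha : Tendsto (fun n => tiltedMean (G n) (extTilt h) f₁ f₂) F (𝓝 a)) :
    tiltedMean G₀ (extTilt h) f₁ f₂ = a := by
  obtain ⟨B₁, hB₁, hc₁_le, hγ₁_le⟩ := hc₁.exists_expEnvelope_bound (envelopeExponent h)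
  obtain ⟨B₂, hB₂, hc₂_le, hγ₂_le⟩ := hc₂.exists_expEnvelope_bound (envelopeExponent h)
  obtain ⟨B₀, hB₀, hc₀_le, hγ₀_le⟩ := hc₀.exists_expEnvelope_bound (envelopeExponent h)
  set B := max B₁ (max B₂ B₀)
  have hB : B ≠ ∞ := by simp [B, hB₁, hB₂, hB₀]
  have hB₁_le : B₁ ≤ B := le_max_left _ _
  have hB₂_le : B₂ ≤ B := (le_max_left _ _).trans (le_max_right _ _)
  have hB₀_le : B₀ ≤ B := (le_max_right _ _).trans (le_max_right _ _)
  obtain ⟨M₁, hM₁⟩ := exists_forall_le_of_continuousMap f₁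
  obtain ⟨M₂, hM₂⟩ := exists_forall_le_of_continuousMap f₂
  have hf₁ : ∀ s, f₁ s ≤ max M₁ M₂ := fun s => (hM₁ s).trans (le_max_left _ _)
  have hf₂ : ∀ s, f₂ s ≤ max M₁ M₂ := fun s => (hM₂ s).trans (le_max_right _ _)
  refine eq_of_tendsto_of_uniform_approx ha
    (fun R : ℕ => tendsto_tiltedMean_of_continuous hG_lim
      ⟨tiltTrunc R h, continuous_tiltTrunc _ _⟩ f₁ f₂)
    (tendsto_truncation_error (M := max M₁ M₂) hB) (fun R => ?_) fun R => ?_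
  · filter_upwards [hF hc₁_le, hF hc₂_le, hF hc₀_le] with n h₁ h₂ h₀
    exact (hG n).tiltedMean_extTilt_approx h (h₁.trans hB₁_le) (h₂.trans hB₂_le)
      (h₀.trans hB₀_le) hf₁ hf₂ (Nat.cast_nonneg R)
  · exact hG₀.tiltedMean_extTilt_approx h (hγ₁_le.trans hB₁_le) (hγ₂_le.trans hB₂_le)
      (hγ₀_le.trans hB₀_le) hf₁ hf₂ (Nat.cast_nonneg R)

theorem exists_limit_tiltedMean
    (hc₁ : TiltConvergence c₁ γ₁) (hc₂ : TiltConvergence c₂ γ₂) (hc₀ : TiltConvergence c₀ γ₀)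
    (hG : ∀ n, HasMarginals (G n) (embLaw (c₁ n)) (embLaw (c₂ n)) (embLaw (c₀ n)))
    (hl : ∀ h (f₁ f₂ : C(S, ℝ≥0)), Tendsto (fun n => tiltedMean (G n) (extTilt h) f₁ f₂) atTop
      (𝓝 (l h f₁ f₂))) :
    ∃ G₀ : ProbabilityMeasure (LawSpace (Fin m → EReal) S),
      HasMarginals G₀ (embLaw γ₁) (embLaw γ₂) (embLaw γ₀) ∧
      ∀ h (f₁ f₂ : C(S, ℝ≥0)), tiltedMean G₀ (extTilt h) f₁ f₂ = l h f₁ f₂ := by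
  have := polishSpace_of_compact_metrizable S
  have := polishSpace_of_compact_metrizable (ProbabilityMeasure ((Fin m → EReal) × S))
  have : BorelSpace (LawSpace (Fin m → EReal) S) := borelSpace_lawSpace
  have hF : (hyperfilter ℕ : Filter ℕ) ≤ atTop := Nat.hyperfilter_le_atTop
  obtain ⟨G₀, -, hG_lim⟩ :=
    isCompact_univ.ultrafilter_le_nhds ((hyperfilter ℕ).map G) (by simp)
  have hG₀ : HasMarginals G₀ (embLaw γ₁) (embLaw γ₂) (embLaw γ₀) :=
    HasMarginals.of_tendsto hG_lim hG (hc₁.tendsto_embLaw.mono_left hF)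
      (hc₂.tendsto_embLaw.mono_left hF) (hc₀.tendsto_embLaw.mono_left hF)
  exact ⟨G₀, hG₀, fun h f₁ f₂ => HasMarginals.tiltedMean_extTilt_eq_of_tendsto hF hc₁ hc₂ hc₀ hG
    hG_lim hG₀ ((hl h f₁ f₂).mono_left hF)⟩

theorem exists_limit_sampler [Nonempty S]
    (hc₁ : TiltConvergence c₁ γ₁) (hc₂ : TiltConvergence c₂ γ₂) (hc₀ : TiltConvergence c₀ γ₀)
    (hG : ∀ n, HasMarginals (G n) (embLaw (c₁ n)) (embLaw (c₂ n)) (embLaw (c₀ n)))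
    (hl : ∀ h (f₁ f₂ : C(S, ℝ≥0)), Tendsto (fun n => tiltedMean (G n) (extTilt h) f₁ f₂) atTop
      (𝓝 (l h f₁ f₂))) :
    ∃ T₁ T₂ : EuclideanSpace ℝ (Fin m) → EuclideanSpace ℝ (Fin m) → I → S,
      Measurable (fun x : EuclideanSpace ℝ (Fin m) × EuclideanSpace ℝ (Fin m) × I =>
        T₁ x.1 x.2.1 x.2.2) ∧
      Measurable (fun x : EuclideanSpace ℝ (Fin m) × EuclideanSpace ℝ (Fin m) × I =>
        T₂ x.1 x.2.1 x.2.2) ∧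
      ∀ h (f₁ f₂ : C(S, ℝ≥0)),
        ∫⁻ ω, (f₁ (T₁ ω.1 ω.2.2.1 ω.2.2.2) : ℝ≥0∞) * f₂ (T₂ ω.2.1 ω.2.2.1 ω.2.2.2) *
          (expTilt h ω.1 * expTilt h ω.2.1 * expTilt h ω.2.2.1)
          ∂((γ₁ : Measure (EuclideanSpace ℝ (Fin m))).prod
            ((γ₂ : Measure (EuclideanSpace ℝ (Fin m))).prod
              ((γ₀ : Measure (EuclideanSpace ℝ (Fin m))).prod (volume : Measure I)))) =
          l h f₁ f₂ := by
  obtain ⟨G₀, hG₀, h_mean⟩ := exists_limit_tiltedMean hc₁ hc₂ hc₀ hG hl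
  obtain ⟨T₁, T₂, hT₁, hT₂, hT⟩ := hG₀.exists_sampler
  have h_emb : Measurable (embEReal (m := m)) := continuous_embEReal.measurable
  refine ⟨fun d₁ d₀ u => T₁ (embEReal d₁) (embEReal d₀) u,
    fun d₂ d₀ u => T₂ (embEReal d₂) (embEReal d₀) u,
    hT₁.comp (h_emb.prodMap (h_emb.prodMap measurable_id)),
    hT₂.comp (h_emb.prodMap (h_emb.prodMap measurable_id)), fun h f₁ f₂ => ?_⟩
  have h_map (γ : ProbabilityMeasure (EuclideanSpace ℝ (Fin m))) :
      MeasurePreserving embEReal (γ : Measure (EuclideanSpace ℝ (Fin m)))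
        (embLaw γ : Measure (Fin m → EReal)) := ⟨h_emb, rfl⟩
  have h_prod := (h_map γ₁).prod ((h_map γ₂).prod ((h_map γ₀).prod
    (MeasurePreserving.id (volume : Measure I))))
  have hf (f : C(S, ℝ≥0)) : Measurable fun y : (Fin m → EReal) × S =>
      (f y.2 : ℝ≥0∞) * extTilt h y.1 :=
    (f.continuous.measurable.comp measurable_snd).coe_nnreal_ennreal.mul (by fun_prop)
  have h_law := hT _ _ (hf f₁) (hf f₂) _ (measurable_extTilt h)
  rw [← h_prod.lintegral_comp] at h_law
  · refine Eq.trans (lintegral_congr fun ω => ?_) (h_law.trans (h_mean h f₁ f₂))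
    simp only [Prod.map_fst, Prod.map_snd, extTilt_embEReal, id]
    ring
  · exact (((hf f₁).comp (by fun_prop)).mul ((hf f₂).comp (by fun_prop))).mul (by fun_prop)

end LimitSampler

section Resampling

open scoped ENNReal

variable {Z ι : Type*}

open Classical in
/-- The sample `z` with the coordinates in `A` replaced by those of another sample `w`. For an
independent copy `w` of an i.i.d. sample `z`, averaging over `w` is conditioning on the coordinates
of `z` outside `A`. -/
def resample (A : Set ι) (w z : ι → Z) : ι → Z := A.piecewise w z

open Classical in
theorem resample_of_mem {A : Set ι} {i : ι} (hi : i ∈ A) (w z : ι → Z) : resample A w z i = w i :=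
  Set.piecewise_eq_of_mem _ _ _ hi

open Classical in
theorem resample_of_notMem {A : Set ι} {i : ι} (hi : i ∉ A) (w z : ι → Z) :
    resample A w z i = z i :=
  Set.piecewise_eq_of_notMem _ _ _ hi

theorem resample_comm {A B : Set ι} (hAB : Disjoint A B) (v w z : ι → Z) :
    resample A v (resample B w z) = resample B w (resample A v z) := by
  ext i
  by_cases hiA : i ∈ A
  · have hiB : i ∉ B := Set.disjoint_left.1 hAB hiA
    simp only [resample_of_mem hiA, resample_of_notMem hiB]
  · by_cases hiB : i ∈ B
    · simp only [resample_of_mem hiB, resample_of_notMem hiA]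
    · simp only [resample_of_notMem hiA, resample_of_notMem hiB]

section DependsOn

variable {β : Type*} {F : (ι → Z) → β} {A B : Set ι}

theorem resample_of_dependsOn (hF : DependsOn F B) (hBA : B ⊆ A) (w z : ι → Z) :
    F (resample A w z) = F w :=
  hF fun _ hi => resample_of_mem (hBA hi) w z

theorem resample_of_dependsOn_disjoint (hF : DependsOn F B) (hAB : Disjoint A B) (w z : ι → Z) :
    F (resample A w z) = F z :=
  hF fun _ hi => resample_of_notMem (Set.disjoint_right.1 hAB hi) w z

end DependsOn

variable [MeasurableSpace Z]

theorem measurable_resample (A : Set ι) :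
    Measurable fun x : (ι → Z) × (ι → Z) => resample A x.1 x.2 := by
  refine measurable_pi_lambda _ fun i => ?_
  by_cases hi : i ∈ A
  · simp only [resample_of_mem hi]
    fun_prop
  · simp only [resample_of_notMem hi]
    fun_prop

theorem measurable_resample_left (A : Set ι) (z : ι → Z) : Measurable fun w => resample A w z :=
  (measurable_resample A).comp measurable_prodMk_right

variable [Fintype ι] (P : Measure Z) [IsProbabilityMeasure P]

theorem map_resample_pi_prod (A : Set ι) :
    ((Measure.pi fun _ : ι => P).prod (Measure.pi fun _ : ι => P)).map
      (fun x => resample A x.1 x.2) = Measure.pi fun _ => P := by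
  classical
  symm
  refine Measure.pi_eq fun s hs => ?_
  rw [Measure.map_apply (measurable_resample A) (MeasurableSet.univ_pi hs)]
  have h_preimage : (fun x : (ι → Z) × (ι → Z) => resample A x.1 x.2) ⁻¹' Set.univ.pi s =
      (Set.univ.pi fun i => if i ∈ A then s i else Set.univ) ×ˢ
        (Set.univ.pi fun i => if i ∈ A then Set.univ else s i) := by
    ext x
    simp only [Set.mem_preimage, Set.mem_univ_pi, Set.mem_prod, ← forall_and]
    refine forall_congr' fun i => ?_
    by_cases hi : i ∈ A <;> simp [hi, resample_of_mem, resample_of_notMem]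
  rw [h_preimage, Measure.prod_prod, Measure.pi_pi, Measure.pi_pi, ← Finset.prod_mul_distrib]
  refine Finset.prod_congr rfl fun i _ => ?_
  by_cases hi : i ∈ A <;> simp [hi]

theorem lintegral_pi_eq_lintegral_resample (A : Set ι) {F : (ι → Z) → ℝ≥0∞} (hF : Measurable F) :
    ∫⁻ z, F z ∂(Measure.pi fun _ => P) =
      ∫⁻ z, ∫⁻ w, F (resample A w z) ∂(Measure.pi fun _ => P) ∂(Measure.pi fun _ => P) := by
  conv_lhs => rw [← map_resample_pi_prod P A]
  rw [lintegral_map hF (measurable_resample A)]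
  exact lintegral_prod_symm _ (hF.comp (measurable_resample A)).aemeasurable

variable {P}

theorem lintegral_pi_mul_of_dependsOn {A : Set ι} {F G : (ι → Z) → ℝ≥0∞} (hF : Measurable F)
    (hG : Measurable G) (hFA : DependsOn F A) (hGA : DependsOn G Aᶜ) :
    ∫⁻ z, F z * G z ∂(Measure.pi fun _ => P) =
      (∫⁻ z, F z ∂(Measure.pi fun _ => P)) * ∫⁻ z, G z ∂(Measure.pi fun _ => P) := by
  rw [lintegral_pi_eq_lintegral_resample P A (F := fun z => F z * G z) (hF.mul hG)]
  simp_rw [resample_of_dependsOn hFA subset_rfl,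
    resample_of_dependsOn_disjoint hGA disjoint_compl_right, lintegral_mul_const _ hF]
  rw [lintegral_const_mul _ hG]

theorem lintegral_pi_mul_mul_eq_lintegral_resample {A₁ A₂ A₀ : Set ι}
    (h₁₂ : Disjoint A₁ A₂) (h₁₀ : Disjoint A₁ A₀) (h₂₀ : Disjoint A₂ A₀)
    {F₁ F₂ F₀ : (ι → Z) → ℝ≥0∞} (hF₁ : Measurable F₁) (hF₂ : Measurable F₂) (hF₀ : Measurable F₀)
    (hF₁A : DependsOn F₁ (A₁ ∪ A₀)) (hF₂A : DependsOn F₂ (A₂ ∪ A₀)) (hF₀A : DependsOn F₀ A₀) :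
    ∫⁻ z, F₁ z * F₂ z * F₀ z ∂(Measure.pi fun _ => P) =
      ∫⁻ z, (∫⁻ w, F₁ (resample A₁ w z) ∂(Measure.pi fun _ => P)) *
        (∫⁻ w, F₂ (resample A₂ w z) ∂(Measure.pi fun _ => P)) * F₀ z
        ∂(Measure.pi fun _ => P) := by
  have h_prod : Measurable fun z => F₁ z * F₂ z * F₀ z := (hF₁.mul hF₂).mul hF₀
  rw [lintegral_pi_eq_lintegral_resample P A₂ h_prod,
    lintegral_pi_eq_lintegral_resample P A₁ (Measurable.lintegral_prod_left'
      (f := fun x => F₁ (resample A₂ x.1 x.2) * F₂ (resample A₂ x.1 x.2) *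
        F₀ (resample A₂ x.1 x.2)) (h_prod.comp (measurable_resample A₂)))]
  refine lintegral_congr fun z => ?_
  have h₁ (w₁ w₂ : ι → Z) : F₁ (resample A₂ w₂ (resample A₁ w₁ z)) = F₁ (resample A₁ w₁ z) :=
    resample_of_dependsOn_disjoint hF₁A (h₁₂.symm.union_right h₂₀) _ _
  have h₂ (w₁ w₂ : ι → Z) : F₂ (resample A₂ w₂ (resample A₁ w₁ z)) = F₂ (resample A₂ w₂ z) := by
    rw [resample_comm h₁₂.symm]
    exact resample_of_dependsOn_disjoint hF₂A (h₁₂.union_right h₁₀) _ _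
  have h₀ (w₁ w₂ : ι → Z) : F₀ (resample A₂ w₂ (resample A₁ w₁ z)) = F₀ z := by
    rw [resample_of_dependsOn_disjoint hF₀A h₂₀, resample_of_dependsOn_disjoint hF₀A h₁₀]
  have hF₁z : Measurable fun w => F₁ (resample A₁ w z) := hF₁.comp (measurable_resample_left A₁ z)
  have hF₂z : Measurable fun w => F₂ (resample A₂ w z) := hF₂.comp (measurable_resample_left A₂ z)
  simp_rw [h₁, h₂, h₀, mul_assoc, lintegral_const_mul _ (hF₂z.mul_const _),
    lintegral_mul_const _ hF₂z, lintegral_mul_const _ hF₁z]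

end Resampling

section Hellinger

open scoped ENNReal

/-- A probability density with respect to `ν`, as a nonnegative real function. -/
structure IsProbDensity {Z : Type*} [MeasurableSpace Z] (ν : Measure Z) (f : Z → ℝ) : Prop where
  measurable : Measurable f
  nonneg : ∀ z, 0 ≤ f z
  lintegral_eq_one : ∫⁻ z, ENNReal.ofReal (f z) ∂ν = 1

/-- The squared Hellinger distance of two densities, without the factor `1/2`. -/
def hellingerSq {Z : Type*} [MeasurableSpace Z] (ν : Measure Z) (f g : Z → ℝ) : ℝ≥0∞ :=
  ∫⁻ z, ENNReal.ofReal ((√(f z) - √(g z)) ^ 2) ∂ν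

variable {Z ι : Type*} [MeasurableSpace Z] {ν : Measure Z} {f g : Z → ℝ}

theorem hellingerSq_comm (ν : Measure Z) (f g : Z → ℝ) :
    hellingerSq ν f g = hellingerSq ν g f := by
  simp only [hellingerSq, sub_sq_comm]

theorem withDensity_ofReal_mul (hf : Measurable f) (hf₀ : ∀ z, 0 ≤ f z) (hg : Measurable g) :
    ν.withDensity (fun z => ENNReal.ofReal (f z * g z)) =
      (ν.withDensity fun z => ENNReal.ofReal (f z)).withDensity fun z => ENNReal.ofReal (g z) := by
  rw [← withDensity_mul _ hf.ennreal_ofReal hg.ennreal_ofReal]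
  congr 1
  funext z
  exact ENNReal.ofReal_mul (hf₀ z)

theorem lintegral_withDensity_ofReal (hf : Measurable f) (hf₀ : ∀ z, 0 ≤ f z) (hg : Measurable g) :
    ∫⁻ z, ENNReal.ofReal (g z) ∂(ν.withDensity fun z => ENNReal.ofReal (f z)) =
      ∫⁻ z, ENNReal.ofReal (f z * g z) ∂ν := by
  rw [lintegral_withDensity_eq_lintegral_mul _ hf.ennreal_ofReal hg.ennreal_ofReal]
  exact lintegral_congr fun z => (ENNReal.ofReal_mul (hf₀ z)).symm

namespace IsProbDensity

theorem integrable (hf : IsProbDensity ν f) : Integrable f ν := by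
  refine ⟨hf.measurable.aestronglyMeasurable, ?_⟩
  rw [hasFiniteIntegral_iff_ofReal (ae_of_all _ hf.nonneg), hf.lintegral_eq_one]
  exact ENNReal.one_lt_top

theorem integral_eq_one (hf : IsProbDensity ν f) : ∫ z, f z ∂ν = 1 := by
  rw [integral_eq_lintegral_of_nonneg_ae (ae_of_all _ hf.nonneg)
    hf.measurable.aestronglyMeasurable, hf.lintegral_eq_one, ENNReal.toReal_one]

theorem isProbabilityMeasure_withDensity (hf : IsProbDensity ν f) :
    IsProbabilityMeasure (ν.withDensity fun z => ENNReal.ofReal (f z)) :=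
  ⟨by rw [withDensity_apply _ .univ, Measure.restrict_univ, hf.lintegral_eq_one]⟩

theorem integrable_withDensity_iff (hf : IsProbDensity ν f) (F : Z → ℝ) :
    Integrable F (ν.withDensity fun z => ENNReal.ofReal (f z)) ↔
      Integrable (fun z => F z * f z) ν := by
  rw [MeasureTheory.integrable_withDensity_iff hf.measurable.ennreal_ofReal
    (ae_of_all _ fun _ => ENNReal.ofReal_lt_top)]
  simp_rw [ENNReal.toReal_ofReal (hf.nonneg _)]

theorem integral_withDensity (hf : IsProbDensity ν f) (F : Z → ℝ) :
    ∫ z, F z ∂(ν.withDensity fun z => ENNReal.ofReal (f z)) = ∫ z, F z * f z ∂ν := by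
  rw [integral_withDensity_eq_integral_toReal_smul hf.measurable.ennreal_ofReal
    (ae_of_all _ fun _ => ENNReal.ofReal_lt_top)]
  simp_rw [ENNReal.toReal_ofReal (hf.nonneg _), smul_eq_mul, mul_comm]

theorem mul (hf : IsProbDensity ν f)
    (hg : IsProbDensity (ν.withDensity fun z => ENNReal.ofReal (f z)) g) :
    IsProbDensity ν fun z => f z * g z where
  measurable := hf.measurable.mul hg.measurable
  nonneg z := mul_nonneg (hf.nonneg z) (hg.nonneg z)
  lintegral_eq_one := by
    rw [← lintegral_withDensity_ofReal hf.measurable hf.nonneg hg.measurable, hg.lintegral_eq_one]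

theorem memLp_sqrt (hf : IsProbDensity ν f) : MemLp (fun z => √(f z)) 2 ν := by
  rw [memLp_two_iff_integrable_sq hf.measurable.sqrt.aestronglyMeasurable]
  simpa only [Real.sq_sqrt (hf.nonneg _)] using hf.integrable

theorem integrable_sqrt_mul_sqrt (hf : IsProbDensity ν f) (hg : IsProbDensity ν g) :
    Integrable (fun z => √(f z) * √(g z)) ν :=
  hf.memLp_sqrt.integrable_mul hg.memLp_sqrt

theorem hellingerSq_eq (hf : IsProbDensity ν f) (hg : IsProbDensity ν g) :
    hellingerSq ν f g = ENNReal.ofReal (2 - 2 * ∫ z, √(f z) * √(g z) ∂ν) := by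
  have h_expand (z : Z) : (√(f z) - √(g z)) ^ 2 = f z + g z - 2 * (√(f z) * √(g z)) := by
    rw [sub_sq, Real.sq_sqrt (hf.nonneg z), Real.sq_sqrt (hg.nonneg z)]
    ring
  have h_sum : Integrable (fun z => f z + g z) ν := hf.integrable.add hg.integrable
  have h_sq : Integrable (fun z => (√(f z) - √(g z)) ^ 2) ν :=
    (hf.memLp_sqrt.sub hg.memLp_sqrt).integrable_sq
  rw [hellingerSq, ← ofReal_integral_eq_lintegral_ofReal h_sq (ae_of_all _ fun _ => sq_nonneg _)]
  simp_rw [h_expand]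
  rw [integral_sub h_sum ((hf.integrable_sqrt_mul_sqrt hg).const_mul 2),
    integral_add hf.integrable hg.integrable, hf.integral_eq_one, hg.integral_eq_one,
    integral_const_mul]
  norm_num

end IsProbDensity

/- `x - y = (√x - √y) (√x + √y)`, and AM-GM with weight `t` separates the two factors. -/
theorem ofReal_le_ofReal_add_sq_sub_sqrt {x y t : ℝ} (hx : 0 ≤ x) (hy : 0 ≤ y) (ht : 0 < t) :
    ENNReal.ofReal x ≤ ENNReal.ofReal y +
      (ENNReal.ofReal (1 / (2 * t)) * ENNReal.ofReal ((√x - √y) ^ 2) +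
        ENNReal.ofReal t * (ENNReal.ofReal x + ENNReal.ofReal y)) := by
  rw [← ENNReal.ofReal_mul (by positivity), ← ENNReal.ofReal_add (by positivity) (by positivity),
    ← ENNReal.ofReal_mul (by positivity), ← ENNReal.ofReal_add (by positivity) (by positivity),
    ← ENNReal.ofReal_add (by positivity) (by positivity)]
  apply ENNReal.ofReal_le_ofReal
  rw [← Real.sq_sqrt hx, ← Real.sq_sqrt hy, Real.sqrt_sq (Real.sqrt_nonneg _),
    Real.sqrt_sq (Real.sqrt_nonneg _)]
  generalize √x = a, √y = b
  have h_sq : 0 ≤ ((a - b) / t - (a + b)) ^ 2 * t / 2 := by positivity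
  have h_expand : ((a - b) / t - (a + b)) ^ 2 * t / 2 =
      1 / (2 * t) * (a - b) ^ 2 - (a ^ 2 - b ^ 2) + t * (a + b) ^ 2 / 2 := by
    field_simp
    ring
  nlinarith [mul_nonneg ht.le (sq_nonneg (a - b))]

theorem lintegral_withDensity_le_add_hellingerSq (hf : IsProbDensity ν f) (hg : IsProbDensity ν g)
    {t : ℝ} (ht : 0 < t) {F : Z → ℝ≥0∞} (hF : Measurable F) {C : ℝ≥0∞} (hFC : ∀ z, F z ≤ C) :
    ∫⁻ z, F z ∂(ν.withDensity fun z => ENNReal.ofReal (f z)) ≤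
      ∫⁻ z, F z ∂(ν.withDensity fun z => ENNReal.ofReal (g z)) +
        C * (ENNReal.ofReal (1 / (2 * t)) * hellingerSq ν f g + ENNReal.ofReal (2 * t)) := by
  have hf_meas := hf.measurable
  have hg_meas := hg.measurable
  rw [lintegral_withDensity_eq_lintegral_mul _ (by fun_prop) hF,
    lintegral_withDensity_eq_lintegral_mul _ (by fun_prop) hF]
  calc ∫⁻ z, ENNReal.ofReal (f z) * F z ∂ν
      ≤ ∫⁻ z, (ENNReal.ofReal (g z) * F z + C * (ENNReal.ofReal (1 / (2 * t)) *
          ENNReal.ofReal ((√(f z) - √(g z)) ^ 2) +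
            ENNReal.ofReal t * (ENNReal.ofReal (f z) + ENNReal.ofReal (g z)))) ∂ν := by
        refine lintegral_mono fun z => (mul_le_mul_left
          (ofReal_le_ofReal_add_sq_sub_sqrt (hf.nonneg z) (hg.nonneg z) ht) (F z)).trans ?_
        rw [add_mul, mul_comm C]
        gcongr
        exact hFC z
    _ = ∫⁻ z, ENNReal.ofReal (g z) * F z ∂ν + C * (ENNReal.ofReal (1 / (2 * t)) *
          hellingerSq ν f g + ENNReal.ofReal t * (1 + 1)) := by
        rw [lintegral_add_right _ (by fun_prop), lintegral_const_mul _ (by fun_prop),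
          lintegral_add_right _ (by fun_prop), lintegral_const_mul _ (by fun_prop),
          lintegral_const_mul _ (by fun_prop), lintegral_add_right _ (by fun_prop),
          hf.lintegral_eq_one, hg.lintegral_eq_one, hellingerSq]
    _ = _ := by
        rw [one_add_one_eq_two, ENNReal.ofReal_mul zero_le_two, ENNReal.ofReal_ofNat,
          mul_comm (ENNReal.ofReal t)]
        rfl

section Product

variable [Fintype ι]

theorem lintegral_pi_ofReal_prod {ν : ι → Measure Z} [∀ i, SigmaFinite (ν i)]
    (hf₀ : ∀ z, 0 ≤ f z) (hf : ∀ i, Integrable f (ν i)) :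
    ∫⁻ z, ENNReal.ofReal (∏ i, f (z i)) ∂(Measure.pi ν) =
      ∏ i, ∫⁻ z, ENNReal.ofReal (f z) ∂(ν i) := by
  have h_prod : Integrable (fun z : ι → Z => ∏ i, f (z i)) (Measure.pi ν) :=
    Integrable.fintype_prod (f := fun _ => f) hf
  rw [← ofReal_integral_eq_lintegral_ofReal h_prod
    (ae_of_all _ fun z => Finset.prod_nonneg fun i _ => hf₀ _),
    integral_fintype_prod_eq_prod (f := fun _ => f),
    ENNReal.ofReal_prod_of_nonneg fun i _ => integral_nonneg hf₀]
  exact Finset.prod_congr rfl fun i _ =>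
    ofReal_integral_eq_lintegral_ofReal (hf i) (ae_of_all _ hf₀)

variable [SigmaFinite ν]

theorem IsProbDensity.pi_withDensity (hf : IsProbDensity ν f) :
    (Measure.pi fun _ : ι => ν.withDensity fun z => ENNReal.ofReal (f z)) =
      (Measure.pi fun _ : ι => ν).withDensity fun z => ENNReal.ofReal (∏ i, f (z i)) := by
  have := hf.isProbabilityMeasure_withDensity
  refine Measure.pi_eq fun s hs => ?_
  rw [withDensity_apply _ (MeasurableSet.univ_pi hs), Measure.restrict_pi_pi,
    lintegral_pi_ofReal_prod hf.nonneg fun i =>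
      hf.integrable.mono_measure Measure.restrict_le_self]
  exact Finset.prod_congr rfl fun i _ => (withDensity_apply _ (hs i)).symm

theorem IsProbDensity.pi (hf : IsProbDensity ν f) :
    IsProbDensity (Measure.pi fun _ : ι => ν) fun z => ∏ i, f (z i) where
  measurable := by
    have := hf.measurable
    fun_prop
  nonneg z := Finset.prod_nonneg fun i _ => hf.nonneg _
  lintegral_eq_one := by
    rw [lintegral_pi_ofReal_prod hf.nonneg fun _ => hf.integrable, hf.lintegral_eq_one,
      Finset.prod_const_one]

theorem hellingerSq_pi_le (hf : IsProbDensity ν f) (hg : IsProbDensity ν g) :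
    hellingerSq (Measure.pi fun _ : ι => ν) (fun z => ∏ i, f (z i)) (fun z => ∏ i, g (z i)) ≤
      Fintype.card ι * hellingerSq ν f g := by
  have h_affinity : ∫ z : ι → Z, √(∏ i, f (z i)) * √(∏ i, g (z i)) ∂(Measure.pi fun _ => ν) =
      (∫ z, √(f z) * √(g z) ∂ν) ^ Fintype.card ι := by
    simp_rw [Real.sqrt_prod _ fun _ _ => hf.nonneg _, Real.sqrt_prod _ fun _ _ => hg.nonneg _,
      ← Finset.prod_mul_distrib]
    exact integral_fintype_prod_eq_pow fun z => √(f z) * √(g z)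
  rw [hf.pi.hellingerSq_eq hg.pi, hf.hellingerSq_eq hg, h_affinity, ← ENNReal.ofReal_natCast,
    ← ENNReal.ofReal_mul (Nat.cast_nonneg _)]
  apply ENNReal.ofReal_le_ofReal
  set ρ := ∫ z, √(f z) * √(g z) ∂ν
  have hρ : 0 ≤ ρ := integral_nonneg fun z => by positivity
  have h_bernoulli := one_add_mul_le_pow (a := ρ - 1) (by linarith) (Fintype.card ι)
  rw [add_sub_cancel] at h_bernoulli
  linarith

end Product

section DominatingMeasure

variable {μ : Measure Z}

theorem add_mul_div_add_cancel {x y : ℝ} (hx : 0 ≤ x) (hy : 0 ≤ y) :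
    (x + y) * (x / (x + y)) = x :=
  mul_div_cancel_of_imp' fun h => by linarith

theorem add_mul_sqrt_div_sub_sqrt_div_sq {x y : ℝ} (hx : 0 ≤ x) (hy : 0 ≤ y) :
    (x + y) * (√(x / (x + y)) - √(y / (x + y))) ^ 2 = (√x - √y) ^ 2 := by
  have hxy : 0 ≤ x + y := add_nonneg hx hy
  rw [← Real.sq_sqrt hxy, ← mul_pow, mul_sub, Real.sq_sqrt hxy, ← Real.sqrt_mul hxy,
    ← Real.sqrt_mul hxy, add_mul_div_add_cancel hx hy, add_comm, add_mul_div_add_cancel hy hx]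

theorem IsProbDensity.div (hf : IsProbDensity μ f) (hg : Measurable g) (hg₀ : ∀ z, 0 ≤ g z)
    (hfg : ∀ z, g z * (f z / g z) = f z) :
    IsProbDensity (μ.withDensity fun z => ENNReal.ofReal (g z)) fun z => f z / g z where
  measurable := hf.measurable.div hg
  nonneg z := div_nonneg (hf.nonneg z) (hg₀ z)
  lintegral_eq_one := by
    have := hf.measurable
    rw [lintegral_withDensity_ofReal hg hg₀ (by fun_prop)]
    simp_rw [hfg, hf.lintegral_eq_one]

theorem IsProbDensity.pi_withDensity_div [Fintype ι] (hf : IsProbDensity μ f) (hg : Measurable g)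
    (hg₀ : ∀ z, 0 ≤ g z) (hfg : ∀ z, g z * (f z / g z) = f z)
    [SigmaFinite (μ.withDensity fun z => ENNReal.ofReal (g z))] :
    (Measure.pi fun _ : ι => μ.withDensity fun z => ENNReal.ofReal (f z)) =
      (Measure.pi fun _ : ι => μ.withDensity fun z => ENNReal.ofReal (g z)).withDensity
        fun z => ENNReal.ofReal (∏ i, f (z i) / g (z i)) := by
  rw [← (hf.div hg hg₀ hfg).pi_withDensity,
    ← withDensity_ofReal_mul hg hg₀ (hf.div hg hg₀ hfg).measurable]
  simp_rw [hfg]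

theorem hellingerSq_div_add (hf : IsProbDensity μ f) (hg : IsProbDensity μ g) :
    hellingerSq (μ.withDensity fun z => ENNReal.ofReal (f z + g z))
      (fun z => f z / (f z + g z)) (fun z => g z / (f z + g z)) = hellingerSq μ f g := by
  have hf_meas := hf.measurable
  have hg_meas := hg.measurable
  rw [hellingerSq, lintegral_withDensity_ofReal (by fun_prop)
    (fun z => add_nonneg (hf.nonneg z) (hg.nonneg z)) (by fun_prop)]
  simp_rw [add_mul_sqrt_div_sub_sqrt_div_sq (hf.nonneg _) (hg.nonneg _), hellingerSq]

/- Densities with respect to an arbitrary `μ` become densities with respect to the finite measure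
`(f + g) μ`, whose powers exist. -/
theorem lintegral_pi_withDensity_le [Fintype ι] (hf : IsProbDensity μ f) (hg : IsProbDensity μ g)
    {t : ℝ} (ht : 0 < t) {F : (ι → Z) → ℝ≥0∞} (hF : Measurable F) {C : ℝ≥0∞}
    (hFC : ∀ z, F z ≤ C) :
    ∫⁻ z, F z ∂(Measure.pi fun _ : ι => μ.withDensity fun z => ENNReal.ofReal (f z)) ≤
      ∫⁻ z, F z ∂(Measure.pi fun _ : ι => μ.withDensity fun z => ENNReal.ofReal (g z)) +
        C * (ENNReal.ofReal (1 / (2 * t)) * (Fintype.card ι * hellingerSq μ f g) +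
          ENNReal.ofReal (2 * t)) := by
  have h_sum : Measurable fun z => f z + g z := hf.measurable.add hg.measurable
  have h_sum_nonneg (z : Z) : 0 ≤ f z + g z := add_nonneg (hf.nonneg z) (hg.nonneg z)
  have : IsFiniteMeasure (μ.withDensity fun z => ENNReal.ofReal (f z + g z)) :=
    isFiniteMeasure_withDensity_ofReal (hf.integrable.add hg.integrable).2
  have h_f (z : Z) : (f z + g z) * (f z / (f z + g z)) = f z :=
    add_mul_div_add_cancel (hf.nonneg z) (hg.nonneg z)
  have h_g (z : Z) : (f z + g z) * (g z / (f z + g z)) = g z := by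
    rw [add_comm, add_mul_div_add_cancel (hg.nonneg z) (hf.nonneg z)]
  have hf' := hf.div h_sum h_sum_nonneg h_f
  have hg' := hg.div h_sum h_sum_nonneg h_g
  rw [hf.pi_withDensity_div h_sum h_sum_nonneg h_f, hg.pi_withDensity_div h_sum h_sum_nonneg h_g,
    ← hellingerSq_div_add hf hg]
  have h_pi := lintegral_withDensity_le_add_hellingerSq (hf'.pi (ι := ι)) hg'.pi ht hF hFC
  grw [hellingerSq_pi_le hf' hg'] at h_pi
  exact h_pi

end DominatingMeasure

end Hellinger

section GaussianShift

open scoped ENNReal RealInnerProductSpace MatrixOrder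
open Matrix WithLp

variable {ι : Type*} [Fintype ι]

theorem integral_cexp_inner_stdGaussian (a t : EuclideanSpace ℝ ι) :
    ∫ x, Complex.exp ((⟪x, a⟫ : ℝ) + (⟪x, t⟫ : ℝ) * Complex.I) ∂(stdGaussian (EuclideanSpace ℝ ι)) =
      Complex.exp (∑ i, ((a i : ℂ) + t i * Complex.I) ^ 2 / 2) := by
  have h_prod (x : ι → ℝ) : Complex.exp ((⟪toLp 2 x, a⟫ : ℝ) + (⟪toLp 2 x, t⟫ : ℝ) * Complex.I) =
      ∏ i, Complex.exp (((a i : ℂ) + t i * Complex.I) * x i) := by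
    rw [← Complex.exp_sum]
    congr 1
    simp only [PiLp.inner_apply, RCLike.inner_apply, conj_trivial, Complex.ofReal_sum,
      Complex.ofReal_mul, Finset.sum_mul, ← Finset.sum_add_distrib]
    exact Finset.sum_congr rfl fun i _ => by ring
  rw [← map_pi_eq_stdGaussian, integral_map (by fun_prop) (by fun_prop)]
  simp_rw [h_prod]
  rw [integral_fintype_prod_eq_prod
    (f := fun i (x : ℝ) => Complex.exp (((a i : ℂ) + t i * Complex.I) * x)), Complex.exp_sum]
  refine Finset.prod_congr rfl fun i _ => ?_
  simpa [complexMGF] using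
    complexMGF_id_gaussianReal (μ := 0) (v := 1) ((a i : ℂ) + t i * Complex.I)

theorem integrable_exp_inner_stdGaussian (a : EuclideanSpace ℝ ι) :
    Integrable (fun x => Real.exp ⟪x, a⟫) (stdGaussian (EuclideanSpace ℝ ι)) := by
  -- Otherwise the integral of the exponential would be the junk value `0`.
  by_contra h_not
  have h_eq := integral_cexp_inner_stdGaussian a 0
  rw [integral_undef fun h_int => h_not (by simpa [Complex.norm_exp] using h_int.norm)] at h_eq
  exact Complex.exp_ne_zero _ h_eq.symm

theorem cexp_mul_sum_sq_div_two (a t : EuclideanSpace ℝ ι) :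
    Complex.exp ((⟪t, a⟫ : ℝ) * Complex.I) * Complex.exp (-‖t‖ ^ 2 / 2) =
      Complex.exp (-(‖a‖ ^ 2 / 2 : ℝ)) *
        Complex.exp (∑ i, ((a i : ℂ) + t i * Complex.I) ^ 2 / 2) := by
  rw [← Complex.exp_add, ← Complex.exp_add, EuclideanSpace.real_norm_sq_eq, ← Complex.ofReal_pow,
    EuclideanSpace.real_norm_sq_eq]
  congr 1
  simp only [PiLp.inner_apply, RCLike.inner_apply, conj_trivial]
  push_cast
  simp only [Finset.sum_mul, Finset.sum_div, ← Finset.sum_neg_distrib, ← Finset.sum_add_distrib]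
  refine Finset.sum_congr rfl fun i _ => ?_
  ring_nf
  simp only [Complex.I_sq]
  ring

theorem map_add_stdGaussian (a : EuclideanSpace ℝ ι) :
    (stdGaussian (EuclideanSpace ℝ ι)).map (fun x => a + x) =
      (stdGaussian (EuclideanSpace ℝ ι)).withDensity
        fun x => ENNReal.ofReal (Real.exp (⟪x, a⟫ - ‖a‖ ^ 2 / 2)) := by
  have h_int : Integrable (fun x => Real.exp (⟪x, a⟫ - ‖a‖ ^ 2 / 2))
      (stdGaussian (EuclideanSpace ℝ ι)) := by
    simp_rw [Real.exp_sub]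
    exact (integrable_exp_inner_stdGaussian a).div_const _
  have : IsFiniteMeasure ((stdGaussian (EuclideanSpace ℝ ι)).withDensity
        fun x => ENNReal.ofReal (Real.exp (⟪x, a⟫ - ‖a‖ ^ 2 / 2))) :=
    isFiniteMeasure_withDensity_ofReal h_int.2
  have : IsProbabilityMeasure ((stdGaussian (EuclideanSpace ℝ ι)).map (fun x => a + x)) :=
    Measure.isProbabilityMeasure_map (by fun_prop)
  refine Measure.ext_of_charFun (funext fun t => ?_)
  have h_density (x : EuclideanSpace ℝ ι) :
      (ENNReal.ofReal (Real.exp (⟪x, a⟫ - ‖a‖ ^ 2 / 2))).toReal •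
        Complex.exp ((⟪x, t⟫ : ℝ) * Complex.I) = Complex.exp (-(‖a‖ ^ 2 / 2 : ℝ)) *
          Complex.exp ((⟪x, a⟫ : ℝ) + (⟪x, t⟫ : ℝ) * Complex.I) := by
    rw [ENNReal.toReal_ofReal (Real.exp_nonneg _), Complex.real_smul, Complex.ofReal_exp,
      ← Complex.exp_add, ← Complex.exp_add]
    congr 1
    push_cast
    ring
  rw [charFun_map_const_add, charFun_stdGaussian, charFun_apply,
    integral_withDensity_eq_integral_toReal_smul (by fun_prop)
      (ae_of_all _ fun _ => ENNReal.ofReal_lt_top)]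
  simp_rw [h_density]
  rw [integral_const_mul, integral_cexp_inner_stdGaussian, ← cexp_mul_sum_sq_div_two,
    real_inner_comm, mul_comm]

variable [DecidableEq ι]

theorem lintegral_mul_expTilt_multivariateGaussian {S : Matrix ι ι ℝ} (hS : S.PosSemidef)
    (h : EuclideanSpace ℝ ι) {F : EuclideanSpace ℝ ι → ℝ≥0∞} (hF : Measurable F) :
    ∫⁻ d, F d * expTilt h d ∂(multivariateGaussian 0 S) =
      ENNReal.ofReal (Real.exp ((h ⬝ᵥ S *ᵥ h) / 2)) *
        ∫⁻ d, F d ∂(multivariateGaussian (toEuclideanCLM (𝕜 := ℝ) S h) S) := by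
  set A := toEuclideanCLM (𝕜 := ℝ) (CFC.sqrt S) with hA
  have h_sq : A * A = toEuclideanCLM (𝕜 := ℝ) S := by
    rw [hA, ← map_mul, CFC.sqrt_mul_sqrt_self _ hS.nonneg]
  have h_self : IsSelfAdjoint A := (CFC.sqrt_nonneg S).isSelfAdjoint.map _
  have h_symm (x y : EuclideanSpace ℝ ι) : ⟪A x, y⟫ = ⟪x, A y⟫ := by
    rw [← ContinuousLinearMap.adjoint_inner_right, h_self.adjoint_eq]
  have h_norm : ‖A h‖ ^ 2 = h ⬝ᵥ S *ᵥ h := by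
    rw [← real_inner_self_eq_norm_sq, h_symm, ← inner_toEuclideanCLM, ← h_sq]
    rfl
  have h_mean (x : EuclideanSpace ℝ ι) : toEuclideanCLM (𝕜 := ℝ) S h + A x = A (A h + x) := by
    rw [map_add, ← h_sq]
    rfl
  have h_shift := lintegral_map (μ := stdGaussian (EuclideanSpace ℝ ι)) (f := fun y => F (A y))
    (g := fun x => A h + x) (by fun_prop) (by fun_prop)
  rw [multivariateGaussian, multivariateGaussian, lintegral_map (by fun_prop) (by fun_prop),
    lintegral_map hF (by fun_prop)]
  simp_rw [← hA, h_mean, zero_add]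
  rw [← h_shift, map_add_stdGaussian, lintegral_withDensity_eq_lintegral_mul _ (by fun_prop)
    (by fun_prop), ← lintegral_const_mul _ (by fun_prop)]
  refine lintegral_congr fun x => ?_
  rw [expTilt, Pi.mul_apply, ← mul_assoc, ← ENNReal.ofReal_mul (Real.exp_nonneg _),
    ← Real.exp_add, h_norm, mul_comm, ← h_symm, real_inner_comm, add_sub_cancel]

theorem map_toEuclideanCLM_multivariateGaussian_inv {S : Matrix ι ι ℝ} (hS : S.PosDef)
    (h : EuclideanSpace ℝ ι) :
    (multivariateGaussian h S⁻¹).map (toEuclideanCLM (𝕜 := ℝ) S) =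
      multivariateGaussian (toEuclideanCLM (𝕜 := ℝ) S h) S := by
  have h_det : IsUnit S.det := (Matrix.isUnit_iff_isUnit_det S).1 hS.isUnit
  have h_self : IsSelfAdjoint (toEuclideanCLM (𝕜 := ℝ) S) :=
    (show IsSelfAdjoint S from hS.isHermitian).map _
  have h_symm (x y : EuclideanSpace ℝ ι) :
      ⟪toEuclideanCLM (𝕜 := ℝ) S x, y⟫ = ⟪x, toEuclideanCLM (𝕜 := ℝ) S y⟫ := by
    rw [← ContinuousLinearMap.adjoint_inner_right, h_self.adjoint_eq]
  have : IsProbabilityMeasure ((multivariateGaussian h S⁻¹).map (toEuclideanCLM (𝕜 := ℝ) S)) :=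
    Measure.isProbabilityMeasure_map (by fun_prop)
  refine Measure.ext_of_charFun (funext fun t => ?_)
  have h_charFun : charFun ((multivariateGaussian h S⁻¹).map (toEuclideanCLM (𝕜 := ℝ) S)) t =
      charFun (multivariateGaussian h S⁻¹) (toEuclideanCLM (𝕜 := ℝ) S t) := by
    rw [charFun_apply, charFun_apply, integral_map (by fun_prop) (by fun_prop)]
    simp_rw [h_symm]
  rw [h_charFun, charFun_multivariateGaussian hS.inv.posSemidef,
    charFun_multivariateGaussian hS.posSemidef, h_symm]
  congr 3
  rw [ofLp_toEuclideanCLM, mulVec_mulVec, Matrix.nonsing_inv_mul _ h_det, one_mulVec,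
    dotProduct_comm]

theorem lintegral_multivariateGaussian_inv {S : Matrix ι ι ℝ} (hS : S.PosDef)
    (h : EuclideanSpace ℝ ι) {F : EuclideanSpace ℝ ι → ℝ≥0∞} (hF : Measurable F) :
    ENNReal.ofReal (Real.exp ((h ⬝ᵥ S *ᵥ h) / 2)) *
      ∫⁻ z, F (toEuclideanCLM (𝕜 := ℝ) S z) ∂(multivariateGaussian h S⁻¹) =
      ∫⁻ d, F d * expTilt h d ∂(multivariateGaussian 0 S) := by
  rw [lintegral_mul_expTilt_multivariateGaussian hS.posSemidef h hF,
    ← map_toEuclideanCLM_multivariateGaussian_inv hS, lintegral_map hF (by fun_prop)]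

end GaussianShift

section Score

open scoped ENNReal RealInnerProductSpace

variable {Z : Type*} [MeasurableSpace Z] {m : ℕ} {μ : Measure Z}
  {Θ : Set (EuclideanSpace ℝ (Fin m))} {p : EuclideanSpace ℝ (Fin m) → Z → ℝ}
  {θ₀ : EuclideanSpace ℝ (Fin m)} {s : Z → EuclideanSpace ℝ (Fin m)}

theorem IsDensityFamily.isProbDensity (hp : IsDensityFamily μ Θ p)
    {θ : EuclideanSpace ℝ (Fin m)} (hθ : θ ∈ Θ) : IsProbDensity μ (p θ) :=
  ⟨hp.measurable θ hθ, hp.nonneg θ hθ, hp.lintegral_eq_one θ hθ⟩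

theorem IsDensityFamily.isProbabilityMeasure_obsLaw (hp : IsDensityFamily μ Θ p)
    {θ : EuclideanSpace ℝ (Fin m)} (hθ : θ ∈ Θ) : IsProbabilityMeasure (obsLaw μ p θ) :=
  (hp.isProbDensity hθ).isProbabilityMeasure_withDensity

theorem eventually_add_mem_of_mem_interior (hθ₀ : θ₀ ∈ interior Θ) :
    ∀ᶠ h in 𝓝 (0 : EuclideanSpace ℝ (Fin m)), θ₀ + h ∈ Θ := by
  have h_tendsto : Tendsto (fun h : EuclideanSpace ℝ (Fin m) => θ₀ + h) (𝓝 0) (𝓝 θ₀) :=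
    Continuous.tendsto' (by fun_prop) 0 θ₀ (add_zero θ₀)
  exact h_tendsto (mem_interior_iff_mem_nhds.1 hθ₀)

/-- The remainder in the definition of differentiability in quadratic mean. -/
def dqmRemainder (p : EuclideanSpace ℝ (Fin m) → Z → ℝ) (θ₀ : EuclideanSpace ℝ (Fin m))
    (s : Z → EuclideanSpace ℝ (Fin m)) (h : EuclideanSpace ℝ (Fin m)) (z : Z) : ℝ :=
  √(p (θ₀ + h) z) - √(p θ₀ z) - 1 / 2 * ⟪h, s z⟫ * √(p θ₀ z)

theorem measurable_dqmRemainder (hp : IsDensityFamily μ Θ p) (hθ : θ₀ ∈ Θ) (hs : Measurable s)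
    {h : EuclideanSpace ℝ (Fin m)} (hh : θ₀ + h ∈ Θ) : Measurable (dqmRemainder p θ₀ s h) := by
  have := hp.measurable _ hθ
  have := hp.measurable _ hh
  unfold dqmRemainder
  fun_prop

theorem IsDQM.eventually_memLp_remainder (hp : IsDensityFamily μ Θ p) (hθ₀ : θ₀ ∈ interior Θ)
    (hs : IsDQM μ p θ₀ s) {ε : ℝ} (hε : 0 < ε) :
    ∀ᶠ h in 𝓝 (0 : EuclideanSpace ℝ (Fin m)), θ₀ + h ∈ Θ ∧
      MemLp (dqmRemainder p θ₀ s h) 2 μ ∧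
      ∫ z, dqmRemainder p θ₀ s h z ^ 2 ∂μ ≤ ε * ‖h‖ ^ 2 := by
  filter_upwards [eventually_add_mem_of_mem_interior hθ₀, hs.2 ε hε] with h hh h_le
  have h_meas := measurable_dqmRemainder hp (interior_subset hθ₀) hs.1 hh
  refine ⟨hh, ?_, ?_⟩
  · refine (memLp_two_iff_integrable_sq h_meas.aestronglyMeasurable).2 ⟨by fun_prop, ?_⟩
    rw [hasFiniteIntegral_iff_ofReal (ae_of_all _ fun _ => sq_nonneg _)]
    exact h_le.trans_lt ENNReal.ofReal_lt_top
  · rw [integral_eq_lintegral_of_nonneg_ae (ae_of_all _ fun _ => sq_nonneg _) (by fun_prop)]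
    exact ENNReal.toReal_le_of_le_ofReal (by positivity) h_le

theorem tendsto_smul_nhds_zero (h : EuclideanSpace ℝ (Fin m)) :
    Tendsto (fun t : ℝ => t • h) (𝓝 0) (𝓝 0) :=
  Continuous.tendsto' (by fun_prop) 0 0 (zero_smul ℝ h)

theorem IsDQM.memLp_inner_mul_sqrt (hp : IsDensityFamily μ Θ p) (hθ₀ : θ₀ ∈ interior Θ)
    (hs : IsDQM μ p θ₀ s) (h : EuclideanSpace ℝ (Fin m)) :
    MemLp (fun z => ⟪h, s z⟫ * √(p θ₀ z)) 2 μ := by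
  have h_ev := (tendsto_smul_nhds_zero h).eventually (hs.eventually_memLp_remainder hp hθ₀ one_pos)
  obtain ⟨t, ⟨h_mem, h_memLp, -⟩, ht⟩ :=
    ((h_ev.filter_mono nhdsWithin_le_nhds).and self_mem_nhdsWithin).exists (f := 𝓝[>] (0 : ℝ))
  have h_eq : (fun z => ⟪h, s z⟫ * √(p θ₀ z)) = fun z =>
      2 / t * (√(p (θ₀ + t • h) z) - √(p θ₀ z) - dqmRemainder p θ₀ s (t • h) z) := by
    funext z
    rw [dqmRemainder, real_inner_smul_left]
    field_simp [ne_of_gt ht]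
    ring
  rw [h_eq]
  exact (((hp.isProbDensity h_mem).memLp_sqrt.sub
    (hp.isProbDensity (interior_subset hθ₀)).memLp_sqrt).sub h_memLp).const_mul _

theorem IsDQM.integrable_inner_sq (hp : IsDensityFamily μ Θ p) (hθ₀ : θ₀ ∈ interior Θ)
    (hs : IsDQM μ p θ₀ s) (h : EuclideanSpace ℝ (Fin m)) :
    Integrable (fun z => ⟪h, s z⟫ ^ 2) (obsLaw μ p θ₀) := by
  have hp₀ := hp.isProbDensity (interior_subset hθ₀)
  refine (hp₀.integrable_withDensity_iff _).2 ?_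
  simpa only [mul_pow, Real.sq_sqrt (hp₀.nonneg _)] using
    (hs.memLp_inner_mul_sqrt hp hθ₀ h).integrable_sq

theorem IsDQM.memLp_score (hp : IsDensityFamily μ Θ p) (hθ₀ : θ₀ ∈ interior Θ)
    (hs : IsDQM μ p θ₀ s) : MemLp s 2 (obsLaw μ p θ₀) := by
  have := hs.1
  rw [memLp_two_iff_integrable_sq_norm (by fun_prop)]
  simp_rw [EuclideanSpace.real_norm_sq_eq]
  refine integrable_finsetSum _ fun i _ => ?_
  simpa [EuclideanSpace.inner_single_left] using!
    hs.integrable_inner_sq hp hθ₀ (EuclideanSpace.single i 1)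

open Classical in
/-- The root density `√(p θ)` as a vector of `L²(μ)`, with the junk value `0` if it is not
square integrable. -/
def rootDensity (μ : Measure Z) (p : EuclideanSpace ℝ (Fin m) → Z → ℝ)
    (θ : EuclideanSpace ℝ (Fin m)) : Lp ℝ 2 μ :=
  if h : MemLp (fun z => √(p θ z)) 2 μ then h.toLp _ else 0

theorem coeFn_rootDensity (hp : IsDensityFamily μ Θ p) {θ : EuclideanSpace ℝ (Fin m)}
    (hθ : θ ∈ Θ) : rootDensity μ p θ =ᵐ[μ] fun z => √(p θ z) := by
  rw [rootDensity, dif_pos (hp.isProbDensity hθ).memLp_sqrt]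
  exact MemLp.coeFn_toLp _

theorem norm_sq_eq_integral_sq {f : Lp ℝ 2 μ} {g : Z → ℝ} (hfg : f =ᵐ[μ] g) :
    ‖f‖ ^ 2 = ∫ z, g z ^ 2 ∂μ := by
  rw [← real_inner_self_eq_norm_sq, L2.inner_def]
  refine integral_congr_ae (hfg.mono fun z hz => ?_)
  simp only [hz, real_inner_self_eq_norm_sq, Real.norm_eq_abs, sq_abs]

theorem norm_sq_rootDensity (hp : IsDensityFamily μ Θ p) {θ : EuclideanSpace ℝ (Fin m)}
    (hθ : θ ∈ Θ) : ‖rootDensity μ p θ‖ ^ 2 = 1 := by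
  have hpθ := hp.isProbDensity hθ
  rw [norm_sq_eq_integral_sq (coeFn_rootDensity hp hθ)]
  simp_rw [Real.sq_sqrt (hpθ.nonneg _), hpθ.integral_eq_one]

theorem IsDQM.hasDerivAt_rootDensity (hp : IsDensityFamily μ Θ p) (hθ₀ : θ₀ ∈ interior Θ)
    (hs : IsDQM μ p θ₀ s) (h : EuclideanSpace ℝ (Fin m)) :
    HasDerivAt (fun t : ℝ => rootDensity μ p (θ₀ + t • h))
      ((1 / 2 : ℝ) • (hs.memLp_inner_mul_sqrt hp hθ₀ h).toLp _) 0 := by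
  rw [hasDerivAt_iff_isLittleO_nhds_zero, Asymptotics.isLittleO_iff]
  intro c hc
  have hε : 0 < c ^ 2 / (‖h‖ ^ 2 + 1) := by positivity
  filter_upwards [(tendsto_smul_nhds_zero h).eventually
    (hs.eventually_memLp_remainder hp hθ₀ hε)] with t ⟨h_mem, _, h_le⟩
  rw [zero_add, zero_smul, add_zero]
  have h_coe : (rootDensity μ p (θ₀ + t • h) - rootDensity μ p θ₀ -
      t • (1 / 2 : ℝ) • (hs.memLp_inner_mul_sqrt hp hθ₀ h).toLp _ : Lp ℝ 2 μ) =ᵐ[μ]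
        dqmRemainder p θ₀ s (t • h) := by
    filter_upwards [Lp.coeFn_sub (rootDensity μ p (θ₀ + t • h) - rootDensity μ p θ₀)
        (t • (1 / 2 : ℝ) • (hs.memLp_inner_mul_sqrt hp hθ₀ h).toLp _),
      Lp.coeFn_sub (rootDensity μ p (θ₀ + t • h)) (rootDensity μ p θ₀),
      Lp.coeFn_smul t ((1 / 2 : ℝ) • (hs.memLp_inner_mul_sqrt hp hθ₀ h).toLp _),
      Lp.coeFn_smul (1 / 2 : ℝ) ((hs.memLp_inner_mul_sqrt hp hθ₀ h).toLp _),
      (hs.memLp_inner_mul_sqrt hp hθ₀ h).coeFn_toLp, coeFn_rootDensity hp h_mem,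
      coeFn_rootDensity hp (interior_subset hθ₀)] with z h₁ h₂ h₃ h₄ h₅ h₆ h₇
    simp only [h₁, h₂, h₃, h₄, h₅, h₆, h₇, Pi.sub_apply, Pi.smul_apply, smul_eq_mul, dqmRemainder,
      real_inner_smul_left]
    ring
  refine (pow_le_pow_iff_left₀ (norm_nonneg _) (by positivity) two_ne_zero).1 ?_
  rw [norm_sq_eq_integral_sq h_coe]
  refine h_le.trans ?_
  rw [norm_smul, mul_pow, mul_pow, div_mul_eq_mul_div, div_le_iff₀ (by positivity)]
  nlinarith [mul_nonneg (sq_nonneg c) (sq_nonneg ‖t‖)]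

/- The root densities are unit vectors of `L²(μ)`, hence orthogonal to their derivative. -/
theorem IsDQM.integral_inner_score (hp : IsDensityFamily μ Θ p) (hθ₀ : θ₀ ∈ interior Θ)
    (hs : IsDQM μ p θ₀ s) (h : EuclideanSpace ℝ (Fin m)) :
    ∫ z, ⟪h, s z⟫ ∂(obsLaw μ p θ₀) = 0 := by
  have hθ := interior_subset hθ₀
  have h_deriv := (hs.hasDerivAt_rootDensity hp hθ₀ h).norm_sq
  have h_const : (fun t : ℝ => ‖rootDensity μ p (θ₀ + t • h)‖ ^ 2) =ᶠ[𝓝 0] fun _ => 1 := by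
    filter_upwards [(tendsto_smul_nhds_zero h).eventually
      (eventually_add_mem_of_mem_interior hθ₀)] with t ht using norm_sq_rootDensity hp ht
  have h_orth := h_deriv.unique ((hasDerivAt_const 0 1).congr_of_eventuallyEq h_const)
  rw [zero_smul, add_zero, real_inner_smul_right, ← mul_assoc, mul_one_div_cancel two_ne_zero,
    one_mul, L2.inner_def] at h_orth
  have hp₀ := hp.isProbDensity hθ
  refine (hp₀.integral_withDensity _).trans (h_orth ▸ integral_congr_ae ?_)
  filter_upwards [(hs.memLp_inner_mul_sqrt hp hθ₀ h).coeFn_toLp, coeFn_rootDensity hp hθ]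
    with z h_score h_root
  simp only [h_score, h_root, RCLike.inner_apply, conj_trivial]
  rw [mul_assoc, Real.mul_self_sqrt (hp₀.nonneg z)]

theorem IsDQM.integral_score (hp : IsDensityFamily μ Θ p) (hθ₀ : θ₀ ∈ interior Θ)
    (hs : IsDQM μ p θ₀ s) : ∫ z, s z ∂(obsLaw μ p θ₀) = 0 := by
  have := hp.isProbabilityMeasure_obsLaw (interior_subset hθ₀)
  refine ext_inner_left ℝ fun h => ?_
  rw [← integral_inner ((hs.memLp_score hp hθ₀).integrable one_le_two),
    hs.integral_inner_score hp hθ₀, inner_zero_right]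

end Score

section CentredTruncation

open scoped RealInnerProductSpace

variable {Z E : Type*} [NormedAddCommGroup E] {s : Z → E}

/-- The truncation of `s` at norm `t`: values of larger norm are replaced by `0`. -/
def normTrunc (s : Z → E) (t : ℝ) : Z → E :=
  {z | ‖s z‖ ≤ t}.indicator s

theorem norm_normTrunc_le (s : Z → E) (t : ℝ) (z : Z) : ‖normTrunc s t z‖ ≤ ‖s z‖ :=
  norm_indicator_le_norm_self _ _

theorem norm_normTrunc_le_of_nonneg (s : Z → E) {t : ℝ} (ht : 0 ≤ t) (z : Z) :
    ‖normTrunc s t z‖ ≤ t := by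
  by_cases h : ‖s z‖ ≤ t
  · exact (norm_normTrunc_le s t z).trans h
  · rwa [normTrunc, Set.indicator_of_notMem (show z ∉ {z | ‖s z‖ ≤ t} from h), norm_zero]

theorem tendsto_normTrunc (s : Z → E) {t : ℕ → ℝ} (ht : Tendsto t atTop atTop) (z : Z) :
    Tendsto (fun n => normTrunc s (t n) z) atTop (𝓝 (s z)) := by
  refine tendsto_const_nhds.congr' ?_
  filter_upwards [ht.eventually_ge_atTop ‖s z‖] with n hn
  exact (Set.indicator_of_mem (show z ∈ {z | ‖s z‖ ≤ t n} from hn) _).symm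

variable [MeasurableSpace Z] {P : Measure Z} {t : ℕ → ℝ}

/-- The truncation of `s` at norm `t`, centred under `P`. -/
def centredTrunc [NormedSpace ℝ E] (P : Measure Z) (s : Z → E) (t : ℝ) (z : Z) : E :=
  normTrunc s t z - ∫ x, normTrunc s t x ∂P

theorem norm_centredTrunc_le_two_mul [NormedSpace ℝ E] [IsProbabilityMeasure P] (s : Z → E)
    {t : ℝ} (ht : 0 ≤ t) (z : Z) : ‖centredTrunc P s t z‖ ≤ 2 * t := by
  have h_mean : ‖∫ x, normTrunc s t x ∂P‖ ≤ t := by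
    simpa using norm_integral_le_of_norm_le_const (μ := P)
      (ae_of_all _ (norm_normTrunc_le_of_nonneg s ht))
  calc ‖centredTrunc P s t z‖ ≤ ‖normTrunc s t z‖ + ‖∫ x, normTrunc s t x ∂P‖ := norm_sub_le _ _
    _ ≤ t + t := add_le_add (norm_normTrunc_le_of_nonneg s ht z) h_mean
    _ = 2 * t := (two_mul t).symm

variable [MeasurableSpace E] [BorelSpace E]

theorem measurable_normTrunc (hs : Measurable s) (t : ℝ) : Measurable (normTrunc s t) :=
  hs.indicator (hs.norm measurableSet_Iic)

theorem measurable_centredTrunc [NormedSpace ℝ E] (hs : Measurable s) (t : ℝ) :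
    Measurable (centredTrunc P s t) :=
  (measurable_normTrunc hs t).sub_const _

variable [SecondCountableTopology E]

theorem integrable_normTrunc (hsm : Measurable s) (hs : Integrable s P) (t : ℝ) :
    Integrable (normTrunc s t) P :=
  hs.mono (measurable_normTrunc hsm t).aestronglyMeasurable (ae_of_all _ (norm_normTrunc_le s t))

section NormedSpace

variable [NormedSpace ℝ E]

theorem norm_centredTrunc_le (hsm : Measurable s) (hs : Integrable s P) (t : ℝ) (z : Z) :
    ‖centredTrunc P s t z‖ ≤ ‖s z‖ + ∫ x, ‖s x‖ ∂P := by
  refine (norm_sub_le _ _).trans (add_le_add (norm_normTrunc_le s t z) ?_)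
  exact (norm_integral_le_integral_norm _).trans
    (integral_mono (integrable_normTrunc hsm hs t).norm hs.norm (norm_normTrunc_le s t))

theorem norm_centredTrunc_sub_le (hsm : Measurable s) (hs : Integrable s P) (t : ℝ) (z : Z) :
    ‖centredTrunc P s t z - s z‖ ≤ 2 * ‖s z‖ + ∫ x, ‖s x‖ ∂P := by
  linarith [norm_sub_le (centredTrunc P s t z) (s z), norm_centredTrunc_le hsm hs t z]

theorem tendsto_centredTrunc (hsm : Measurable s) (hs : Integrable s P)
    (hs_mean : ∫ z, s z ∂P = 0) (ht : Tendsto t atTop atTop) (z : Z) :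
    Tendsto (fun n => centredTrunc P s (t n) z) atTop (𝓝 (s z)) := by
  have h_mean : Tendsto (fun n => ∫ x, normTrunc s (t n) x ∂P) atTop (𝓝 0) := by
    rw [← hs_mean]
    exact tendsto_integral_of_dominated_convergence (fun z => ‖s z‖)
      (fun n => (measurable_normTrunc hsm _).aestronglyMeasurable) hs.norm
      (fun n => ae_of_all _ (norm_normTrunc_le s _)) (ae_of_all _ (tendsto_normTrunc s ht))
  simpa only [centredTrunc, sub_zero] using (tendsto_normTrunc s ht z).sub h_mean

variable [IsProbabilityMeasure P]

theorem integral_centredTrunc [CompleteSpace E] (hsm : Measurable s) (hs : Integrable s P)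
    (t : ℝ) : ∫ z, centredTrunc P s t z ∂P = 0 := by
  simp only [centredTrunc]
  rw [integral_sub (integrable_normTrunc hsm hs t) (integrable_const _), integral_const,
    probReal_univ, one_smul, sub_self]

theorem memLp_centredTrunc_sub (hsm : Measurable s) (hs : MemLp s 2 P) (t : ℝ) :
    MemLp (fun z => centredTrunc P s t z - s z) 2 P :=
  ((hs.norm.const_mul 2).add (memLp_const (∫ x, ‖s x‖ ∂P))).mono'
    ((measurable_centredTrunc hsm t).sub hsm).aestronglyMeasurable
    (ae_of_all _ (norm_centredTrunc_sub_le hsm (hs.integrable one_le_two) t))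

theorem tendsto_integral_norm_centredTrunc_sub_sq (hsm : Measurable s) (hs : MemLp s 2 P)
    (hs_mean : ∫ z, s z ∂P = 0) (ht : Tendsto t atTop atTop) :
    Tendsto (fun n => ∫ z, ‖centredTrunc P s (t n) z - s z‖ ^ 2 ∂P) atTop (𝓝 0) := by
  have hsi := hs.integrable one_le_two
  rw [← integral_zero Z ℝ (μ := P)]
  refine tendsto_integral_of_dominated_convergence
    (fun z => (2 * ‖s z‖ + ∫ x, ‖s x‖ ∂P) ^ 2)
    (fun n => (((measurable_centredTrunc hsm _).sub hsm).norm.pow_const 2).aestronglyMeasurable)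
    ((hs.norm.const_mul 2).add (memLp_const _)).integrable_sq
    (fun n => ae_of_all _ fun z => ?_) (ae_of_all _ fun z => ?_)
  · rw [norm_pow, norm_norm]
    gcongr
    exact norm_centredTrunc_sub_le hsm hsi _ z
  · simpa using ((tendsto_centredTrunc hsm hsi hs_mean ht z).sub_const (s z)).norm.pow 2

end NormedSpace

theorem tendsto_integral_inner_centredTrunc_sq [InnerProductSpace ℝ E] [IsProbabilityMeasure P]
    (hsm : Measurable s) (hs : MemLp s 2 P) (hs_mean : ∫ z, s z ∂P = 0)
    (ht : Tendsto t atTop atTop) (h : E) :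
    Tendsto (fun n => ∫ z, ⟪h, centredTrunc P s (t n) z⟫ ^ 2 ∂P) atTop
      (𝓝 (∫ z, ⟪h, s z⟫ ^ 2 ∂P)) := by
  have hsi := hs.integrable one_le_two
  refine tendsto_integral_of_dominated_convergence
    (fun z => (‖h‖ * (‖s z‖ + ∫ x, ‖s x‖ ∂P)) ^ 2)
    (fun n => ?_) ((hs.norm.add (memLp_const _)).const_mul ‖h‖).integrable_sq
    (fun n => ae_of_all _ fun z => ?_) (ae_of_all _ fun z => ?_)
  · exact ((measurable_centredTrunc hsm _).const_inner.pow_const 2).aestronglyMeasurable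
  · rw [norm_pow]
    gcongr
    exact (norm_inner_le_norm _ _).trans
      (mul_le_mul_of_nonneg_left (norm_centredTrunc_le hsm hsi _ z) (norm_nonneg h))
  · exact (tendsto_const_nhds.inner (tendsto_centredTrunc hsm hsi hs_mean ht z)).pow 2

end CentredTruncation

section ScoreApproximation

open scoped RealInnerProductSpace

variable {Z : Type*} [MeasurableSpace Z] {m : ℕ}

/-- `u n` is a centred approximation in `L²(P)` of the score `s`, of supremum norm `o(√n)` with
rate `δ`. -/
structure IsScoreApprox (P : Measure Z) (s : Z → EuclideanSpace ℝ (Fin m))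
    (u : ℕ → Z → EuclideanSpace ℝ (Fin m)) (δ : ℕ → ℝ) : Prop where
  measurable : ∀ n, Measurable (u n)
  integral_eq_zero : ∀ n, ∫ z, u n z ∂P = 0
  bound : ∀ n z, ‖u n z‖ ≤ δ n * √n
  tendsto_bound : Tendsto δ atTop (𝓝 0)
  memLp_sub : ∀ n, MemLp (fun z => u n z - s z) 2 P
  tendsto_sub_sq : Tendsto (fun n => ∫ z, ‖u n z - s z‖ ^ 2 ∂P) atTop (𝓝 0)
  tendsto_inner_sq : ∀ h, Tendsto (fun n => ∫ z, ⟪h, u n z⟫ ^ 2 ∂P) atTop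
    (𝓝 (∫ z, ⟪h, s z⟫ ^ 2 ∂P))

theorem exists_isScoreApprox (P : Measure Z) [IsProbabilityMeasure P]
    {s : Z → EuclideanSpace ℝ (Fin m)} (hsm : Measurable s) (hs : MemLp s 2 P)
    (hs_mean : ∫ z, s z ∂P = 0) : ∃ u δ, IsScoreApprox P s u δ := by
  have ht : Tendsto (fun n : ℕ => √√(n : ℝ)) atTop atTop :=
    Real.tendsto_sqrt_atTop.comp (Real.tendsto_sqrt_atTop.comp tendsto_natCast_atTop_atTop)
  have hsi := hs.integrable one_le_two
  refine ⟨fun n => centredTrunc P s √√n, fun n => 2 * (√√n)⁻¹,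
    fun n => measurable_centredTrunc hsm _, fun n => integral_centredTrunc hsm hsi _,
    fun n z => ?_, ?_, fun n => memLp_centredTrunc_sub hsm hs _,
    tendsto_integral_norm_centredTrunc_sub_sq hsm hs hs_mean ht,
    tendsto_integral_inner_centredTrunc_sq hsm hs hs_mean ht⟩
  · refine (norm_centredTrunc_le_two_mul s (Real.sqrt_nonneg _) z).trans_eq ?_
    rw [mul_assoc, inv_mul_eq_div, Real.div_sqrt]
  · simpa only [mul_zero, Pi.inv_apply] using ht.inv_tendsto_atTop.const_mul 2

theorem tendsto_zero_of_tendsto_natCast_mul {𝕜 : Type*} [RCLike 𝕜] {a : ℕ → 𝕜} {l : 𝕜}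
    (ha : Tendsto (fun n : ℕ => (n : 𝕜) * a n) atTop (𝓝 l)) : Tendsto a atTop (𝓝 0) := by
  have h_inv : Tendsto (fun n : ℕ => (n : 𝕜)⁻¹) atTop (𝓝 0) := tendsto_inv_atTop_nhds_zero_nat
  have h_mul := h_inv.mul ha
  rw [zero_mul] at h_mul
  refine h_mul.congr' ?_
  filter_upwards [eventually_ne_atTop 0] with n hn
  exact inv_mul_cancel_left₀ (Nat.cast_ne_zero.2 hn) _

theorem norm_cexp_ofReal_sub_le {c : ℂ} {x : ℝ} (hx : ‖c‖ * |x| ≤ 1) :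
    ‖Complex.exp (c * x) - 1 - c * x - c ^ 2 / 2 * (x ^ 2 : ℝ)‖ ≤ 3 * ‖c‖ ^ 3 * |x| * x ^ 2 := by
  have h_norm : ‖c * (x : ℂ)‖ = ‖c‖ * |x| := by simp
  have h_taylor := Complex.norm_exp_sub_sum_le_norm_mul_exp (c * (x : ℂ)) 3
  have h_sum : ∑ k ∈ Finset.range 3, (c * (x : ℂ)) ^ k / (k.factorial : ℂ) =
      1 + c * x + c ^ 2 / 2 * (x ^ 2 : ℝ) := by
    simp [Finset.sum_range_succ, Nat.factorial]
    ring
  have h_exp : Real.exp ‖c * (x : ℂ)‖ ≤ 3 :=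
    (Real.exp_le_exp.2 (h_norm.trans_le hx)).trans
      (Real.exp_one_lt_d9.le.trans (by norm_num))
  rw [h_sum, ← sub_sub, ← sub_sub] at h_taylor
  calc _ ≤ ‖c * (x : ℂ)‖ ^ 3 * Real.exp ‖c * (x : ℂ)‖ := h_taylor
    _ ≤ ‖c * (x : ℂ)‖ ^ 3 * 3 := by gcongr
    _ = 3 * ‖c‖ ^ 3 * |x| * x ^ 2 := by rw [h_norm, ← sq_abs x]; ring

namespace IsScoreApprox

variable {P : Measure Z} {s : Z → EuclideanSpace ℝ (Fin m)}
  {u : ℕ → Z → EuclideanSpace ℝ (Fin m)} {δ : ℕ → ℝ}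

/-- The scaled linear statistic `h'u(z) / √n`. -/
def lin (u : ℕ → Z → EuclideanSpace ℝ (Fin m)) (h : EuclideanSpace ℝ (Fin m)) (n : ℕ) (z : Z) :
    ℝ :=
  ⟪h, u n z⟫ / √n

theorem measurable_lin (hu : IsScoreApprox P s u δ) (h : EuclideanSpace ℝ (Fin m)) (n : ℕ) :
    Measurable (lin u h n) :=
  (hu.measurable n).const_inner.div_const _

theorem abs_lin_le (hu : IsScoreApprox P s u δ) (h : EuclideanSpace ℝ (Fin m)) (n : ℕ) (z : Z) :
    |lin u h n z| ≤ ‖h‖ * |δ n| := by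
  rw [lin, abs_div, abs_of_nonneg (Real.sqrt_nonneg _)]
  refine div_le_of_le_mul₀ (Real.sqrt_nonneg _) (by positivity) ?_
  calc |⟪h, u n z⟫| ≤ ‖h‖ * ‖u n z‖ := abs_real_inner_le_norm _ _
    _ ≤ ‖h‖ * (|δ n| * √n) := by
      gcongr
      exact (hu.bound n z).trans (by gcongr; exact le_abs_self _)
    _ = ‖h‖ * |δ n| * √n := (mul_assoc _ _ _).symm

theorem tendsto_abs_lin_bound (hu : IsScoreApprox P s u δ) (h : EuclideanSpace ℝ (Fin m)) :
    Tendsto (fun n => ‖h‖ * |δ n|) atTop (𝓝 0) := by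
  simpa using hu.tendsto_bound.abs.const_mul ‖h‖

theorem natCast_mul_integral_lin_sq {n : ℕ} (hn : n ≠ 0) (h : EuclideanSpace ℝ (Fin m)) :
    (n : ℝ) * ∫ z, lin u h n z ^ 2 ∂P = ∫ z, ⟪h, u n z⟫ ^ 2 ∂P := by
  simp only [lin, div_pow, Real.sq_sqrt (Nat.cast_nonneg n)]
  rw [integral_div, mul_div_cancel₀ _ (Nat.cast_ne_zero.2 hn)]

theorem tendsto_natCast_mul_integral_lin_sq (hu : IsScoreApprox P s u δ)
    (h : EuclideanSpace ℝ (Fin m)) :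
    Tendsto (fun n : ℕ => (n : ℝ) * ∫ z, lin u h n z ^ 2 ∂P) atTop
      (𝓝 (∫ z, ⟪h, s z⟫ ^ 2 ∂P)) := by
  refine (hu.tendsto_inner_sq h).congr' ?_
  filter_upwards [eventually_ne_atTop 0] with n hn
  exact (natCast_mul_integral_lin_sq hn h).symm

variable [IsProbabilityMeasure P]

theorem integrable_of_continuous_lin (hu : IsScoreApprox P s u δ) (h : EuclideanSpace ℝ (Fin m))
    (n : ℕ) {E : Type*} [NormedAddCommGroup E] [SecondCountableTopology E] [MeasurableSpace E]
    [BorelSpace E] {f : ℝ → E} (hf : Continuous f) : Integrable (fun z => f (lin u h n z)) P := by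
  obtain ⟨B, hB⟩ := (isCompact_Icc (a := -(‖h‖ * |δ n|))
    (b := ‖h‖ * |δ n|)).exists_bound_of_continuousOn hf.continuousOn
  exact Integrable.of_bound (hf.measurable.comp (hu.measurable_lin h n)).aestronglyMeasurable B
    (ae_of_all _ fun z => hB _ (abs_le.1 (hu.abs_lin_le h n z)))

theorem integrable_lin (hu : IsScoreApprox P s u δ) (h : EuclideanSpace ℝ (Fin m)) (n : ℕ) :
    Integrable (lin u h n) P :=
  hu.integrable_of_continuous_lin h n continuous_id

theorem integrable_lin_sq (hu : IsScoreApprox P s u δ) (h : EuclideanSpace ℝ (Fin m)) (n : ℕ) :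
    Integrable (fun z => lin u h n z ^ 2) P :=
  hu.integrable_of_continuous_lin h n (continuous_pow 2)

theorem integral_lin (hu : IsScoreApprox P s u δ) (h : EuclideanSpace ℝ (Fin m)) (n : ℕ) :
    ∫ z, lin u h n z ∂P = 0 := by
  have h_int : Integrable (u n) P := Integrable.of_bound (hu.measurable n).aestronglyMeasurable _
    (ae_of_all _ (hu.bound n))
  simp only [lin]
  rw [integral_div, integral_inner h_int, hu.integral_eq_zero, inner_zero_right, zero_div]

theorem integral_cexp_lin_sub (hu : IsScoreApprox P s u δ) (h : EuclideanSpace ℝ (Fin m)) (c : ℂ)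
    (n : ℕ) :
    ∫ z, (Complex.exp (c * lin u h n z) - 1 - c * lin u h n z -
      c ^ 2 / 2 * (lin u h n z ^ 2 : ℝ)) ∂P =
    ∫ z, Complex.exp (c * lin u h n z) ∂P - 1 - c ^ 2 / 2 * (∫ z, lin u h n z ^ 2 ∂P : ℝ) := by
  have h_exp : Integrable (fun z => Complex.exp (c * lin u h n z)) P :=
    hu.integrable_of_continuous_lin h n (f := fun x : ℝ => Complex.exp (c * x)) (by fun_prop)
  have h_lin : Integrable (fun z => c * (lin u h n z : ℂ)) P :=
    (hu.integrable_lin h n).ofReal.const_mul c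
  have h_sq : Integrable (fun z => c ^ 2 / 2 * ((lin u h n z ^ 2 : ℝ) : ℂ)) P :=
    (hu.integrable_lin_sq h n).ofReal.const_mul _
  have h_exp_one : Integrable (fun z => Complex.exp (c * lin u h n z) - 1) P :=
    h_exp.sub (integrable_const 1)
  have h_exp_lin : Integrable (fun z => Complex.exp (c * lin u h n z) - 1 - c * lin u h n z) P :=
    h_exp_one.sub h_lin
  rw [integral_sub h_exp_lin h_sq, integral_sub h_exp_one h_lin,
    integral_sub h_exp (integrable_const _), integral_const_mul, integral_const_mul,
    integral_complex_ofReal, integral_complex_ofReal, hu.integral_lin]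
  simp

theorem norm_integral_cexp_lin_sub_le (hu : IsScoreApprox P s u δ) (h : EuclideanSpace ℝ (Fin m))
    {c : ℂ} {n : ℕ} (hn : ‖c‖ * (‖h‖ * |δ n|) ≤ 1) :
    ‖∫ z, Complex.exp (c * lin u h n z) ∂P - 1 - c ^ 2 / 2 * (∫ z, lin u h n z ^ 2 ∂P : ℝ)‖ ≤
      3 * ‖c‖ ^ 3 * (‖h‖ * |δ n|) * ∫ z, lin u h n z ^ 2 ∂P := by
  rw [← hu.integral_cexp_lin_sub, ← integral_const_mul]
  refine norm_integral_le_of_norm_le ((hu.integrable_lin_sq h n).const_mul _)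
    (ae_of_all _ fun z => ?_)
  have h_lin := hu.abs_lin_le h n z
  refine (norm_cexp_ofReal_sub_le (le_trans (by gcongr) hn)).trans ?_
  gcongr

theorem tendsto_natCast_mul_cexp_sub_one (hu : IsScoreApprox P s u δ)
    (h : EuclideanSpace ℝ (Fin m)) (c : ℂ) :
    Tendsto (fun n : ℕ => (n : ℂ) * (∫ z, Complex.exp (c * lin u h n z) ∂P - 1)) atTop
      (𝓝 (c ^ 2 * (∫ z, ⟪h, s z⟫ ^ 2 ∂P : ℝ) / 2)) := by
  have h_quad : Tendsto (fun n : ℕ => c ^ 2 / 2 * ((n * ∫ z, lin u h n z ^ 2 ∂P : ℝ) : ℂ)) atTop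
      (𝓝 (c ^ 2 * (∫ z, ⟪h, s z⟫ ^ 2 ∂P : ℝ) / 2)) := by
    rw [mul_div_right_comm]
    exact ((Complex.continuous_ofReal.tendsto _).comp
      (hu.tendsto_natCast_mul_integral_lin_sq h)).const_mul (c ^ 2 / 2)
  have h_rem : Tendsto (fun n : ℕ => 3 * ‖c‖ ^ 3 * ((‖h‖ * |δ n|) *
      (n * ∫ z, lin u h n z ^ 2 ∂P))) atTop (𝓝 0) := by
    simpa using ((hu.tendsto_abs_lin_bound h).mul
      (hu.tendsto_natCast_mul_integral_lin_sq h)).const_mul (3 * ‖c‖ ^ 3)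
  have h_small : ∀ᶠ n in atTop, ‖c‖ * (‖h‖ * |δ n|) ≤ 1 := by
    have := (hu.tendsto_abs_lin_bound h).const_mul ‖c‖
    rw [mul_zero] at this
    exact this.eventually_le_const one_pos
  refine (tendsto_iff_of_dist (squeeze_zero' (Eventually.of_forall fun _ => dist_nonneg) ?_
    h_rem)).1 h_quad
  filter_upwards [h_small] with n hn
  rw [dist_eq_norm, norm_sub_rev]
  calc _ = ‖(n : ℂ) * (∫ z, Complex.exp (c * lin u h n z) ∂P - 1 -
        c ^ 2 / 2 * (∫ z, lin u h n z ^ 2 ∂P : ℝ))‖ := by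
        congr 1
        push_cast
        ring
    _ = n * ‖∫ z, Complex.exp (c * lin u h n z) ∂P - 1 -
        c ^ 2 / 2 * (∫ z, lin u h n z ^ 2 ∂P : ℝ)‖ := by rw [norm_mul, Complex.norm_natCast]
    _ ≤ n * (3 * ‖c‖ ^ 3 * (‖h‖ * |δ n|) * ∫ z, lin u h n z ^ 2 ∂P) := by
        gcongr
        exact hu.norm_integral_cexp_lin_sub_le h hn
    _ = _ := by ring

theorem tendsto_pow_cexp (hu : IsScoreApprox P s u δ) (h : EuclideanSpace ℝ (Fin m)) (c : ℂ)
    {k : ℕ → ℕ} {lam : ℝ} (hk : Tendsto (fun n => (k n : ℝ) / n) atTop (𝓝 lam)) :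
    Tendsto (fun n : ℕ => (∫ z, Complex.exp (c * lin u h n z) ∂P) ^ k n) atTop
      (𝓝 (Complex.exp (lam * (c ^ 2 * (∫ z, ⟪h, s z⟫ ^ 2 ∂P : ℝ) / 2)))) := by
  have h_sub_one := hu.tendsto_natCast_mul_cexp_sub_one h c
  have h_log := Complex.tendsto_nat_mul_log_one_add_of_tendsto h_sub_one
  have h_share : Tendsto (fun n => (((k n : ℝ) / n : ℝ) : ℂ)) atTop (𝓝 (lam : ℂ)) :=
    (Complex.continuous_ofReal.tendsto _).comp hk
  refine ((Complex.continuous_exp.tendsto _).comp (h_share.mul h_log)).congr' ?_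
  filter_upwards [(tendsto_zero_of_tendsto_natCast_mul h_sub_one).eventually_ne
    (neg_ne_zero.2 one_ne_zero).symm, eventually_ne_atTop 0] with n hn hn₀
  have h_ne : ∫ z, Complex.exp (c * lin u h n z) ∂P ≠ 0 := fun h₀ => hn (by rw [h₀, zero_sub])
  have : (n : ℂ) ≠ 0 := Nat.cast_ne_zero.2 hn₀
  simp only [Function.comp_apply, add_sub_cancel]
  conv_rhs => rw [← Complex.exp_log h_ne, ← Complex.exp_nat_mul]
  congr 1
  push_cast
  field_simp

theorem tendsto_pow_exp (hu : IsScoreApprox P s u δ) (h : EuclideanSpace ℝ (Fin m))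
    {k : ℕ → ℕ} {lam : ℝ} (hk : Tendsto (fun n => (k n : ℝ) / n) atTop (𝓝 lam)) :
    Tendsto (fun n : ℕ => (∫ z, Real.exp (lin u h n z) ∂P) ^ k n) atTop
      (𝓝 (Real.exp (lam * (∫ z, ⟪h, s z⟫ ^ 2 ∂P) / 2))) := by
  have h_re := (Complex.continuous_re.tendsto _).comp (hu.tendsto_pow_cexp h 1 hk)
  simp only [one_pow, one_mul] at h_re
  convert h_re using 2
  · simp only [Function.comp_apply]
    norm_cast
  · rw [← mul_div_assoc]
    norm_cast

end IsScoreApprox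

end ScoreApproximation

section HellingerApproximation

open scoped RealInnerProductSpace

variable {Z : Type*} [MeasurableSpace Z] {m : ℕ}

theorem sq_one_add_half_sub_sqrt_exp_div_le {y M v : ℝ} (hy : |y| ≤ 1) (hM : 1 ≤ M)
    (hMv : M - 1 ≤ v) : (1 + y / 2 - √(Real.exp y / M)) ^ 2 ≤ y ^ 4 / 8 + 8 * v ^ 2 := by
  have hM_sqrt : 1 ≤ √M := Real.one_le_sqrt.2 hM
  have h_taylor : |Real.exp (y / 2) - 1 - y / 2| ≤ (y / 2) ^ 2 := by
    refine Real.abs_exp_sub_one_sub_id_le ?_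
    rw [abs_div, abs_two]
    linarith
  have h_exp : Real.exp (y / 2) ≤ 2 := by
    nlinarith [(abs_le.1 h_taylor).2, (abs_le.1 hy).1, (abs_le.1 hy).2]
  have h_ratio : (√M - 1) / √M ≤ v := by
    refine (div_le_self (by linarith) hM_sqrt).trans ((sub_le_sub_right ?_ 1).trans hMv)
    exact Real.sqrt_le_left (by linarith) |>.2 (by nlinarith)
  have h_normalise : |Real.exp (y / 2) - Real.exp (y / 2) / √M| ≤ 2 * v := by
    have h_eq : Real.exp (y / 2) - Real.exp (y / 2) / √M =
        Real.exp (y / 2) * ((√M - 1) / √M) := by field_simp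
    have : 0 ≤ (√M - 1) / √M := div_nonneg (by linarith) (by linarith)
    rw [h_eq, abs_of_nonneg (by positivity)]
    gcongr
  have h_abs : |1 + y / 2 - Real.exp (y / 2) / √M| ≤ y ^ 2 / 4 + 2 * v := by
    rw [abs_le] at h_taylor h_normalise ⊢
    constructor <;> linarith [h_taylor.1, h_taylor.2, h_normalise.1, h_normalise.2]
  rw [Real.sqrt_div' _ (by linarith), ← Real.exp_half]
  calc _ = |1 + y / 2 - Real.exp (y / 2) / √M| ^ 2 := (sq_abs _).symm
    _ ≤ (y ^ 2 / 4 + 2 * v) ^ 2 := by gcongr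
    _ ≤ y ^ 4 / 8 + 8 * v ^ 2 := by nlinarith [sq_nonneg (y ^ 2 / 4 - 2 * v)]

theorem IsProbDensity.hellingerSq_mul_le {μ : Measure Z} {f f' g a b r : Z → ℝ}
    (hf : IsProbDensity μ f)
    (h_eq : ∀ z, √(f' z) - √(f z * g z) = r z + (a z - b z) * √(f z))
    (hr : Integrable (fun z => r z ^ 2) μ)
    (ha : Integrable (fun z => a z ^ 2) (μ.withDensity fun z => ENNReal.ofReal (f z)))
    (hb : Integrable (fun z => b z ^ 2) (μ.withDensity fun z => ENNReal.ofReal (f z))) :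
    hellingerSq μ f' (fun z => f z * g z) ≤ ENNReal.ofReal (3 * (∫ z, r z ^ 2 ∂μ +
      (∫ z, a z ^ 2 ∂(μ.withDensity fun z => ENNReal.ofReal (f z)) +
        ∫ z, b z ^ 2 ∂(μ.withDensity fun z => ENNReal.ofReal (f z))))) := by
  have hab : Integrable (fun z => (a z ^ 2 + b z ^ 2) * f z) μ :=
    (hf.integrable_withDensity_iff _).1 (ha.add hb)
  have h_le (z : Z) : (√(f' z) - √(f z * g z)) ^ 2 ≤
      3 * (r z ^ 2 + (a z ^ 2 + b z ^ 2) * f z) := by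
    rw [h_eq, ← Real.sq_sqrt (hf.nonneg z), Real.sqrt_sq (Real.sqrt_nonneg _)]
    nlinarith [sq_nonneg (r z - a z * √(f z)), sq_nonneg (r z + b z * √(f z)),
      sq_nonneg (a z * √(f z) + b z * √(f z))]
  calc hellingerSq μ f' (fun z => f z * g z)
      ≤ ∫⁻ z, ENNReal.ofReal (3 * (r z ^ 2 + (a z ^ 2 + b z ^ 2) * f z)) ∂μ :=
        lintegral_mono fun z => ENNReal.ofReal_le_ofReal (h_le z)
    _ = ENNReal.ofReal (∫ z, 3 * (r z ^ 2 + (a z ^ 2 + b z ^ 2) * f z) ∂μ) :=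
        (ofReal_integral_eq_lintegral_ofReal ((hr.add hab).const_mul 3)
          (ae_of_all _ fun z => (sq_nonneg _).trans (h_le z))).symm
    _ = _ := by
        rw [integral_const_mul, integral_add hr hab, ← integral_add ha hb,
          hf.integral_withDensity]

namespace IsScoreApprox

variable {P : Measure Z} {s : Z → EuclideanSpace ℝ (Fin m)}
  {u : ℕ → Z → EuclideanSpace ℝ (Fin m)} {δ : ℕ → ℝ}

theorem integrable_inner_sub_div_sq (hu : IsScoreApprox P s u δ) (h : EuclideanSpace ℝ (Fin m))
    (n : ℕ) : Integrable (fun z => (⟪h, u n z - s z⟫ / (2 * √n)) ^ 2) P := by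
  simp only [div_pow]
  exact ((hu.memLp_sub n).const_inner h).integrable_sq.div_const _

theorem integral_inner_sub_div_sq_le (hu : IsScoreApprox P s u δ) (h : EuclideanSpace ℝ (Fin m))
    (n : ℕ) : ∫ z, (⟪h, u n z - s z⟫ / (2 * √n)) ^ 2 ∂P ≤
      ‖h‖ ^ 2 / (4 * n) * ∫ z, ‖u n z - s z‖ ^ 2 ∂P := by
  rw [← integral_const_mul]
  refine integral_mono (hu.integrable_inner_sub_div_sq h n)
    ((hu.memLp_sub n).norm.integrable_sq.const_mul _) fun z => ?_
  have h_inner : ⟪h, u n z - s z⟫ ^ 2 ≤ (‖h‖ * ‖u n z - s z‖) ^ 2 :=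
    sq_le_sq' (neg_le_of_abs_le (abs_real_inner_le_norm _ _)) (real_inner_le_norm _ _)
  calc (⟪h, u n z - s z⟫ / (2 * √n)) ^ 2 = ⟪h, u n z - s z⟫ ^ 2 / (4 * n) := by
        rw [div_pow, mul_pow, Real.sq_sqrt (Nat.cast_nonneg n)]
        norm_num
    _ ≤ (‖h‖ * ‖u n z - s z‖) ^ 2 / (4 * n) := by gcongr
    _ = ‖h‖ ^ 2 / (4 * n) * ‖u n z - s z‖ ^ 2 := by ring

theorem tendsto_hellinger_bound (hu : IsScoreApprox P s u δ) (h : EuclideanSpace ℝ (Fin m)) :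
    Tendsto (fun n : ℕ => ‖h‖ ^ 2 / 4 * (∫ z, ‖u n z - s z‖ ^ 2 ∂P) +
      ((‖h‖ * |δ n|) ^ 2 / 8 * (n * ∫ z, lin u h n z ^ 2 ∂P) +
        8 * (∫ z, lin u h n z ^ 2 ∂P) * (n * ∫ z, lin u h n z ^ 2 ∂P))) atTop (𝓝 0) := by
  have h_sq := hu.tendsto_natCast_mul_integral_lin_sq h
  have h_sup := (((hu.tendsto_abs_lin_bound h).pow 2).div_const 8).mul h_sq
  have h_mean := ((tendsto_zero_of_tendsto_natCast_mul h_sq).const_mul 8).mul h_sq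
  simpa using (hu.tendsto_sub_sq.const_mul (‖h‖ ^ 2 / 4)).add (h_sup.add h_mean)

/-- The exponential moment of the scaled linear statistic. -/
def expMean (P : Measure Z) (u : ℕ → Z → EuclideanSpace ℝ (Fin m)) (h : EuclideanSpace ℝ (Fin m))
    (n : ℕ) : ℝ :=
  ∫ z, Real.exp (lin u h n z) ∂P

variable [IsProbabilityMeasure P]

theorem integrable_exp_lin (hu : IsScoreApprox P s u δ) (h : EuclideanSpace ℝ (Fin m)) (n : ℕ) :
    Integrable (fun z => Real.exp (lin u h n z)) P :=
  hu.integrable_of_continuous_lin h n Real.continuous_exp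

theorem one_le_expMean (hu : IsScoreApprox P s u δ) (h : EuclideanSpace ℝ (Fin m)) (n : ℕ) :
    1 ≤ expMean P u h n := by
  have h_mono := integral_mono ((hu.integrable_lin h n).add (integrable_const 1))
    (hu.integrable_exp_lin h n) fun z => Real.add_one_le_exp (lin u h n z)
  rwa [integral_add' (hu.integrable_lin h n) (integrable_const _), hu.integral_lin, zero_add,
    integral_const, probReal_univ, one_smul] at h_mono

theorem expMean_sub_one_le (hu : IsScoreApprox P s u δ) (h : EuclideanSpace ℝ (Fin m)) {n : ℕ}
    (hn : ‖h‖ * |δ n| ≤ 1) : expMean P u h n - 1 ≤ ∫ z, lin u h n z ^ 2 ∂P := by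
  have h_exp_sub : Integrable (fun z => Real.exp (lin u h n z) - 1) P :=
    (hu.integrable_exp_lin h n).sub (integrable_const 1)
  calc expMean P u h n - 1 = ∫ z, (Real.exp (lin u h n z) - 1 - lin u h n z) ∂P := by
        rw [integral_sub h_exp_sub (hu.integrable_lin h n),
          integral_sub (hu.integrable_exp_lin h n) (integrable_const 1), hu.integral_lin,
          integral_const, probReal_univ, one_smul, sub_zero, expMean]
    _ ≤ ∫ z, lin u h n z ^ 2 ∂P :=
        integral_mono (h_exp_sub.sub (hu.integrable_lin h n)) (hu.integrable_lin_sq h n) fun z =>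
          (le_abs_self _).trans
            (Real.abs_exp_sub_one_sub_id_le ((hu.abs_lin_le h n z).trans hn))

theorem integrable_one_add_sub_sqrt_sq (hu : IsScoreApprox P s u δ)
    (h : EuclideanSpace ℝ (Fin m)) (n : ℕ) :
    Integrable (fun z => (1 + lin u h n z / 2 - √(Real.exp (lin u h n z) / expMean P u h n)) ^ 2)
      P :=
  hu.integrable_of_continuous_lin h n
    (f := fun x => (1 + x / 2 - √(Real.exp x / expMean P u h n)) ^ 2) (by fun_prop)

theorem integral_one_add_sub_sqrt_sq_le (hu : IsScoreApprox P s u δ)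
    (h : EuclideanSpace ℝ (Fin m)) {n : ℕ} (hn : ‖h‖ * |δ n| ≤ 1) :
    ∫ z, (1 + lin u h n z / 2 - √(Real.exp (lin u h n z) / expMean P u h n)) ^ 2 ∂P ≤
      (‖h‖ * |δ n|) ^ 2 / 8 * ∫ z, lin u h n z ^ 2 ∂P + 8 * (∫ z, lin u h n z ^ 2 ∂P) ^ 2 := by
  have h_sq := (hu.integrable_lin_sq h n).const_mul ((‖h‖ * |δ n|) ^ 2 / 8)
  have h_mono := integral_mono (hu.integrable_one_add_sub_sqrt_sq h n)
    (h_sq.add (integrable_const (8 * (∫ z, lin u h n z ^ 2 ∂P) ^ 2))) fun z => by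
      have h_lin := hu.abs_lin_le h n z
      refine (sq_one_add_half_sub_sqrt_exp_div_le (h_lin.trans hn) (hu.one_le_expMean h n)
        (hu.expMean_sub_one_le h hn)).trans (add_le_add_left ?_ _)
      calc lin u h n z ^ 4 / 8 = |lin u h n z| ^ 2 / 8 * lin u h n z ^ 2 := by rw [sq_abs]; ring
        _ ≤ (‖h‖ * |δ n|) ^ 2 / 8 * lin u h n z ^ 2 := by gcongr
  rwa [integral_add' h_sq (integrable_const _), integral_const_mul, integral_const, probReal_univ,
    one_smul] at h_mono

end IsScoreApprox

open IsScoreApprox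

variable {μ : Measure Z} {Θ : Set (EuclideanSpace ℝ (Fin m))}
  {p : EuclideanSpace ℝ (Fin m) → Z → ℝ} {θ₀ : EuclideanSpace ℝ (Fin m)}
  {s : Z → EuclideanSpace ℝ (Fin m)} {u : ℕ → Z → EuclideanSpace ℝ (Fin m)} {δ : ℕ → ℝ}

/-- The normalised exponential tilt of `P_{θ₀}` which approximates the law at `θ₀ + h / √n`, as a
density with respect to `P_{θ₀}`. -/
def tiltDensity (μ : Measure Z) (p : EuclideanSpace ℝ (Fin m) → Z → ℝ)
    (θ₀ : EuclideanSpace ℝ (Fin m)) (u : ℕ → Z → EuclideanSpace ℝ (Fin m))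
    (h : EuclideanSpace ℝ (Fin m)) (n : ℕ) (z : Z) : ℝ :=
  Real.exp (lin u h n z) / expMean (obsLaw μ p θ₀) u h n

theorem IsDQM.eventually_natCast_mul_remainder_le (hp : IsDensityFamily μ Θ p)
    (hθ₀ : θ₀ ∈ interior Θ) (hs : IsDQM μ p θ₀ s) (h : EuclideanSpace ℝ (Fin m)) {η : ℝ}
    (hη : 0 < η) :
    ∀ᶠ n : ℕ in atTop, localParam θ₀ h n ∈ Θ ∧
      MemLp (dqmRemainder p θ₀ s ((√(n : ℝ))⁻¹ • h)) 2 μ ∧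
      n * ∫ z, dqmRemainder p θ₀ s ((√(n : ℝ))⁻¹ • h) z ^ 2 ∂μ ≤ η := by
  have h_local : Tendsto (fun n : ℕ => (√(n : ℝ))⁻¹ • h) atTop (𝓝 0) :=
    (tendsto_smul_nhds_zero h).comp
      (Real.tendsto_sqrt_atTop.comp tendsto_natCast_atTop_atTop).inv_tendsto_atTop
  filter_upwards [h_local.eventually (hs.eventually_memLp_remainder hp hθ₀
    (ε := η / (‖h‖ ^ 2 + 1)) (by positivity)), eventually_gt_atTop 0]
    with n ⟨h_mem, h_memLp, h_le⟩ hn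
  have hn₀ : (0 : ℝ) < n := Nat.cast_pos.2 hn
  rw [norm_smul, mul_pow, norm_inv, Real.norm_of_nonneg (Real.sqrt_nonneg _), inv_pow,
    Real.sq_sqrt hn₀.le] at h_le
  refine ⟨h_mem, h_memLp, ?_⟩
  calc _ ≤ n * (η / (‖h‖ ^ 2 + 1) * ((n : ℝ)⁻¹ * ‖h‖ ^ 2)) := by gcongr
    _ = η * (‖h‖ ^ 2 / (‖h‖ ^ 2 + 1)) := by field_simp
    _ ≤ η := mul_le_of_le_one_right hη.le (div_le_one_of_le₀ (by linarith) (by positivity))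

theorem sqrt_localParam_sub_sqrt_tiltDensity {n : ℕ} (h : EuclideanSpace ℝ (Fin m)) {z : Z}
    (hz : 0 ≤ p θ₀ z) :
    √(p (localParam θ₀ h n) z) - √(p θ₀ z * tiltDensity μ p θ₀ u h n z) =
      dqmRemainder p θ₀ s ((√(n : ℝ))⁻¹ • h) z +
        ((1 + lin u h n z / 2 - √(tiltDensity μ p θ₀ u h n z)) -
          ⟪h, u n z - s z⟫ / (2 * √n)) * √(p θ₀ z) := by
  rw [Real.sqrt_mul hz, dqmRemainder, real_inner_smul_left, localParam, inner_sub_right, lin]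
  ring

/-- Both the truncation of the score and the normalisation of the tilt cost only `o(1 / n)` in
squared Hellinger distance, as does the remainder of the differentiability in quadratic mean. -/
theorem IsDQM.eventually_hellingerSq_le (hp : IsDensityFamily μ Θ p) (hθ₀ : θ₀ ∈ interior Θ)
    (hs : IsDQM μ p θ₀ s) (hu : IsScoreApprox (obsLaw μ p θ₀) s u δ)
    (h : EuclideanSpace ℝ (Fin m)) {η : ℝ} (hη : 0 < η) :
    ∀ᶠ n : ℕ in atTop, localParam θ₀ h n ∈ Θ ∧
      hellingerSq μ (p (localParam θ₀ h n)) (fun z => p θ₀ z * tiltDensity μ p θ₀ u h n z) ≤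
        ENNReal.ofReal (η / n) := by
  have hθ := interior_subset hθ₀
  have := hp.isProbabilityMeasure_obsLaw hθ
  filter_upwards [hs.eventually_natCast_mul_remainder_le hp hθ₀ h (η := η / 6) (by positivity),
    (hu.tendsto_hellinger_bound h).eventually_lt_const (show 0 < η / 6 by positivity),
    (hu.tendsto_abs_lin_bound h).eventually_le_const one_pos, eventually_gt_atTop 0]
    with n ⟨h_mem, h_memLp, h_rem⟩ h_bound h_small hn
  have hn₀ : (0 : ℝ) < n := Nat.cast_pos.2 hn
  refine ⟨h_mem, ((hp.isProbDensity hθ).hellingerSq_mul_le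
    (fun z => sqrt_localParam_sub_sqrt_tiltDensity h (hp.nonneg _ hθ z)) h_memLp.integrable_sq
    (hu.integrable_one_add_sub_sqrt_sq h n) (hu.integrable_inner_sub_div_sq h n)).trans
    (ENNReal.ofReal_le_ofReal ?_)⟩
  have h_tilt := hu.integral_one_add_sub_sqrt_sq_le h h_small
  have h_trunc := hu.integral_inner_sub_div_sq_le h n
  rw [le_div_iff₀ hn₀]
  set v := ∫ z, lin u h n z ^ 2 ∂(obsLaw μ p θ₀)
  set D := ∫ z, ‖u n z - s z‖ ^ 2 ∂(obsLaw μ p θ₀)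
  set R := ∫ z, dqmRemainder p θ₀ s ((√(n : ℝ))⁻¹ • h) z ^ 2 ∂μ
  calc _ ≤ 3 * (R + ((‖h‖ * |δ n|) ^ 2 / 8 * v + 8 * v ^ 2 + ‖h‖ ^ 2 / (4 * n) * D)) * n :=
        mul_le_mul_of_nonneg_right (mul_le_mul_of_nonneg_left
          (add_le_add_right (add_le_add h_tilt h_trunc) R) zero_le_three) hn₀.le
    _ = 3 * (n * R + (‖h‖ ^ 2 / 4 * D +
          ((‖h‖ * |δ n|) ^ 2 / 8 * (n * v) + 8 * v * (n * v)))) := by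
        field_simp
        ring
    _ ≤ η := by linarith

end HellingerApproximation

section ProductApproximation

open scoped ENNReal NNReal
open IsScoreApprox

variable {Z : Type*} [MeasurableSpace Z] {m : ℕ} {μ : Measure Z}
  {Θ : Set (EuclideanSpace ℝ (Fin m))}
  {p : EuclideanSpace ℝ (Fin m) → Z → ℝ} {θ₀ : EuclideanSpace ℝ (Fin m)}
  {s : Z → EuclideanSpace ℝ (Fin m)} {u : ℕ → Z → EuclideanSpace ℝ (Fin m)} {δ : ℕ → ℝ}

theorem IsScoreApprox.isProbDensity_tiltDensity [IsProbabilityMeasure (obsLaw μ p θ₀)]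
    (hu : IsScoreApprox (obsLaw μ p θ₀) s u δ) (h : EuclideanSpace ℝ (Fin m)) (n : ℕ) :
    IsProbDensity (obsLaw μ p θ₀) (tiltDensity μ p θ₀ u h n) where
  measurable := (hu.measurable_lin h n).exp.div_const _
  nonneg _ := div_nonneg (Real.exp_nonneg _) (integral_nonneg fun _ => Real.exp_nonneg _)
  lintegral_eq_one := by
    have h_pos : 0 < expMean (obsLaw μ p θ₀) u h n := one_pos.trans_le (hu.one_le_expMean h n)
    unfold tiltDensity
    rw [← ofReal_integral_eq_lintegral_ofReal ((hu.integrable_exp_lin h n).div_const _)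
        (ae_of_all _ fun _ => div_nonneg (Real.exp_nonneg _) h_pos.le),
      integral_div, ← expMean, div_self h_pos.ne', ENNReal.ofReal_one]

theorem lintegral_pi_withDensity_mul_tiltDensity (hp : IsDensityFamily μ Θ p) (hθ : θ₀ ∈ Θ)
    (hu : IsScoreApprox (obsLaw μ p θ₀) s u δ) (h : EuclideanSpace ℝ (Fin m)) (n : ℕ)
    {F : (Fin n → Z) → ℝ≥0∞} (hF : Measurable F) :
    ∫⁻ z, F z ∂(Measure.pi fun _ : Fin n => μ.withDensity fun z =>
        ENNReal.ofReal (p θ₀ z * tiltDensity μ p θ₀ u h n z)) =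
      ∫⁻ z, F z * ENNReal.ofReal (∏ i, tiltDensity μ p θ₀ u h n (z i))
        ∂(Measure.pi fun _ => obsLaw μ p θ₀) := by
  have := hp.isProbabilityMeasure_obsLaw hθ
  have hq := hu.isProbDensity_tiltDensity h n
  have hq_meas := hq.measurable
  rw [withDensity_ofReal_mul (hp.measurable _ hθ) (hp.nonneg _ hθ) hq_meas, ← obsLaw,
    hq.pi_withDensity,
    lintegral_withDensity_eq_lintegral_mul _ (by fun_prop) hF]
  simp only [Pi.mul_apply, mul_comm]

theorem exists_pos_mul_ofReal_le (C : ℝ≥0) {ε : ℝ≥0∞} (hε : 0 < ε) :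
    ∃ t : ℝ, 0 < t ∧ C * ENNReal.ofReal t ≤ ε := by
  have h_cont : Continuous fun t : ℝ => C * ENNReal.ofReal t :=
    (ENNReal.continuous_const_mul ENNReal.coe_ne_top).comp ENNReal.continuous_ofReal
  have h_lim : Tendsto (fun t : ℝ => C * ENNReal.ofReal t) (𝓝[>] 0) (𝓝 0) := by
    simpa using (h_cont.tendsto 0).mono_left nhdsWithin_le_nhds
  obtain ⟨t, ht_le, ht⟩ := ((h_lim.eventually_le_const hε).and self_mem_nhdsWithin).exists
  exact ⟨t, ht, ht_le⟩

theorem lintegral_pi_withDensity_le_add_ofReal {n : ℕ} (hn : 0 < n) {f g : Z → ℝ}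
    (hf : IsProbDensity μ f) (hg : IsProbDensity μ g) {t : ℝ} (ht : 0 < t)
    (h_le : hellingerSq μ f g ≤ ENNReal.ofReal (t ^ 2 / n)) {F : (Fin n → Z) → ℝ≥0∞}
    (hF : Measurable F) {C : ℝ≥0} (hFC : ∀ z, F z ≤ C) :
    ∫⁻ z, F z ∂(Measure.pi fun _ => μ.withDensity fun z => ENNReal.ofReal (f z)) ≤
      ∫⁻ z, F z ∂(Measure.pi fun _ => μ.withDensity fun z => ENNReal.ofReal (g z)) +
        C * ENNReal.ofReal (2 * t) := by
  have hn₀ : (n : ℝ) ≠ 0 := (Nat.cast_pos.2 hn).ne'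
  have h_const : ENNReal.ofReal (1 / (2 * (t / 2))) * (n * ENNReal.ofReal (t ^ 2 / n)) +
      ENNReal.ofReal (2 * (t / 2)) = ENNReal.ofReal (2 * t) := by
    rw [← ENNReal.ofReal_natCast n, ← ENNReal.ofReal_mul (by positivity),
      ← ENNReal.ofReal_mul (by positivity), ← ENNReal.ofReal_add (by positivity) (by positivity)]
    congr 1
    field_simp
    ring
  refine (lintegral_pi_withDensity_le hf hg (half_pos ht) hF hFC).trans ?_
  rw [← h_const, Fintype.card_fin]
  gcongr

theorem IsDQM.tendsto_lintegral_tiltDensity (hp : IsDensityFamily μ Θ p) (hθ₀ : θ₀ ∈ interior Θ)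
    (hs : IsDQM μ p θ₀ s) (hu : IsScoreApprox (obsLaw μ p θ₀) s u δ)
    (h : EuclideanSpace ℝ (Fin m)) {F : ∀ n : ℕ, (Fin n → Z) → ℝ≥0∞}
    (hF : ∀ n, Measurable (F n)) {C : ℝ≥0} (hFC : ∀ n z, F n z ≤ C) {l : ℝ≥0∞} (hl₀ : l ≠ ∞)
    (hl : Tendsto (fun n => ∫⁻ z, F n z ∂(sampleLaw μ p n (localParam θ₀ h n))) atTop (𝓝 l)) :
    Tendsto (fun n => ∫⁻ z, F n z * ENNReal.ofReal (∏ i, tiltDensity μ p θ₀ u h n (z i))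
      ∂(Measure.pi fun _ => obsLaw μ p θ₀)) atTop (𝓝 l) := by
  have hθ := interior_subset hθ₀
  have := hp.isProbabilityMeasure_obsLaw hθ
  rw [ENNReal.tendsto_nhds hl₀] at hl ⊢
  intro ε hε
  have hε₂ := ENNReal.half_pos hε.ne'
  obtain ⟨t, ht, htε⟩ := exists_pos_mul_ofReal_le C hε₂
  filter_upwards [hl (ε / 2) hε₂, hs.eventually_hellingerSq_le hp hθ₀ hu h
    (η := (t / 2) ^ 2) (by positivity), eventually_gt_atTop 0]
    with n ⟨h_lower, h_upper⟩ ⟨h_mem, h_le⟩ hn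
  have hf := hp.isProbDensity h_mem
  have hg : IsProbDensity μ fun z => p θ₀ z * tiltDensity μ p θ₀ u h n z :=
    (hp.isProbDensity hθ).mul (hu.isProbDensity_tiltDensity h n)
  have h_local_le :=
    lintegral_pi_withDensity_le_add_ofReal hn hf hg (half_pos ht) h_le (hF n) (hFC n)
  have h_tilt_le := lintegral_pi_withDensity_le_add_ofReal hn hg hf (half_pos ht)
    ((hellingerSq_comm ..).trans_le h_le) (hF n) (hFC n)
  rw [mul_div_cancel₀ t two_ne_zero,
    lintegral_pi_withDensity_mul_tiltDensity hp hθ hu h n (hF n)] at h_local_le h_tilt_le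
  constructor
  · rw [tsub_le_iff_right] at h_lower ⊢
    calc l ≤ _ := h_lower
      _ ≤ _ := add_le_add_left (h_local_le.trans (add_le_add_right htε _)) _
      _ = _ := by rw [add_assoc, ENNReal.add_halves]
  · calc _ ≤ _ := h_tilt_le
      _ ≤ l + ε / 2 + ε / 2 := add_le_add h_upper htε
      _ = l + ε := by rw [add_assoc, ENNReal.add_halves]

end ProductApproximation

section ScoreSum

open scoped ENNReal RealInnerProductSpace
open IsScoreApprox

variable {Z : Type*} {m n : ℕ}

/-- The sum over `i ∈ A` of the approximate scores `u n (z i)`, scaled by `1 / √n`. -/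
def scoreSum (u : ℕ → Z → EuclideanSpace ℝ (Fin m)) (A : Set (Fin n)) (z : Fin n → Z) :
    EuclideanSpace ℝ (Fin m) :=
  (√(n : ℝ))⁻¹ • ∑ i, A.indicator (fun i => u n (z i)) i

theorem inner_scoreSum (u : ℕ → Z → EuclideanSpace ℝ (Fin m)) (A : Set (Fin n))
    (h : EuclideanSpace ℝ (Fin m)) (z : Fin n → Z) :
    ⟪h, scoreSum u A z⟫ = ∑ i, A.indicator (fun i => lin u h n (z i)) i := by
  rw [scoreSum, inner_smul_right, inner_sum, Finset.mul_sum]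
  refine Finset.sum_congr rfl fun i _ => ?_
  by_cases hi : i ∈ A
  · rw [Set.indicator_of_mem hi, Set.indicator_of_mem hi, lin, div_eq_inv_mul]
  · rw [Set.indicator_of_notMem hi, Set.indicator_of_notMem hi, inner_zero_right, mul_zero]

theorem dependsOn_scoreSum (u : ℕ → Z → EuclideanSpace ℝ (Fin m)) (A : Set (Fin n)) :
    DependsOn (scoreSum u A) A := by
  intro x y hxy
  simp only [scoreSum, Set.indicator_congr fun i hi => congrArg (u n) (hxy i hi)]

theorem scoreSum_union (u : ℕ → Z → EuclideanSpace ℝ (Fin m)) {A B : Set (Fin n)}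
    (hAB : Disjoint A B) (z : Fin n → Z) :
    scoreSum u (A ∪ B) z = scoreSum u A z + scoreSum u B z := by
  simp only [scoreSum, Set.indicator_union_of_disjoint hAB, Finset.sum_add_distrib, smul_add]

variable [MeasurableSpace Z] {P : Measure Z} {s : Z → EuclideanSpace ℝ (Fin m)}
  {u : ℕ → Z → EuclideanSpace ℝ (Fin m)} {δ : ℕ → ℝ}

theorem IsScoreApprox.measurable_scoreSum (hu : IsScoreApprox P s u δ) (A : Set (Fin n)) :
    Measurable (scoreSum u A) := by
  unfold scoreSum
  refine (Finset.measurable_fun_sum _ fun i _ => ?_).const_smul (√(n : ℝ))⁻¹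
  by_cases hi : i ∈ A
  · simpa only [Set.indicator_of_mem hi, Function.comp_def] using
      (hu.measurable n).comp (measurable_pi_apply i)
  · simpa only [Set.indicator_of_notMem hi] using measurable_const

theorem integral_pi_prod_mulIndicator (P : Measure Z) [IsProbabilityMeasure P] (A : Set (Fin n))
    (f : Z → ℂ) :
    ∫ z, ∏ i, A.mulIndicator (fun i => f (z i)) i ∂(Measure.pi fun _ => P) =
      (∫ x, f x ∂P) ^ A.ncard := by
  classical
  calc _ = ∫ z, ∏ i, (if i ∈ A then f else 1) (z i) ∂(Measure.pi fun _ => P) := by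
        simp only [Set.mulIndicator_apply, ite_apply, Pi.one_apply]
    _ = ∏ i, ∫ x, (if i ∈ A then f else 1) x ∂P :=
        integral_fintype_prod_eq_prod fun i : Fin n => if i ∈ A then f else 1
    _ = ∏ i, if i ∈ A then ∫ x, f x ∂P else 1 := by
        refine Finset.prod_congr rfl fun i _ => ?_
        split_ifs
        · rfl
        · simp only [Pi.one_apply, integral_const, probReal_univ, one_smul]
    _ = _ := by
        rw [Finset.prod_ite, Finset.prod_const, Finset.prod_const_one, mul_one,
          Set.filter_mem_univ_eq_toFinset, Set.ncard_eq_toFinset_card']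

variable [IsProbabilityMeasure P]

variable (P) in
theorem integral_cexp_inner_scoreSum (u : ℕ → Z → EuclideanSpace ℝ (Fin m)) (A : Set (Fin n))
    (h : EuclideanSpace ℝ (Fin m)) (c : ℂ) :
    ∫ z, Complex.exp (c * (⟪h, scoreSum u A z⟫ : ℝ)) ∂(Measure.pi fun _ => P) =
      (∫ z, Complex.exp (c * lin u h n z) ∂P) ^ A.ncard := by
  rw [← integral_pi_prod_mulIndicator]
  refine integral_congr_ae (ae_of_all _ fun z => ?_)
  dsimp only
  rw [inner_scoreSum, Complex.ofReal_sum, Finset.mul_sum, Complex.exp_sum]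
  refine Finset.prod_congr rfl fun i _ => ?_
  by_cases hi : i ∈ A
  · rw [Set.indicator_of_mem hi, Set.mulIndicator_of_mem hi]
  · rw [Set.indicator_of_notMem hi, Set.mulIndicator_of_notMem hi, Complex.ofReal_zero, mul_zero,
      Complex.exp_zero]

theorem IsScoreApprox.lintegral_expTilt_scoreSum (hu : IsScoreApprox P s u δ) (A : Set (Fin n))
    (h : EuclideanSpace ℝ (Fin m)) :
    ∫⁻ z, expTilt h (scoreSum u A z) ∂(Measure.pi fun _ => P) =
      ENNReal.ofReal (expMean P u h n ^ A.ncard) := by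
  have h_meas := hu.measurable_scoreSum A
  have h_int : Integrable (fun z => Real.exp ⟪h, scoreSum u A z⟫) (Measure.pi fun _ => P) := by
    refine Integrable.of_bound (by fun_prop) (Real.exp (∑ _ : Fin n, ‖h‖ * |δ n|))
      (ae_of_all _ fun z => ?_)
    rw [Real.norm_of_nonneg (Real.exp_nonneg _), inner_scoreSum]
    refine Real.exp_le_exp.2 (Finset.sum_le_sum fun i _ => ?_)
    exact Set.indicator_apply_le' (fun _ => (le_abs_self _).trans (hu.abs_lin_le h n _))
      fun _ => by positivity
  have h_cexp := integral_cexp_inner_scoreSum P u A h 1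
  simp only [one_mul, ← Complex.ofReal_exp, integral_complex_ofReal] at h_cexp
  unfold expTilt
  rw [← ofReal_integral_eq_lintegral_ofReal h_int (ae_of_all _ fun _ => Real.exp_nonneg _)]
  exact congrArg ENNReal.ofReal (mod_cast h_cexp)

section Tilt

variable {μ : Measure Z} {p : EuclideanSpace ℝ (Fin m) → Z → ℝ} {θ₀ : EuclideanSpace ℝ (Fin m)}

theorem expTilt_scoreSum_univ {h : EuclideanSpace ℝ (Fin m)}
    (hM : 0 < expMean (obsLaw μ p θ₀) u h n) (z : Fin n → Z) :
    expTilt h (scoreSum u Set.univ z) = ENNReal.ofReal (expMean (obsLaw μ p θ₀) u h n ^ n) *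
      ENNReal.ofReal (∏ i, tiltDensity μ p θ₀ u h n (z i)) := by
  rw [expTilt, inner_scoreSum, ← ENNReal.ofReal_mul (by positivity)]
  simp only [Set.indicator_univ, Real.exp_sum, tiltDensity, Finset.prod_div_distrib,
    Finset.prod_const, Finset.card_univ, Fintype.card_fin]
  rw [mul_div_cancel₀ _ (by positivity)]

theorem IsScoreApprox.lintegral_mul_expTilt_scoreSum [IsProbabilityMeasure (obsLaw μ p θ₀)]
    (hu : IsScoreApprox (obsLaw μ p θ₀) s u δ) {A : Set (Fin n)}
    (h : EuclideanSpace ℝ (Fin m)) {F : (Fin n → Z) → ℝ≥0∞} (hF : Measurable F)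
    (hFA : DependsOn F A) :
    ∫⁻ z, F z * expTilt h (scoreSum u A z) ∂(Measure.pi fun _ => obsLaw μ p θ₀) =
      ENNReal.ofReal (expMean (obsLaw μ p θ₀) u h n ^ A.ncard) *
        ∫⁻ z, F z * ENNReal.ofReal (∏ i, tiltDensity μ p θ₀ u h n (z i))
          ∂(Measure.pi fun _ => obsLaw μ p θ₀) := by
  have hM : 0 < expMean (obsLaw μ p θ₀) u h n := one_pos.trans_le (hu.one_le_expMean h n)
  have hA := hu.measurable_scoreSum A
  have hAc := hu.measurable_scoreSum Aᶜ
  have hq := (hu.isProbDensity_tiltDensity h n).measurable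
  have h_split : (∫⁻ z, F z * expTilt h (scoreSum u A z) ∂(Measure.pi fun _ => obsLaw μ p θ₀)) *
      ENNReal.ofReal (expMean (obsLaw μ p θ₀) u h n ^ Aᶜ.ncard) =
      ENNReal.ofReal (expMean (obsLaw μ p θ₀) u h n ^ n) *
        ∫⁻ z, F z * ENNReal.ofReal (∏ i, tiltDensity μ p θ₀ u h n (z i))
          ∂(Measure.pi fun _ => obsLaw μ p θ₀) := by
    rw [← hu.lintegral_expTilt_scoreSum, ← lintegral_pi_mul_of_dependsOn (A := A) (by fun_prop)
        (by fun_prop) (fun x y hxy => by rw [hFA hxy, dependsOn_scoreSum u A hxy])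
        (fun x y hxy => by rw [dependsOn_scoreSum u Aᶜ hxy]),
      ← lintegral_const_mul _ (by fun_prop)]
    refine lintegral_congr fun z => ?_
    rw [mul_assoc, ← expTilt_add, ← scoreSum_union u disjoint_compl_right, Set.union_compl_self,
      expTilt_scoreSum_univ hM, mul_left_comm]
  have h_pow : expMean (obsLaw μ p θ₀) u h n ^ n =
      expMean (obsLaw μ p θ₀) u h n ^ A.ncard * expMean (obsLaw μ p θ₀) u h n ^ Aᶜ.ncard := by
    rw [← pow_add, Set.ncard_add_ncard_compl, Nat.card_fin]
  rw [h_pow, ENNReal.ofReal_mul (by positivity), mul_right_comm] at h_split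
  exact (ENNReal.mul_left_inj (by simpa using by positivity) ENNReal.ofReal_ne_top).1 h_split

end Tilt

end ScoreSum

section FisherInformation

open scoped RealInnerProductSpace MatrixOrder
open Matrix

variable {Z : Type*} [MeasurableSpace Z] {m : ℕ} {μ : Measure Z}
  {p : EuclideanSpace ℝ (Fin m) → Z → ℝ} {θ₀ : EuclideanSpace ℝ (Fin m)}
  {s : Z → EuclideanSpace ℝ (Fin m)}

theorem integral_inner_sq_eq_fisherInfo (hs : MemLp s 2 (obsLaw μ p θ₀))
    (h : EuclideanSpace ℝ (Fin m)) :
    ∫ z, ⟪h, s z⟫ ^ 2 ∂(obsLaw μ p θ₀) = h ⬝ᵥ fisherInfo μ p θ₀ s *ᵥ h := by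
  have h_coord (i : Fin m) : MemLp (fun z => s z i) 2 (obsLaw μ p θ₀) :=
    hs.mono ((EuclideanSpace.proj (𝕜 := ℝ) i).continuous.comp_aestronglyMeasurable hs.1)
      (ae_of_all _ fun z => PiLp.norm_apply_le (s z) i)
  have h_int (i j : Fin m) : Integrable (fun z => s z i * s z j) (obsLaw μ p θ₀) :=
    (h_coord i).integrable_mul (h_coord j)
  have h_expand (z : Z) : ⟪h, s z⟫ ^ 2 = ∑ i, ∑ j, h i * h j * (s z i * s z j) := by
    simp only [PiLp.inner_apply, RCLike.inner_apply, conj_trivial, sq, Finset.sum_mul_sum]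
    exact Finset.sum_congr rfl fun i _ => Finset.sum_congr rfl fun j _ => by ring
  simp_rw [h_expand]
  rw [integral_finsetSum _ fun i _ => integrable_finsetSum _ fun j _ => (h_int i j).const_mul _]
  simp only [dotProduct, mulVec, Finset.mul_sum]
  refine Finset.sum_congr rfl fun i _ => ?_
  rw [integral_finsetSum _ fun j _ => (h_int i j).const_mul _]
  refine Finset.sum_congr rfl fun j _ => ?_
  rw [integral_const_mul, fisherInfo, Matrix.of_apply]
  ring

theorem posSemidef_fisherInfo (hs : MemLp s 2 (obsLaw μ p θ₀)) :
    (fisherInfo μ p θ₀ s).PosSemidef := by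
  have h_symm : (fisherInfo μ p θ₀ s).IsHermitian := by
    ext i j
    simp only [fisherInfo, conjTranspose_apply, of_apply, star_trivial, mul_comm]
  refine .of_dotProduct_mulVec_nonneg h_symm fun x => ?_
  rw [star_trivial, ← integral_inner_sq_eq_fisherInfo hs (WithLp.toLp 2 x)]
  exact integral_nonneg fun _ => sq_nonneg _

theorem posDef_fisherInfo (hs : MemLp s 2 (obsLaw μ p θ₀))
    (hJ : IsUnit (fisherInfo μ p θ₀ s).det) : (fisherInfo μ p θ₀ s).PosDef :=
  (posSemidef_fisherInfo hs).posDef_iff_isUnit.2 ((Matrix.isUnit_iff_isUnit_det _).2 hJ)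

end FisherInformation

section ScoreSumLimit

open scoped ENNReal RealInnerProductSpace
open Matrix IsScoreApprox

variable {Z : Type*} [MeasurableSpace Z] {m : ℕ} {P : Measure Z} [IsProbabilityMeasure P]
  {s : Z → EuclideanSpace ℝ (Fin m)} {u : ℕ → Z → EuclideanSpace ℝ (Fin m)} {δ : ℕ → ℝ}

/-- The law of an i.i.d. sample from `P`, indexed by `ι`. -/
abbrev iidLaw (ι : Type*) [Fintype ι] (P : Measure Z) [IsProbabilityMeasure P] :
    ProbabilityMeasure (ι → Z) :=
  ⟨Measure.pi fun _ => P, inferInstance⟩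

namespace IsScoreApprox

/-- The law of `scoreSum u A z` for an i.i.d. sample `z` from `P`. -/
def scoreSumLaw (hu : IsScoreApprox P s u δ) {n : ℕ} (A : Set (Fin n)) :
    ProbabilityMeasure (EuclideanSpace ℝ (Fin m)) :=
  (iidLaw (Fin n) P).map (hu.measurable_scoreSum A).aemeasurable

theorem toMeasure_scoreSumLaw (hu : IsScoreApprox P s u δ) {n : ℕ} (A : Set (Fin n)) :
    (hu.scoreSumLaw A : Measure (EuclideanSpace ℝ (Fin m))) =
      (Measure.pi fun _ : Fin n => P).map (scoreSum u A) := rfl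

theorem charFun_scoreSumLaw (hu : IsScoreApprox P s u δ) {n : ℕ} (A : Set (Fin n))
    (t : EuclideanSpace ℝ (Fin m)) :
    charFun (hu.scoreSumLaw A : Measure (EuclideanSpace ℝ (Fin m))) t =
      (∫ z, Complex.exp (Complex.I * lin u t n z) ∂P) ^ A.ncard := by
  rw [charFun_apply, toMeasure_scoreSumLaw, integral_map (hu.measurable_scoreSum _).aemeasurable
    (by fun_prop), ← integral_cexp_inner_scoreSum]
  simp_rw [real_inner_comm, mul_comm]

theorem lintegral_expTilt_scoreSumLaw (hu : IsScoreApprox P s u δ) {n : ℕ} (A : Set (Fin n))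
    (h : EuclideanSpace ℝ (Fin m)) :
    ∫⁻ d, expTilt h d ∂(hu.scoreSumLaw A) = ENNReal.ofReal (expMean P u h n ^ A.ncard) := by
  rw [toMeasure_scoreSumLaw, lintegral_map (by fun_prop) (hu.measurable_scoreSum _),
    hu.lintegral_expTilt_scoreSum]

theorem tiltConvergence (hu : IsScoreApprox P s u δ) {S : Matrix (Fin m) (Fin m) ℝ}
    (hS : S.PosSemidef) {lam : ℝ} (hlam : ∀ h, lam * ∫ z, ⟪h, s z⟫ ^ 2 ∂P = h ⬝ᵥ S *ᵥ h)
    {A : ∀ n : ℕ, Set (Fin n)}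
    (hA : Tendsto (fun n : ℕ => ((A n).ncard : ℝ) / n) atTop (𝓝 lam)) :
    TiltConvergence (fun n => hu.scoreSumLaw (A n)) ⟨multivariateGaussian 0 S, inferInstance⟩ where
  tendsto := by
    refine ProbabilityMeasure.tendsto_of_tendsto_charFun fun t => ?_
    simp_rw [charFun_scoreSumLaw]
    rw [ProbabilityMeasure.coe_mk, charFun_multivariateGaussian hS, ← hlam]
    convert hu.tendsto_pow_cexp t Complex.I hA using 3
    rw [Complex.I_sq, inner_zero_right]
    push_cast
    ring
  bound h := by
    have h_lim := hu.tendsto_pow_exp h hA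
    rw [hlam] at h_lim
    refine ⟨ENNReal.ofReal (Real.exp ((h ⬝ᵥ S *ᵥ h) / 2) + 1), ENNReal.ofReal_ne_top, ?_⟩
    filter_upwards [h_lim.eventually_le_const (lt_add_one _)] with n hn
    rw [lintegral_expTilt_scoreSumLaw]
    exact ENNReal.ofReal_le_ofReal hn

end IsScoreApprox

end ScoreSumLimit

section ConditionalLaws

open scoped ENNReal NNReal

variable {Z ι K S : Type*} [MeasurableSpace Z] [MeasurableSpace K] [MeasurableSpace S]
  {A : Set ι} {D : (ι → Z) → K} {T : (ι → Z) → S}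

theorem measurable_prodMk_resample (A : Set ι) (hD : Measurable D) (hT : Measurable T)
    (z : ι → Z) : Measurable fun w => (D w, T (resample A w z)) :=
  hD.prodMk (hT.comp (measurable_resample_left A z))

variable [Fintype ι]

section LawGivenCompl

variable (P : Measure Z) [IsProbabilityMeasure P]

/-- For `D` depending only on the coordinates in `A`, the conditional law of `(D, T)` given the
coordinates of the sample outside `A`. -/
def lawGivenCompl (A : Set ι) (hD : Measurable D) (hT : Measurable T) (z : ι → Z) :
    ProbabilityMeasure (K × S) :=
  (iidLaw ι P).map (measurable_prodMk_resample A hD hT z).aemeasurable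

variable {P}

theorem map_fst_lawGivenCompl (hD : Measurable D) (hT : Measurable T) (z : ι → Z) :
    (lawGivenCompl P A hD hT z).map measurable_fst.aemeasurable =
      (iidLaw ι P).map hD.aemeasurable :=
  Subtype.ext (Measure.map_map measurable_fst (measurable_prodMk_resample A hD hT z))

theorem lintegral_lawGivenCompl (hD : Measurable D) (hT : Measurable T) (hDA : DependsOn D A)
    {F : K × S → ℝ≥0∞} (hF : Measurable F) (z : ι → Z) :
    ∫⁻ y, F y ∂(lawGivenCompl P A hD hT z : Measure (K × S)) =
      ∫⁻ w, F (D (resample A w z), T (resample A w z)) ∂(Measure.pi fun _ => P) := by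
  simp_rw [resample_of_dependsOn hDA subset_rfl]
  exact lintegral_map hF (measurable_prodMk_resample A hD hT z)

theorem measurable_lawGivenCompl (hD : Measurable D) (hT : Measurable T) :
    Measurable (lawGivenCompl P A hD hT) := by
  refine Measurable.subtype_mk (Measure.measurable_of_measurable_coe _ fun B hB => ?_)
  have h_meas : Measurable fun x : (ι → Z) × (ι → Z) => (D x.1, T (resample A x.1 x.2)) :=
    (hD.comp measurable_fst).prodMk (hT.comp (measurable_resample A))
  have h_apply (z : ι → Z) :
      (lawGivenCompl P A hD hT z : Measure (K × S)) B =
        (Measure.pi fun _ => P) {w | (D w, T (resample A w z)) ∈ B} :=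
    Measure.map_apply (measurable_prodMk_resample A hD hT z) hB
  change Measurable fun z => (lawGivenCompl P A hD hT z : Measure (K × S)) B
  simp_rw [h_apply]
  exact measurable_measure_prodMk_right (h_meas hB)

end LawGivenCompl

theorem measurableSet_setOf_map_fst_eq [TopologicalSpace K] [CompactSpace K]
    [TopologicalSpace.MetrizableSpace K] [BorelSpace K] (c : ProbabilityMeasure K) :
    MeasurableSet {κ : ProbabilityMeasure (K × S) | κ.map measurable_fst.aemeasurable = c} :=
  Measurable.subtype_mk ((Measure.measurable_map _ measurable_fst).comp measurable_subtype_coe)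
    (isClosed_singleton (x := c)).measurableSet

/-- The formula for the tilted mean holds because `(D₁, T₁)` and `(D₂, T₂)` are conditionally
independent given the observations in `A₀`, the only ones they share. -/
theorem exists_hasMarginals_tiltedMean_eq [TopologicalSpace K] [CompactSpace K]
    [TopologicalSpace.MetrizableSpace K] [BorelSpace K] (P : Measure Z) [IsProbabilityMeasure P]
    {A₁ A₂ A₀ : Set ι} (h₁₂ : Disjoint A₁ A₂) (h₁₀ : Disjoint A₁ A₀) (h₂₀ : Disjoint A₂ A₀)
    {D₁ D₂ D₀ : (ι → Z) → K} (hD₁ : Measurable D₁) (hD₂ : Measurable D₂) (hD₀ : Measurable D₀)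
    (hD₁A : DependsOn D₁ A₁) (hD₂A : DependsOn D₂ A₂) (hD₀A : DependsOn D₀ A₀)
    {T₁ T₂ : (ι → Z) → S} (hT₁ : Measurable T₁) (hT₂ : Measurable T₂)
    (hT₁A : DependsOn T₁ (A₁ ∪ A₀)) (hT₂A : DependsOn T₂ (A₂ ∪ A₀)) :
    ∃ G : ProbabilityMeasure (LawSpace K S),
      HasMarginals G ((iidLaw ι P).map hD₁.aemeasurable) ((iidLaw ι P).map hD₂.aemeasurable)
        ((iidLaw ι P).map hD₀.aemeasurable) ∧
      ∀ (w : K → ℝ≥0∞) (f₁ f₂ : S → ℝ≥0), Measurable w → Measurable f₁ → Measurable f₂ →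
        tiltedMean G w f₁ f₂ = ∫⁻ z, f₁ (T₁ z) * f₂ (T₂ z) * (w (D₁ z) * w (D₂ z) * w (D₀ z))
          ∂(Measure.pi fun _ => P) := by
  have h_law : Measurable fun z => ((lawGivenCompl P A₁ hD₁ hT₁ z, lawGivenCompl P A₂ hD₂ hT₂ z,
      D₀ z) : LawSpace K S) :=
    (measurable_lawGivenCompl hD₁ hT₁).prodMk ((measurable_lawGivenCompl hD₂ hT₂).prodMk hD₀)
  refine ⟨(iidLaw ι P).map h_law.aemeasurable, ⟨?_, ?_, ?_⟩, fun w f₁ f₂ hw hf₁ hf₂ => ?_⟩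
  · refine (ae_map_iff h_law.aemeasurable ?_).2 (ae_of_all _ (map_fst_lawGivenCompl hD₁ hT₁))
    exact measurable_fst (measurableSet_setOf_map_fst_eq _)
  · refine (ae_map_iff h_law.aemeasurable ?_).2 (ae_of_all _ (map_fst_lawGivenCompl hD₂ hT₂))
    exact measurable_fst.comp measurable_snd (measurableSet_setOf_map_fst_eq _)
  · exact Subtype.ext (Measure.map_map (by fun_prop) h_law)
  · have h_dep {A : Set ι} {D : (ι → Z) → K} {T : (ι → Z) → S} (hD : DependsOn D A)
        (hT : DependsOn T (A ∪ A₀)) (f : S → ℝ≥0) :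
        DependsOn (fun z => f (T z) * w (D z)) (A ∪ A₀) := fun x y hxy => by
      simp only [hT hxy, hD fun i hi => hxy i (Or.inl hi)]
    refine (lintegral_map (measurable_lintegral_lawSpace (F₁ := fun y => f₁ y.2 * w y.1)
      (F₂ := fun y => f₂ y.2 * w y.1) (by fun_prop) (by fun_prop) hw) h_law).trans ?_
    simp_rw [lintegral_lawGivenCompl hD₁ hT₁ hD₁A (F := fun y => f₁ y.2 * w y.1) (by fun_prop),
      lintegral_lawGivenCompl hD₂ hT₂ hD₂A (F := fun y => f₂ y.2 * w y.1) (by fun_prop)]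
    refine (lintegral_pi_mul_mul_eq_lintegral_resample h₁₂ h₁₀ h₂₀ (by fun_prop) (by fun_prop)
      (hw.comp hD₀) (h_dep hD₁A hT₁A f₁) (h_dep hD₂A hT₂A f₂)
      fun x y hxy => by simp only [Function.comp_apply, hD₀A hxy]).symm.trans
      (lintegral_congr fun z => ?_)
    simp only [Function.comp_apply]
    ring

end ConditionalLaws

section TiltedPairs

open scoped ENNReal NNReal BoundedContinuousFunction

variable {Z : Type*} [MeasurableSpace Z] {m : ℕ} {μ : Measure Z}
  {Θ : Set (EuclideanSpace ℝ (Fin m))} {p : EuclideanSpace ℝ (Fin m) → Z → ℝ}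
  {θ₀ : EuclideanSpace ℝ (Fin m)} {s : Z → EuclideanSpace ℝ (Fin m)}
  {u : ℕ → Z → EuclideanSpace ℝ (Fin m)} {δ : ℕ → ℝ}
  {S₁ S₂ : ∀ n : ℕ, (Fin n → Z) → ℝ} {L : Measure (ℝ × ℝ)} [IsFiniteMeasure L]

theorem lintegral_comp_eq_ofReal_integral {X Y : Type*} [MeasurableSpace X] [TopologicalSpace Y]
    [MeasurableSpace Y] [OpensMeasurableSpace Y] {ρ : Measure X} [IsFiniteMeasure ρ]
    (f : Y →ᵇ ℝ≥0) {T : X → Y} (hT : Measurable T) :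
    ∫⁻ x, f (T x) ∂ρ = ENNReal.ofReal (∫ x, (f (T x) : ℝ) ∂ρ) := by
  refine lintegral_coe_eq_integral _ (Integrable.of_bound
    (f.continuous.measurable.comp hT).coe_nnreal_real.aestronglyMeasurable (nndist f 0)
    (ae_of_all _ fun x => ?_))
  rw [Real.norm_of_nonneg (NNReal.coe_nonneg _), NNReal.coe_le_coe]
  exact BoundedContinuousFunction.NNReal.upper_bound f _

theorem PairConvergesInLaw.tendsto_lintegral {ν : ∀ n : ℕ, Measure (Fin n → Z)}
    (hν : ∀ᶠ n in atTop, IsFiniteMeasure (ν n)) (hS₁ : ∀ n, Measurable (S₁ n))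
    (hS₂ : ∀ n, Measurable (S₂ n)) (hconv : PairConvergesInLaw ν S₁ S₂ L) (f : ℝ × ℝ →ᵇ ℝ≥0) :
    Tendsto (fun n => ∫⁻ z, f (S₁ n z, S₂ n z) ∂(ν n)) atTop (𝓝 (∫⁻ y, f y ∂L)) := by
  let g : ℝ × ℝ →ᵇ ℝ := BoundedContinuousFunction.comp _ NNReal.isometry_coe.lipschitz f
  rw [lintegral_comp_eq_ofReal_integral f (T := fun y => y) measurable_id]
  refine ((ENNReal.continuous_ofReal.tendsto _).comp (hconv g)).congr' ?_
  filter_upwards [hν] with n hn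
  exact (lintegral_comp_eq_ofReal_integral f ((hS₁ n).prodMk (hS₂ n))).symm

theorem IsDQM.tendsto_lintegral_mul_expTilt_scoreSum (hp : IsDensityFamily μ Θ p)
    (hθ₀ : θ₀ ∈ interior Θ) (hs : IsDQM μ p θ₀ s) (hu : IsScoreApprox (obsLaw μ p θ₀) s u δ)
    (h : EuclideanSpace ℝ (Fin m)) {A : ∀ n : ℕ, Set (Fin n)} {lam : ℝ}
    (hA : Tendsto (fun n : ℕ => ((A n).ncard : ℝ) / n) atTop (𝓝 lam))
    {F : ∀ n : ℕ, (Fin n → Z) → ℝ≥0∞} (hF : ∀ n, Measurable (F n))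
    (hFA : ∀ n, DependsOn (F n) (A n)) {C : ℝ≥0} (hFC : ∀ n z, F n z ≤ C) {l : ℝ≥0∞} (hl₀ : l ≠ ∞)
    (hl : Tendsto (fun n => ∫⁻ z, F n z ∂(sampleLaw μ p n (localParam θ₀ h n))) atTop (𝓝 l)) :
    Tendsto (fun n => ∫⁻ z, F n z * expTilt h (scoreSum u (A n) z)
        ∂(Measure.pi fun _ => obsLaw μ p θ₀)) atTop
      (𝓝 (ENNReal.ofReal (Real.exp (lam * (∫ z, inner ℝ h (s z) ^ 2 ∂(obsLaw μ p θ₀)) / 2)) *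
        l)) := by
  have := hp.isProbabilityMeasure_obsLaw (interior_subset hθ₀)
  have h_const := ENNReal.tendsto_ofReal (hu.tendsto_pow_exp h hA)
  have h_lim := hs.tendsto_lintegral_tiltDensity hp hθ₀ hu h hF hFC hl₀ hl
  refine (ENNReal.Tendsto.mul h_const (Or.inr hl₀) h_lim (Or.inr ENNReal.ofReal_ne_top)).congr
    fun n => ?_
  exact (hu.lintegral_mul_expTilt_scoreSum h (hF n) (hFA n)).symm

theorem PairConvergesInLaw.tendsto_lintegral_mul_expTilt_scoreSum (hp : IsDensityFamily μ Θ p)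
    (hθ₀ : θ₀ ∈ interior Θ) (hs : IsDQM μ p θ₀ s) (hu : IsScoreApprox (obsLaw μ p θ₀) s u δ)
    (h : EuclideanSpace ℝ (Fin m)) {A : ∀ n : ℕ, Set (Fin n)} {lam : ℝ}
    (hA : Tendsto (fun n : ℕ => ((A n).ncard : ℝ) / n) atTop (𝓝 lam))
    (hS₁ : ∀ n, Measurable (S₁ n)) (hS₂ : ∀ n, Measurable (S₂ n))
    (hS₁A : ∀ n, DependsOn (S₁ n) (A n)) (hS₂A : ∀ n, DependsOn (S₂ n) (A n))
    (hconv : PairConvergesInLaw (fun n => sampleLaw μ p n (localParam θ₀ h n)) S₁ S₂ L)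
    (f : ℝ × ℝ →ᵇ ℝ≥0) :
    Tendsto (fun n => ∫⁻ z, f (S₁ n z, S₂ n z) * expTilt h (scoreSum u (A n) z)
        ∂(Measure.pi fun _ => obsLaw μ p θ₀)) atTop
      (𝓝 (ENNReal.ofReal (Real.exp (lam * (∫ z, inner ℝ h (s z) ^ 2 ∂(obsLaw μ p θ₀)) / 2)) *
        ∫⁻ y, f y ∂L)) := by
  have h_prob : ∀ᶠ n in atTop, IsFiniteMeasure (sampleLaw μ p n (localParam θ₀ h n)) := by
    filter_upwards [hs.eventually_hellingerSq_le hp hθ₀ hu h one_pos] with n hn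
    have := hp.isProbabilityMeasure_obsLaw hn.1
    unfold sampleLaw
    infer_instance
  exact hs.tendsto_lintegral_mul_expTilt_scoreSum hp hθ₀ hu h hA (fun n => by fun_prop)
    (fun n x y hxy => by simp only [hS₁A n hxy, hS₂A n hxy])
    (fun n z => ENNReal.coe_le_coe.2 (BoundedContinuousFunction.NNReal.upper_bound f _))
    (f.lintegral_lt_top_of_nnreal L).ne (hconv.tendsto_lintegral h_prob hS₁ hS₂ f)

/-- The test function `(x, y) ↦ f₁ x * f₂ y` on `ℝ × ℝ`, for `f₁` and `f₂` continuous on the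
extended reals. -/
def prodTest (f₁ f₂ : C(EReal, ℝ≥0)) : ℝ × ℝ →ᵇ ℝ≥0 :=
  (BoundedContinuousFunction.mkOfCompact
    ⟨fun y : EReal × EReal => f₁ y.1 * f₂ y.2, by fun_prop⟩).compContinuous
    ⟨Prod.map (↑) (↑), continuous_coe_real_ereal.prodMap continuous_coe_real_ereal⟩

theorem coe_prodTest (f₁ f₂ : C(EReal, ℝ≥0)) (y : ℝ × ℝ) :
    (prodTest f₁ f₂ y : ℝ≥0∞) = f₁ (y.1 : EReal) * f₂ (y.2 : EReal) :=
  ENNReal.coe_mul _ _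

end TiltedPairs

section GaussianLimit

open scoped ENNReal NNReal unitInterval
open Matrix

section Prod

variable {X₁ X₂ X₃ X₄ : Type*} [MeasurableSpace X₁] [MeasurableSpace X₂] [MeasurableSpace X₃]
  [MeasurableSpace X₄] {μ₁ : Measure X₁} {μ₂ : Measure X₂} {μ₃ : Measure X₃} {μ₄ : Measure X₄}
  [SFinite μ₂] [SFinite μ₃] [SFinite μ₄]

theorem prod_prod_prod_withDensity {f₁ : X₁ → ℝ≥0∞} {f₂ : X₂ → ℝ≥0∞} {f₃ : X₃ → ℝ≥0∞}
    (hf₁ : Measurable f₁) (hf₂ : Measurable f₂) (hf₃ : Measurable f₃) :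
    (μ₁.withDensity f₁).prod ((μ₂.withDensity f₂).prod ((μ₃.withDensity f₃).prod μ₄)) =
      (μ₁.prod (μ₂.prod (μ₃.prod μ₄))).withDensity
        fun x => f₁ x.1 * f₂ x.2.1 * f₃ x.2.2.1 := by
  rw [prod_withDensity_left hf₃, prod_withDensity hf₂ (by fun_prop),
    prod_withDensity hf₁ (by fun_prop)]
  simp only [mul_assoc]

theorem map_prod_map_prod_map_prod_map [SFinite μ₁] {Y₁ Y₂ Y₃ Y₄ : Type*} [MeasurableSpace Y₁]
    [MeasurableSpace Y₂] [MeasurableSpace Y₃] [MeasurableSpace Y₄]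
    {g₁ : X₁ → Y₁} {g₂ : X₂ → Y₂} {g₃ : X₃ → Y₃} {g₄ : X₄ → Y₄} (hg₁ : Measurable g₁)
    (hg₂ : Measurable g₂) (hg₃ : Measurable g₃) (hg₄ : Measurable g₄) :
    (μ₁.map g₁).prod ((μ₂.map g₂).prod ((μ₃.map g₃).prod (μ₄.map g₄))) =
      (μ₁.prod (μ₂.prod (μ₃.prod μ₄))).map (Prod.map g₁ (Prod.map g₂ (Prod.map g₃ g₄))) := by
  rw [Measure.map_prod_map _ _ hg₃ hg₄, Measure.map_prod_map _ _ hg₂ (by fun_prop),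
    Measure.map_prod_map _ _ hg₁ (by fun_prop)]

end Prod

theorem withDensity_expTilt_multivariateGaussian {ι : Type*} [Fintype ι] [DecidableEq ι]
    {S : Matrix ι ι ℝ} (hS : S.PosDef) (h : EuclideanSpace ℝ ι) :
    (multivariateGaussian 0 S).withDensity (expTilt h) =
      ENNReal.ofReal (Real.exp ((h ⬝ᵥ S *ᵥ h) / 2)) •
        (multivariateGaussian h S⁻¹).map (toEuclideanCLM (𝕜 := ℝ) S) := by
  refine Measure.ext_of_lintegral _ fun F hF => ?_
  rw [lintegral_smul_measure, lintegral_map hF (by fun_prop), smul_eq_mul,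
    lintegral_multivariateGaussian_inv hS h hF,
    lintegral_withDensity_eq_lintegral_mul _ (measurable_expTilt h) hF]
  simp only [Pi.mul_apply, mul_comm]

variable {m : ℕ} {J : Matrix (Fin m) (Fin m) ℝ} {lam₁ lam₂ lam₁₂ : ℝ}

/-- `limitExperiment`, with the uniform randomisation taking values in the type `I`. -/
def shiftExperiment (J : Matrix (Fin m) (Fin m) ℝ) (lam₁ lam₂ lam₁₂ : ℝ)
    (h : EuclideanSpace ℝ (Fin m)) : Measure (EuclideanSpace ℝ (Fin m) ×
      EuclideanSpace ℝ (Fin m) × EuclideanSpace ℝ (Fin m) × I) :=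
  (multivariateGaussian h (lam₁ • J)⁻¹).prod ((multivariateGaussian h (lam₂ • J)⁻¹).prod
    ((multivariateGaussian h (lam₁₂ • J)⁻¹).prod volume))

theorem limitExperiment_eq_map (J : Matrix (Fin m) (Fin m) ℝ) (lam₁ lam₂ lam₁₂ : ℝ)
    (h : EuclideanSpace ℝ (Fin m)) :
    limitExperiment J lam₁ lam₂ lam₁₂ h = (shiftExperiment J lam₁ lam₂ lam₁₂ h).map
      (Prod.map id (Prod.map id (Prod.map id (↑)))) := by
  rw [shiftExperiment, ← map_prod_map_prod_map_prod_map measurable_id measurable_id measurable_id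
    measurable_subtype_coe, unitInterval.measurePreserving_coe.map_eq, Measure.map_id,
    Measure.map_id, Measure.map_id, limitExperiment]

/-- The linear maps `lam₁ J`, `lam₂ J` and `lam₁₂ J`, applied to the three Gaussian observations of
the limit experiment. -/
def scaleObs (J : Matrix (Fin m) (Fin m) ℝ) (lam₁ lam₂ lam₁₂ : ℝ) :
    EuclideanSpace ℝ (Fin m) × EuclideanSpace ℝ (Fin m) × EuclideanSpace ℝ (Fin m) × I →
      EuclideanSpace ℝ (Fin m) × EuclideanSpace ℝ (Fin m) × EuclideanSpace ℝ (Fin m) × I :=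
  Prod.map (toEuclideanCLM (𝕜 := ℝ) (lam₁ • J)) (Prod.map (toEuclideanCLM (𝕜 := ℝ) (lam₂ • J))
    (Prod.map (toEuclideanCLM (𝕜 := ℝ) (lam₁₂ • J)) id))

theorem measurable_scaleObs (J : Matrix (Fin m) (Fin m) ℝ) (lam₁ lam₂ lam₁₂ : ℝ) :
    Measurable (scaleObs J lam₁ lam₂ lam₁₂) := by
  unfold scaleObs
  fun_prop

theorem withDensity_expTilt_prod_multivariateGaussian (hJ : J.PosDef) (hlam₁ : 0 < lam₁)
    (hlam₂ : 0 < lam₂) (hlam₁₂ : 0 < lam₁₂) (h : EuclideanSpace ℝ (Fin m)) :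
    ((multivariateGaussian 0 (lam₁ • J)).prod ((multivariateGaussian 0 (lam₂ • J)).prod
      ((multivariateGaussian 0 (lam₁₂ • J)).prod (volume : Measure I)))).withDensity
        (fun ω => expTilt h ω.1 * expTilt h ω.2.1 * expTilt h ω.2.2.1) =
      ENNReal.ofReal (Real.exp ((lam₁ + lam₂ + lam₁₂) * (h ⬝ᵥ J *ᵥ h) / 2)) •
        (shiftExperiment J lam₁ lam₂ lam₁₂ h).map (scaleObs J lam₁ lam₂ lam₁₂) := by
  have h_const : ENNReal.ofReal (Real.exp ((lam₁ + lam₂ + lam₁₂) * (h ⬝ᵥ J *ᵥ h) / 2)) =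
      ENNReal.ofReal (Real.exp ((h ⬝ᵥ (lam₁ • J) *ᵥ h) / 2)) *
        (ENNReal.ofReal (Real.exp ((h ⬝ᵥ (lam₂ • J) *ᵥ h) / 2)) *
          ENNReal.ofReal (Real.exp ((h ⬝ᵥ (lam₁₂ • J) *ᵥ h) / 2))) := by
    simp only [Matrix.smul_mulVec, dotProduct_smul, smul_eq_mul]
    rw [← ENNReal.ofReal_mul (by positivity), ← ENNReal.ofReal_mul (by positivity),
      ← Real.exp_add, ← Real.exp_add]
    congr 2
    ring
  have h_map := map_prod_map_prod_map_prod_map (μ₁ := multivariateGaussian h (lam₁ • J)⁻¹)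
    (μ₂ := multivariateGaussian h (lam₂ • J)⁻¹) (μ₃ := multivariateGaussian h (lam₁₂ • J)⁻¹)
    (μ₄ := (volume : Measure I)) (toEuclideanCLM (𝕜 := ℝ) (lam₁ • J)).measurable
    (toEuclideanCLM (𝕜 := ℝ) (lam₂ • J)).measurable
    (toEuclideanCLM (𝕜 := ℝ) (lam₁₂ • J)).measurable measurable_id
  rw [Measure.map_id] at h_map
  rw [← prod_prod_prod_withDensity (measurable_expTilt h) (measurable_expTilt h)
      (measurable_expTilt h), withDensity_expTilt_multivariateGaussian (hJ.smul hlam₁),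
    withDensity_expTilt_multivariateGaussian (hJ.smul hlam₂),
    withDensity_expTilt_multivariateGaussian (hJ.smul hlam₁₂)]
  simp only [Measure.prod_smul_left, Measure.prod_smul_right, smul_smul, h_map]
  congr 1
  rw [h_const]
  ring

theorem lintegral_mul_expTilt_prod_multivariateGaussian (hJ : J.PosDef) (hlam₁ : 0 < lam₁)
    (hlam₂ : 0 < lam₂) (hlam₁₂ : 0 < lam₁₂) (h : EuclideanSpace ℝ (Fin m))
    {F : EuclideanSpace ℝ (Fin m) × EuclideanSpace ℝ (Fin m) × EuclideanSpace ℝ (Fin m) × I → ℝ≥0∞}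
    (hF : Measurable F) :
    ∫⁻ ω, F ω * (expTilt h ω.1 * expTilt h ω.2.1 * expTilt h ω.2.2.1)
      ∂((multivariateGaussian 0 (lam₁ • J)).prod ((multivariateGaussian 0 (lam₂ • J)).prod
        ((multivariateGaussian 0 (lam₁₂ • J)).prod (volume : Measure I)))) =
      ENNReal.ofReal (Real.exp ((lam₁ + lam₂ + lam₁₂) * (h ⬝ᵥ J *ᵥ h) / 2)) *
        ∫⁻ ω, F (scaleObs J lam₁ lam₂ lam₁₂ ω) ∂(shiftExperiment J lam₁ lam₂ lam₁₂ h) := by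
  have h_weight : Measurable fun ω : EuclideanSpace ℝ (Fin m) × EuclideanSpace ℝ (Fin m) ×
      EuclideanSpace ℝ (Fin m) × I => expTilt h ω.1 * expTilt h ω.2.1 * expTilt h ω.2.2.1 := by
    have := measurable_expTilt h
    fun_prop
  rw [← lintegral_map hF (measurable_scaleObs J lam₁ lam₂ lam₁₂), ← smul_eq_mul,
    ← lintegral_smul_measure,
    ← withDensity_expTilt_prod_multivariateGaussian hJ hlam₁ hlam₂ hlam₁₂ h,
    lintegral_withDensity_eq_lintegral_mul _ h_weight hF]
  exact lintegral_congr fun ω => mul_comm _ _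

end GaussianLimit

section LimitStatistics

open scoped ENNReal NNReal unitInterval
open Matrix

theorem ext_of_lintegral_mul_continuousMap {X Y : Type*} [TopologicalSpace X] [CompactSpace X]
    [MeasurableSpace X] [BorelSpace X] [TopologicalSpace.MetrizableSpace X] [TopologicalSpace Y]
    [CompactSpace Y] [MeasurableSpace Y] [BorelSpace Y] [TopologicalSpace.MetrizableSpace Y]
    {ρ ρ' : Measure (X × Y)} [IsFiniteMeasure ρ] (h : ∀ (f : C(X, ℝ≥0)) (g : C(Y, ℝ≥0)),
      ∫⁻ y, (f y.1 : ℝ≥0∞) * g y.2 ∂ρ = ∫⁻ y, (f y.1 : ℝ≥0∞) * g y.2 ∂ρ') : ρ = ρ' := by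
  -- The library lemma is stated for families of factors, hence the detour through `Unit → X`.
  let e : (X × Y) ≃ᵐ ((Unit → X) × (Unit → Y)) :=
    .symm <| .prodCongr (.funUnique ..) (.funUnique ..)
  rw [← e.map_measurableEquiv_injective.eq_iff]
  have : IsFiniteMeasure (ρ.map e) := inferInstance
  refine Measure.ext_of_lintegral_prod_mul_prod_boundedContinuousFunction fun f g => ?_
  rw [lintegral_map_equiv, lintegral_map_equiv]
  simpa [e] using! h (f ()).toContinuousMap (g ()).toContinuousMap

variable {m : ℕ} {J : Matrix (Fin m) (Fin m) ℝ} {lam₁ lam₂ lam₁₂ : ℝ}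

instance isProbabilityMeasure_shiftExperiment (h : EuclideanSpace ℝ (Fin m)) :
    IsProbabilityMeasure (shiftExperiment J lam₁ lam₂ lam₁₂ h) := by
  unfold shiftExperiment
  infer_instance

theorem map_scaleObs_shiftExperiment_eq (hJ : J.PosDef) (hlam₁ : 0 < lam₁) (hlam₂ : 0 < lam₂)
    (hlam₁₂ : 0 < lam₁₂) {h : EuclideanSpace ℝ (Fin m)} {L : Measure (ℝ × ℝ)}
    {V : EuclideanSpace ℝ (Fin m) × EuclideanSpace ℝ (Fin m) × EuclideanSpace ℝ (Fin m) × I →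
      EReal × EReal} (hV : Measurable V)
    (h_tilt : ∀ f₁ f₂ : C(EReal, ℝ≥0),
      ∫⁻ ω, (f₁ (V ω).1 : ℝ≥0∞) * f₂ (V ω).2 *
          (expTilt h ω.1 * expTilt h ω.2.1 * expTilt h ω.2.2.1)
        ∂((multivariateGaussian 0 (lam₁ • J)).prod ((multivariateGaussian 0 (lam₂ • J)).prod
          ((multivariateGaussian 0 (lam₁₂ • J)).prod (volume : Measure I)))) =
        ENNReal.ofReal (Real.exp ((lam₁ + lam₂ + lam₁₂) * (h ⬝ᵥ J *ᵥ h) / 2)) *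
          ∫⁻ y, (f₁ (y.1 : EReal) : ℝ≥0∞) * f₂ (y.2 : EReal) ∂L) :
    (shiftExperiment J lam₁ lam₂ lam₁₂ h).map (V ∘ scaleObs J lam₁ lam₂ lam₁₂) =
      L.map (Prod.map (↑) (↑)) := by
  have hVA := hV.comp (measurable_scaleObs J lam₁ lam₂ lam₁₂)
  have := Measure.isProbabilityMeasure_map (μ := shiftExperiment J lam₁ lam₂ lam₁₂ h)
    hVA.aemeasurable
  refine ext_of_lintegral_mul_continuousMap fun f₁ f₂ => ?_
  have hf : Measurable fun y : EReal × EReal => (f₁ y.1 : ℝ≥0∞) * f₂ y.2 := by fun_prop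
  have h_scaled := (lintegral_mul_expTilt_prod_multivariateGaussian hJ hlam₁ hlam₂ hlam₁₂ h
    (hf.comp hV)).symm.trans (h_tilt f₁ f₂)
  rw [ENNReal.mul_right_inj (ENNReal.ofReal_pos.2 (Real.exp_pos _)).ne' ENNReal.ofReal_ne_top]
    at h_scaled
  rw [lintegral_map hf hVA, lintegral_map hf
    (measurable_coe_real_ereal.prodMap measurable_coe_real_ereal)]
  exact h_scaled

/-- The real-valued statistic obtained from an extended real-valued one; the uniform randomisation
is a real number, clamped to `[0, 1]`. -/
def toRealStatistic {E : Type*} (W : E × E × I → EReal) (z z₀ : E) (v : ℝ) : ℝ :=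
  (W (z, z₀, Set.projIcc 0 1 zero_le_one v)).toReal

theorem measurable_toRealStatistic {E : Type*} [MeasurableSpace E] {W : E × E × I → EReal}
    (hW : Measurable W) :
    Measurable fun x : E × E × ℝ => toRealStatistic W x.1 x.2.1 x.2.2 :=
  measurable_ereal_toReal.comp (hW.comp (measurable_fst.prodMk (measurable_snd.fst.prodMk
    (continuous_projIcc.measurable.comp measurable_snd.snd))))

theorem limitExperiment_map_toRealStatistic {h : EuclideanSpace ℝ (Fin m)} {L : Measure (ℝ × ℝ)}
    {W₁ W₂ : EuclideanSpace ℝ (Fin m) × EuclideanSpace ℝ (Fin m) × I → EReal}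
    (hW₁ : Measurable W₁) (hW₂ : Measurable W₂)
    (hL : (shiftExperiment J lam₁ lam₂ lam₁₂ h).map (fun ω => (W₁ (ω.1, ω.2.2), W₂ ω.2)) =
      L.map (Prod.map (↑) (↑))) :
    (limitExperiment J lam₁ lam₂ lam₁₂ h).map (fun ω => (toRealStatistic W₁ ω.1 ω.2.2.1 ω.2.2.2,
      toRealStatistic W₂ ω.2.1 ω.2.2.1 ω.2.2.2)) = L := by
  have h_toReal : Measurable (Prod.map EReal.toReal EReal.toReal) :=
    measurable_ereal_toReal.prodMap measurable_ereal_toReal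
  have h_pair : Measurable fun ω : EuclideanSpace ℝ (Fin m) × EuclideanSpace ℝ (Fin m) ×
      EuclideanSpace ℝ (Fin m) × ℝ => (toRealStatistic W₁ ω.1 ω.2.2.1 ω.2.2.2,
        toRealStatistic W₂ ω.2.1 ω.2.2.1 ω.2.2.2) :=
    ((measurable_toRealStatistic hW₁).comp (measurable_fst.prodMk measurable_snd.snd)).prodMk
      ((measurable_toRealStatistic hW₂).comp measurable_snd)
  calc _ = (shiftExperiment J lam₁ lam₂ lam₁₂ h).map
        (Prod.map EReal.toReal EReal.toReal ∘ fun ω => (W₁ (ω.1, ω.2.2), W₂ ω.2)) := by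
        rw [limitExperiment_eq_map, Measure.map_map h_pair (by fun_prop)]
        congr 1
        funext ω
        simp only [Function.comp_apply, Prod.map, id_eq, toRealStatistic, Set.projIcc_val]
    _ = L.map (Prod.map EReal.toReal EReal.toReal ∘ Prod.map (↑) (↑)) := by
        rw [← Measure.map_map h_toReal (by fun_prop), hL, Measure.map_map h_toReal
          (measurable_coe_real_ereal.prodMap measurable_coe_real_ereal)]
    _ = L := Measure.map_id

theorem exists_statistics_of_tilted_limit (hJ : J.PosDef) (hlam₁ : 0 < lam₁) (hlam₂ : 0 < lam₂)
    (hlam₁₂ : 0 < lam₁₂) {L : EuclideanSpace ℝ (Fin m) → Measure (ℝ × ℝ)}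
    {T₁ T₂ : EuclideanSpace ℝ (Fin m) → EuclideanSpace ℝ (Fin m) → I → EReal}
    (hT₁ : Measurable fun x : EuclideanSpace ℝ (Fin m) × EuclideanSpace ℝ (Fin m) × I =>
      T₁ x.1 x.2.1 x.2.2)
    (hT₂ : Measurable fun x : EuclideanSpace ℝ (Fin m) × EuclideanSpace ℝ (Fin m) × I =>
      T₂ x.1 x.2.1 x.2.2)
    (h_tilt : ∀ h (f₁ f₂ : C(EReal, ℝ≥0)),
      ∫⁻ ω, (f₁ (T₁ ω.1 ω.2.2.1 ω.2.2.2) : ℝ≥0∞) * f₂ (T₂ ω.2.1 ω.2.2.1 ω.2.2.2) *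
          (expTilt h ω.1 * expTilt h ω.2.1 * expTilt h ω.2.2.1)
        ∂((multivariateGaussian 0 (lam₁ • J)).prod ((multivariateGaussian 0 (lam₂ • J)).prod
          ((multivariateGaussian 0 (lam₁₂ • J)).prod (volume : Measure I)))) =
        ENNReal.ofReal (Real.exp ((lam₁ + lam₂ + lam₁₂) * (h ⬝ᵥ J *ᵥ h) / 2)) *
          ∫⁻ y, (f₁ (y.1 : EReal) : ℝ≥0∞) * f₂ (y.2 : EReal) ∂(L h)) :
    ∃ T₁ T₂ : EuclideanSpace ℝ (Fin m) → EuclideanSpace ℝ (Fin m) → ℝ → ℝ,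
      Measurable (fun x : EuclideanSpace ℝ (Fin m) × EuclideanSpace ℝ (Fin m) × ℝ =>
        T₁ x.1 x.2.1 x.2.2) ∧
      Measurable (fun x : EuclideanSpace ℝ (Fin m) × EuclideanSpace ℝ (Fin m) × ℝ =>
        T₂ x.1 x.2.1 x.2.2) ∧
      ∀ h, (limitExperiment J lam₁ lam₂ lam₁₂ h).map
        (fun ω => (T₁ ω.1 ω.2.2.1 ω.2.2.2, T₂ ω.2.1 ω.2.2.1 ω.2.2.2)) = L h := by
  have h_scale (lam : ℝ) : Measurable fun x : EuclideanSpace ℝ (Fin m) × EuclideanSpace ℝ (Fin m) ×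
      I => (toEuclideanCLM (𝕜 := ℝ) (lam • J) x.1,
        toEuclideanCLM (𝕜 := ℝ) (lam₁₂ • J) x.2.1, x.2.2) := by fun_prop
  have hV : Measurable fun ω : EuclideanSpace ℝ (Fin m) × EuclideanSpace ℝ (Fin m) ×
      EuclideanSpace ℝ (Fin m) × I => (T₁ ω.1 ω.2.2.1 ω.2.2.2, T₂ ω.2.1 ω.2.2.1 ω.2.2.2) :=
    (hT₁.comp (measurable_fst.prodMk measurable_snd.snd)).prodMk (hT₂.comp measurable_snd)
  have hW₁ := hT₁.comp (h_scale lam₁)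
  have hW₂ := hT₂.comp (h_scale lam₂)
  exact ⟨toRealStatistic _, toRealStatistic _, measurable_toRealStatistic hW₁,
    measurable_toRealStatistic hW₂, fun h => limitExperiment_map_toRealStatistic hW₁ hW₂
      (map_scaleObs_shiftExperiment_eq hJ hlam₁ hlam₂ hlam₁₂ hV (h_tilt h))⟩

end LimitStatistics

section InfoIndices

theorem infoIndices_union (N N' : Set ℝ) (n : ℕ) :
    infoIndices (N ∪ N') n = infoIndices N n ∪ infoIndices N' n := rfl

theorem disjoint_infoIndices {N N' : Set ℝ} (h : Disjoint N N') (n : ℕ) :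
    Disjoint (infoIndices N n) (infoIndices N' n) :=
  h.preimage _

theorem HasAsymptoticShare.nonneg {N : Set ℝ} {lam : ℝ} (h : HasAsymptoticShare N lam) :
    0 ≤ lam :=
  ge_of_tendsto' h fun _ => by positivity

theorem HasAsymptoticShare.union {N N' : Set ℝ} {lam lam' : ℝ} (h : HasAsymptoticShare N lam)
    (h' : HasAsymptoticShare N' lam') (h_disj : Disjoint N N') :
    HasAsymptoticShare (N ∪ N') (lam + lam') := by
  refine (h.add h').congr fun n => ?_
  rw [infoIndices_union, Set.ncard_union_eq (disjoint_infoIndices h_disj n), Nat.cast_add, add_div]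

end InfoIndices

section LimitSampler

open scoped ENNReal NNReal unitInterval
open Matrix

variable {Z : Type*} [MeasurableSpace Z] {m : ℕ}

theorem IsScoreApprox.exists_hasMarginals_scoreSumLaw {P : Measure Z} [IsProbabilityMeasure P]
    {s : Z → EuclideanSpace ℝ (Fin m)} {u : ℕ → Z → EuclideanSpace ℝ (Fin m)} {δ : ℕ → ℝ}
    (hu : IsScoreApprox P s u δ) {n : ℕ} {A₁ A₂ A₀ : Set (Fin n)} (h₁₂ : Disjoint A₁ A₂)
    (h₁₀ : Disjoint A₁ A₀) (h₂₀ : Disjoint A₂ A₀) {S₁ S₂ : (Fin n → Z) → ℝ} (hS₁ : Measurable S₁)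
    (hS₂ : Measurable S₂) (hS₁A : DependsOn S₁ (A₁ ∪ A₀)) (hS₂A : DependsOn S₂ (A₂ ∪ A₀)) :
    ∃ G : ProbabilityMeasure (LawSpace (Fin m → EReal) EReal),
      HasMarginals G (embLaw (hu.scoreSumLaw A₁)) (embLaw (hu.scoreSumLaw A₂))
        (embLaw (hu.scoreSumLaw A₀)) ∧
      ∀ h (f₁ f₂ : C(EReal, ℝ≥0)), tiltedMean G (extTilt h) f₁ f₂ =
        ∫⁻ z, prodTest f₁ f₂ (S₁ z, S₂ z) * expTilt h (scoreSum u (A₁ ∪ A₂ ∪ A₀) z)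
          ∂(Measure.pi fun _ => P) := by
  have h_emb : Measurable (embEReal (m := m)) := continuous_embEReal.measurable
  have h_sum (A : Set (Fin n)) : Measurable (embEReal ∘ scoreSum u A) :=
    h_emb.comp (hu.measurable_scoreSum A)
  have h_dep (A : Set (Fin n)) : DependsOn (embEReal ∘ scoreSum u A) A :=
    fun x y hxy => congrArg embEReal (dependsOn_scoreSum u A hxy)
  have h_law (A : Set (Fin n)) : (iidLaw (Fin n) P).map (h_sum A).aemeasurable =
      embLaw (hu.scoreSumLaw A) :=
    Subtype.ext (Measure.map_map h_emb (hu.measurable_scoreSum A)).symm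
  obtain ⟨G, hG, h_mean⟩ := exists_hasMarginals_tiltedMean_eq P h₁₂ h₁₀ h₂₀ (h_sum A₁) (h_sum A₂)
    (h_sum A₀) (h_dep A₁) (h_dep A₂) (h_dep A₀) (measurable_coe_real_ereal.comp hS₁)
    (measurable_coe_real_ereal.comp hS₂) (fun x y hxy => congrArg Real.toEReal (hS₁A hxy))
    (fun x y hxy => congrArg Real.toEReal (hS₂A hxy))
  simp only [h_law] at hG
  refine ⟨G, hG, fun h f₁ f₂ => ?_⟩
  rw [h_mean _ f₁ f₂ (measurable_extTilt h) f₁.continuous.measurable f₂.continuous.measurable]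
  simp only [Function.comp_apply, extTilt_embEReal, coe_prodTest, expTilt_add,
    scoreSum_union u (Disjoint.union_left h₁₀ h₂₀), scoreSum_union u h₁₂]

theorem exists_limit_sampler_of_pairConvergesInLaw {μ : Measure Z}
    {Θ : Set (EuclideanSpace ℝ (Fin m))} {p : EuclideanSpace ℝ (Fin m) → Z → ℝ}
    (hp : IsDensityFamily μ Θ p) {θ₀ : EuclideanSpace ℝ (Fin m)} (hθ₀ : θ₀ ∈ interior Θ)
    {s : Z → EuclideanSpace ℝ (Fin m)} (hs : IsDQM μ p θ₀ s)
    {N₁ N₂ N₀ : Set ℝ} (h₁₂ : Disjoint N₁ N₂) (h₁₀ : Disjoint N₁ N₀) (h₂₀ : Disjoint N₂ N₀)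
    {lam₁ lam₂ lam₀ : ℝ} (hN₁ : HasAsymptoticShare N₁ lam₁) (hN₂ : HasAsymptoticShare N₂ lam₂)
    (hN₀ : HasAsymptoticShare N₀ lam₀) {S₁ S₂ : ∀ n : ℕ, (Fin n → Z) → ℝ}
    (hS₁ : ∀ n, Measurable (S₁ n)) (hS₂ : ∀ n, Measurable (S₂ n))
    (hS₁N : ∀ n, DependsOn (S₁ n) (infoIndices (N₁ ∪ N₀) n))
    (hS₂N : ∀ n, DependsOn (S₂ n) (infoIndices (N₂ ∪ N₀) n))
    {L : EuclideanSpace ℝ (Fin m) → Measure (ℝ × ℝ)} [∀ h, IsFiniteMeasure (L h)]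
    (hconv : ∀ h, PairConvergesInLaw (fun n => sampleLaw μ p n (localParam θ₀ h n)) S₁ S₂ (L h)) :
    ∃ T₁ T₂ : EuclideanSpace ℝ (Fin m) → EuclideanSpace ℝ (Fin m) → I → EReal,
      Measurable (fun x : EuclideanSpace ℝ (Fin m) × EuclideanSpace ℝ (Fin m) × I =>
        T₁ x.1 x.2.1 x.2.2) ∧
      Measurable (fun x : EuclideanSpace ℝ (Fin m) × EuclideanSpace ℝ (Fin m) × I =>
        T₂ x.1 x.2.1 x.2.2) ∧
      ∀ h (f₁ f₂ : C(EReal, ℝ≥0)),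
        ∫⁻ ω, (f₁ (T₁ ω.1 ω.2.2.1 ω.2.2.2) : ℝ≥0∞) * f₂ (T₂ ω.2.1 ω.2.2.1 ω.2.2.2) *
            (expTilt h ω.1 * expTilt h ω.2.1 * expTilt h ω.2.2.1)
          ∂((multivariateGaussian 0 (lam₁ • fisherInfo μ p θ₀ s)).prod
            ((multivariateGaussian 0 (lam₂ • fisherInfo μ p θ₀ s)).prod
              ((multivariateGaussian 0 (lam₀ • fisherInfo μ p θ₀ s)).prod
                (volume : Measure I)))) =
          ENNReal.ofReal (Real.exp
            ((lam₁ + lam₂ + lam₀) * (h ⬝ᵥ fisherInfo μ p θ₀ s *ᵥ h) / 2)) *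
            ∫⁻ y, (f₁ (y.1 : EReal) : ℝ≥0∞) * f₂ (y.2 : EReal) ∂(L h) := by
  have := hp.isProbabilityMeasure_obsLaw (interior_subset hθ₀)
  have hs2 := hs.memLp_score hp hθ₀
  obtain ⟨u, δ, hu⟩ := exists_isScoreApprox (obsLaw μ p θ₀) hs.1 hs2 (hs.integral_score hp hθ₀)
  have h_tilt {N : Set ℝ} {lam : ℝ} (hN : HasAsymptoticShare N lam) :=
    hu.tiltConvergence ((posSemidef_fisherInfo hs2).smul hN.nonneg) (lam := lam) (fun h => by
      rw [integral_inner_sq_eq_fisherInfo hs2, smul_mulVec, dotProduct_smul, smul_eq_mul]) hN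
  choose G hG h_mean using fun n => hu.exists_hasMarginals_scoreSumLaw
    (disjoint_infoIndices h₁₂ n) (disjoint_infoIndices h₁₀ n) (disjoint_infoIndices h₂₀ n)
    (hS₁ n) (hS₂ n) (hS₁N n) (hS₂N n)
  refine exists_limit_sampler (h_tilt hN₁) (h_tilt hN₂) (h_tilt hN₀) hG fun h f₁ f₂ => ?_
  simp only [h_mean, ← coe_prodTest, ← integral_inner_sq_eq_fisherInfo hs2]
  refine (hconv h).tendsto_lintegral_mul_expTilt_scoreSum hp hθ₀ hs hu h
    ((hN₁.union hN₂ h₁₂).union hN₀ (Disjoint.union_left h₁₀ h₂₀)) hS₁ hS₂ (fun n => ?_)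
    (fun n => ?_) (prodTest f₁ f₂)
  · exact (hS₁N n).mono (Set.union_subset_union_left _ Set.subset_union_left)
  · exact (hS₂N n).mono (Set.union_subset_union_left _ Set.subset_union_right)

end LimitSampler

end

theorem theorem1 {Z : Type*} [MeasurableSpace Z] {m : ℕ} (μ : Measure Z)
    (Θ : Set (EuclideanSpace ℝ (Fin m))) (p : EuclideanSpace ℝ (Fin m) → Z → ℝ)
    (hp : IsDensityFamily μ Θ p)
    (θ₀ : EuclideanSpace ℝ (Fin m)) (hθ₀ : θ₀ ∈ interior Θ)
    (s : Z → EuclideanSpace ℝ (Fin m)) (hs : IsDQM μ p θ₀ s)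
    (hJ : IsUnit (fisherInfo μ p θ₀ s).det)
    (I₁ I₂ : Set ℝ) (hI₁ : I₁ ⊆ Set.Icc 0 1) (hI₂ : I₂ ⊆ Set.Icc 0 1)
    (lam₁ lam₂ lam₁₂ : ℝ)
    (hlam₁ : 0 < lam₁) (hlam₂ : 0 < lam₂) (hlam₁₂ : 0 < lam₁₂)
    (hN₁ : HasAsymptoticShare (I₁ ∩ I₂ᶜ) lam₁)
    (hN₂ : HasAsymptoticShare (I₂ ∩ I₁ᶜ) lam₂)
    (hN₁₂ : HasAsymptoticShare (I₁ ∩ I₂) lam₁₂)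
    (S₁ S₂ : ∀ n : ℕ, (Fin n → Z) → ℝ)
    (hS₁ : ∀ n, Measurable (S₁ n)) (hS₂ : ∀ n, Measurable (S₂ n))
    (hS₁I : ∀ n, DependsOn (S₁ n) (infoIndices I₁ n))
    (hS₂I : ∀ n, DependsOn (S₂ n) (infoIndices I₂ n))
    (L : EuclideanSpace ℝ (Fin m) → Measure (ℝ × ℝ)) (hL : ∀ h, IsProbabilityMeasure (L h))
    (hconv : ∀ h, PairConvergesInLaw (fun n => sampleLaw μ p n (localParam θ₀ h n)) S₁ S₂ (L h)) :
    ∃ T₁ T₂ : EuclideanSpace ℝ (Fin m) → EuclideanSpace ℝ (Fin m) → ℝ → ℝ,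
      Measurable (fun x : EuclideanSpace ℝ (Fin m) × EuclideanSpace ℝ (Fin m) × ℝ =>
        T₁ x.1 x.2.1 x.2.2) ∧
      Measurable (fun x : EuclideanSpace ℝ (Fin m) × EuclideanSpace ℝ (Fin m) × ℝ =>
        T₂ x.1 x.2.1 x.2.2) ∧
      ∀ h : EuclideanSpace ℝ (Fin m),
        (limitExperiment (fisherInfo μ p θ₀ s) lam₁ lam₂ lam₁₂ h).map
          (fun ω => (T₁ ω.1 ω.2.2.1 ω.2.2.2, T₂ ω.2.1 ω.2.2.1 ω.2.2.2)) = L h := by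
  have h_restrict {I I' : Set ℝ} {S : ∀ n : ℕ, (Fin n → Z) → ℝ}
      (hS : ∀ n, DependsOn (S n) (infoIndices I n)) (n : ℕ) :
      DependsOn (S n) (infoIndices (I ∩ I'ᶜ ∪ I ∩ I') n) := by
    rw [Set.union_comm, Set.inter_union_compl]
    exact hS n
  have h_disj (I I' : Set ℝ) : Disjoint (I ∩ I'ᶜ) I' := disjoint_compl_left.mono_left inf_le_right
  obtain ⟨T₁, T₂, hT₁, hT₂, h_tilt⟩ := exists_limit_sampler_of_pairConvergesInLaw hp hθ₀ hs
    ((h_disj I₁ I₂).mono_right Set.inter_subset_left)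
    ((h_disj I₁ I₂).mono_right Set.inter_subset_right)
    ((h_disj I₂ I₁).mono_right Set.inter_subset_left) hN₁ hN₂ hN₁₂ hS₁ hS₂ (h_restrict hS₁I)
    (by simpa only [Set.inter_comm I₁] using h_restrict hS₂I) hconv
  exact exists_statistics_of_tilted_limit (posDef_fisherInfo (hs.memLp_score hp hθ₀) hJ)
    hlam₁ hlam₂ hlam₁₂ hT₁ hT₂ h_tilt
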